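/- Fix $\sigma>0$ and real constants $m_5,c_3$. For $N\ge 1$ let $X_N=N^{-1/2}W_N$, where $W_N$ is a random $N\times N$ matrix of one of the following two kinds. (Real symmetric case) $W_N$ is real symmetric, the entries $(W_N)_{ij}$, $1\le i\le j\le N$, are jointly independent and centered, $\mathbb V (W_N)_{ij}=\sigma^2$ and $\mathbb E|(W_N)_{ij}|^5\le m_5$ for $i\neq j$, and $\mathbb E|(W_N)_{ii}|^3\le c_3$ for all $i$. (Hermitian case) $W_N$ is Hermitian, the random variables $\Re (W_N)_{ij},\Im (W_N)_{ij}$ $(1\le i<j\le N)$ and $(W_N)_{ii}$ $(1\le i\le N)$ are jointly independent and centered, $\mathbb V[\Re (W_N)_{ij}]=\mathbb V[\Im (W_N)_{ij}]=\sigma^2/2$ and $\mathbb E|(W_N)_{ij}|^5\le m_5$ for $i\ne j$, and $\mathbb E|(W_N)_{ii}|^3\le c_3$ for all $i$. Let $R_N(z)=(zI_N-X_N)^{-1}$ for $z\in\mathbb C\setminus\mathbb R$, and let $$g_\sigma(z)=\int\frac{d\mu_{sc}(x)}{z-x},\qquad \frac{d\mu_{sc}}{dx}(x)=\frac{1}{2\pi\sigma^2}\sqrt{4\sigma^2-x^2}\,\mathbf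 1_{[-2\sigma,2\sigma]}(x),$$ be the Stieltjes transform of the semicircle law. Let $\langle u,v\rangle=\sum_i\overline{u_i}v_i$ on $\mathbb C^N$, and $\mathbb V\xi=\mathbb E|\xi-\mathbb E\xi|^2$ for a complex random variable $\xi$. Then, for nonrandom unit vectors $u,v\in\mathbb C^N$, the random variable $\langle u,R_N(z)v\rangle$ is square integrable and the following hold. 1. For every bounded set $B\subset\mathbb C\setminus\mathbb R$ (which may accumulate at $\mathbb R$), $$\mathbb E\langle u,R_N(z)v\rangle=g_\sigma(z)\langle u,v\rangle+O\!\left(\frac{1}{|\Im z|^{7}\sqrt N}\right)$$ uniformly for $z\in B$. 2. There are a real constant $M$ and a real polynomial $P_8$ of degree $8$ with all coefficients positive such that $$\mathbb E\langle u,R_N(z)v\rangle=g_\sigma(z)\langle u,v\rangle+O\!\left((|z|+M)\frac{P_8(|\Im z|^{-1})}{\sqrt N}\right)$$ uniformly for $z\in\mathbb C\setminus\mathbb R$. 3. There is a real polynomial $P_8$ of degree $8$ with all coefficients positive such that $$\mathbb V\langle u,R_N(z)v\rangle=O\!\left(\frac{P_8(|\Im z|^{-1})}{N}\right)$$ uniformly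 for $z\in\mathbb C\setminus\mathbb R$. The constants implied in $O(\cdot)$, the constant $M$ and the polynomials depend only on $\sigma,m_5,c_3$ (and, in 1, on $B$); in particular they do not depend on $N$, on $u,v$, or on the law of $W_N$ within the class above. -/

import Mathlib

open MeasureTheory ProbabilityTheory

universe u

noncomputable section

namespace WignerResolvent

/-- Density of the semicircle distribution with variance `σ ^ 2`, supported on `[-2σ, 2σ]`. -/
def semicircleDensity (σ x : ℝ) : ℝ :=
  (Set.Icc (-(2 * σ)) (2 * σ)).indicator
    (fun x => 1 / (2 * Real.pi * σ ^ 2) * Real.sqrt (4 * σ ^ 2 - x ^ 2)) x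

/-- The semicircle distribution. -/
def semicircle (σ : ℝ) : Measure ℝ :=
  volume.withDensity (fun x => ENNReal.ofReal (semicircleDensity σ x))

/-- The Stieltjes transform `g_σ(z) = ∫ (z - x)⁻¹ dμ_sc(x)` of the semicircle distribution. -/
def semicircleStieltjes (σ : ℝ) (z : ℂ) : ℂ :=
  ∫ x : ℝ, 1 / (z - (x : ℂ)) ∂(semicircle σ)

/-- `W` is a real symmetric `N × N` Wigner matrix (before normalization by `√N`): the entries on and
above the diagonal are jointly independent and centered, the off-diagonal entries have variance
`σ ^ 2` and fifth absolute moment at most `m₅`, the diagonal entries have third absolute moment at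
most `c₃`. -/
structure IsRealSymmetricWigner {Ω : Type u} [MeasurableSpace Ω] (μ : Measure Ω) {N : ℕ}
    (σ m₅ c₃ : ℝ) (W : Ω → Matrix (Fin N) (Fin N) ℝ) : Prop where
  measurable_entry : ∀ i j, Measurable (fun ω => W ω i j)
  isSymm : ∀ ω, (W ω).IsSymm
  indep : iIndepFun (fun (p : {p : Fin N × Fin N // p.1 ≤ p.2}) ω => W ω p.1.1 p.1.2) μ
  mean_offDiag : ∀ i j, i ≠ j → ∫ ω, W ω i j ∂μ = 0
  variance_offDiag : ∀ i j, i ≠ j → variance (fun ω => W ω i j) μ = σ ^ 2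
  integrable_offDiag : ∀ i j, i ≠ j → Integrable (fun ω => |W ω i j| ^ 5) μ
  moment_offDiag : ∀ i j, i ≠ j → ∫ ω, |W ω i j| ^ 5 ∂μ ≤ m₅
  mean_diag : ∀ i, ∫ ω, W ω i i ∂μ = 0
  integrable_diag : ∀ i, Integrable (fun ω => |W ω i i| ^ 3) μ
  moment_diag : ∀ i, ∫ ω, |W ω i i| ^ 3 ∂μ ≤ c₃

/-- The independent real coordinates of a random Hermitian matrix: the real parts and the imaginary
parts of the entries strictly above the diagonal, and the (real) diagonal entries. -/
def hermitianCoordinates {Ω : Type u} {N : ℕ} (W : Ω → Matrix (Fin N) (Fin N) ℂ) :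
    ({p : Fin N × Fin N // p.1 < p.2} ⊕ {p : Fin N × Fin N // p.1 < p.2}) ⊕ Fin N → Ω → ℝ
  | Sum.inl (Sum.inl p), ω => (W ω p.1.1 p.1.2).re
  | Sum.inl (Sum.inr p), ω => (W ω p.1.1 p.1.2).im
  | Sum.inr i, ω => (W ω i i).re

/-- `W` is a Hermitian `N × N` Wigner matrix (before normalization by `√N`): the real and imaginary
parts of the entries above the diagonal and the diagonal entries are jointly independent and
centered, the real and imaginary parts of off-diagonal entries have variance `σ ^ 2 / 2`, the
off-diagonal entries have fifth absolute moment at most `m₅`, and the diagonal entries have third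
absolute moment at most `c₃`. -/
structure IsHermitianWigner {Ω : Type u} [MeasurableSpace Ω] (μ : Measure Ω) {N : ℕ}
    (σ m₅ c₃ : ℝ) (W : Ω → Matrix (Fin N) (Fin N) ℂ) : Prop where
  measurable_entry : ∀ i j, Measurable (fun ω => W ω i j)
  isHermitian : ∀ ω, (W ω).IsHermitian
  indep : iIndepFun (hermitianCoordinates W) μ
  mean_offDiag : ∀ i j, i ≠ j → ∫ ω, W ω i j ∂μ = 0
  variance_re_offDiag : ∀ i j, i ≠ j → variance (fun ω => (W ω i j).re) μ = σ ^ 2 / 2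
  variance_im_offDiag : ∀ i j, i ≠ j → variance (fun ω => (W ω i j).im) μ = σ ^ 2 / 2
  integrable_offDiag : ∀ i j, i ≠ j → Integrable (fun ω => ‖W ω i j‖ ^ 5) μ
  moment_offDiag : ∀ i j, i ≠ j → ∫ ω, ‖W ω i j‖ ^ 5 ∂μ ≤ m₅
  mean_diag : ∀ i, ∫ ω, W ω i i ∂μ = 0
  integrable_diag : ∀ i, Integrable (fun ω => ‖W ω i i‖ ^ 3) μ
  moment_diag : ∀ i, ∫ ω, ‖W ω i i‖ ^ 3 ∂μ ≤ c₃

/-- A Wigner matrix, real symmetric (viewed as a complex matrix) or Hermitian. -/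
def IsWigner {Ω : Type u} [MeasurableSpace Ω] (μ : Measure Ω) {N : ℕ}
    (σ m₅ c₃ : ℝ) (W : Ω → Matrix (Fin N) (Fin N) ℂ) : Prop :=
  (∃ V : Ω → Matrix (Fin N) (Fin N) ℝ, IsRealSymmetricWigner μ σ m₅ c₃ V ∧
    ∀ ω, W ω = (V ω).map Complex.ofReal) ∨
  IsHermitianWigner μ σ m₅ c₃ W

/-- The resolvent `R_N(z) = (z I - X_N)⁻¹` of the normalized matrix `X_N = W / √N`. -/
def resolventMatrix {N : ℕ} (W : Matrix (Fin N) (Fin N) ℂ) (z : ℂ) : Matrix (Fin N) (Fin N) ℂ :=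
  (z • (1 : Matrix (Fin N) (Fin N) ℂ) - ((1 / Real.sqrt N : ℝ) : ℂ) • W)⁻¹

/-- The sesquilinear form `⟨u, R_N(z) v⟩ = ∑ i j, conj (u i) * R_N(z) i j * v j`. -/
def resolventForm {N : ℕ} (W : Matrix (Fin N) (Fin N) ℂ) (u v : EuclideanSpace ℂ (Fin N))
    (z : ℂ) : ℂ :=
  inner ℂ u (Matrix.toEuclideanLin (resolventMatrix W z) v)

/-- The variance `E |ξ - E ξ|²` of a complex random variable. -/
def complexVariance {Ω : Type u} [MeasurableSpace Ω] (μ : Measure Ω) (ξ : Ω → ℂ) : ℝ :=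
  ∫ ω, ‖ξ ω - ∫ ω', ξ ω' ∂μ‖ ^ 2 ∂μ

/-- A real polynomial of degree `l` all of whose `l + 1` coefficients are positive. -/
def IsPositivePolynomial (l : ℕ) (P : Polynomial ℝ) : Prop :=
  P.natDegree = l ∧ ∀ k ≤ l, 0 < P.coeff k

end WignerResolvent

end

namespace WignerResolvent

/-! Write `η = |Im z|`, `x = 1/η`, `t = N^{-1/2}` and `F = ⟨u, R v⟩`. Three facts carry the proof:
the resolvent is bounded by `1/η`; changing one entry changes it by the resolvent identity; a matrix
with that entry deleted is independent of the entry. Both symmetry classes are treated at once by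
`IsWignerModel`, which records `E|w|² = σ²`, `E w² = τ` and a few absolute moments.

Variance. Efron–Stein with replacement by zero (`efronStein`) bounds `Var F` by the sum over entries
of `E|F - F⁽ⁱʲ⁾|²`, the superscript meaning deletion. To leading order the difference is `t (x_i w
y_j + x_j w̄ y_i)`, where `x = u R⁽ⁱʲ⁾` and `y = R⁽ⁱʲ⁾ v`, so independence factors out the moments
of `w`. The remaining vectors depend on `(i, j)` and cannot be summed directly.
`IsWignerModel.integral_zeroOut_le` repairs this: with probability at least `1/2` the entry is at
most `2L`, on that event the coordinates with and without the entry are comparable, and by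
independence the event costs only a factor `2`. Now `∑ |(uR)_i|²` and `∑ |(Rv)_j|²` are at most
`1/η²`, which gives `O((x⁴ + x⁶)/N)` in `IsWignerModel.variance_form_le`.

Mean. Take expectations in `zR = 1 + XR` and expand each `E[w_ik (Rv)_k]` to second order in `w_ik`.
The zeroth term vanishes by centering, the first produces `σ²` times the normalized trace times `F`
and a term with `τ` of size `O(1/N)`, and the rest is summed with the same comparison. Replacing the
mean of the product of trace and `F` by the product of means costs a covariance, controlled by the
variance bound. With `h` the mean normalized trace, `(z - σ²h) E F = ⟨u, v⟩ + O(t (x² + x⁵))`;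
averaging over the basis vectors, `h` satisfies the semicircle equation up to the same error.

Stability. Both `h` and `g_σ` lie in the half plane opposite to `z`, so `z - σ²h` and `z - σ²(h +
g_σ)` have modulus at least `η`. Subtracting the equations gives `E F - g_σ⟨u, v⟩ = O(t (x³ + x⁷))`
on the whole of `ℂ \ ℝ`. The perturbative argument needs `2Lt ≤ η`; otherwise `x` is so large that
trivial bounds suffice. -/

/-! ### The Stieltjes transform of the semicircle law -/

open Complex in
-- The integrand is `(P(e^{iθ}) + P(e^{-iθ})) / 4` with `P(ζ) = (1 - ζ²)/(1 - wζ)`. Folding the two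
-- halves together gives a quarter of the integral of `P` over the full circle, and the mean value
-- property evaluates that as `2π P(0) = 2π`.
theorem integral_sin_sq_div_eq {w : ℂ} (hw : ‖w‖ < 1) :
    ∫ θ in (0 : ℝ)..Real.pi, (Real.sin θ : ℂ) ^ 2 / (1 + w ^ 2 - 2 * w * Real.cos θ)
      = (Real.pi / 2 : ℂ) := by
  set P : ℂ → ℂ := fun ζ => (1 - ζ ^ 2) / (1 - w * ζ) with hP
  have hne : ∀ ζ : ℂ, ‖ζ‖ ≤ 1 → 1 - w * ζ ≠ 0 := by
    intro ζ hζ h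
    have h1 : w * ζ = 1 := by linear_combination -h
    have h2 : ‖w * ζ‖ = 1 := by rw [h1]; simp
    rw [norm_mul] at h2
    nlinarith [norm_nonneg w, norm_nonneg ζ]
  have hPc : Continuous fun θ : ℝ => P (circleMap 0 1 θ) := by
    refine Continuous.div ?_ ?_ fun θ => hne _ (by simp)
    · fun_prop
    · fun_prop
  have havg : Real.circleAverage P 0 1 = 1 := by
    have : DiffContOnCl ℂ P (Metric.ball 0 |1|) := by
      refine DifferentiableOn.diffContOnCl ?_
      intro ζ hζ
      have hζ' : ‖ζ‖ ≤ 1 := by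
        rw [closure_ball _ (by norm_num)] at hζ
        simpa using hζ
      refine DifferentiableAt.differentiableWithinAt ?_
      refine DifferentiableAt.div ?_ ?_ (hne ζ hζ') <;> fun_prop
    rw [this.circleAverage]
    simp [hP]
  have hint : ∫ θ in (0 : ℝ)..2 * Real.pi, P (circleMap 0 1 θ) = 2 * Real.pi := by
    have h2 : (2 * Real.pi : ℝ) ≠ 0 := by positivity
    rw [Real.circleAverage_def] at havg
    have := congrArg (fun x : ℂ => (2 * Real.pi : ℝ) • x) havg
    simp only [smul_smul, mul_inv_cancel₀ h2, one_smul] at this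
    rw [this]
    simp
  have hrefl : ∫ θ in (0 : ℝ)..Real.pi, P (circleMap 0 1 (2 * Real.pi - θ))
      = ∫ θ in Real.pi..2 * Real.pi, P (circleMap 0 1 θ) := by
    rw [intervalIntegral.integral_comp_sub_left (fun θ => P (circleMap 0 1 θ))]
    congr 1 <;> ring
  have hpt : ∀ θ : ℝ, (Real.sin θ : ℂ) ^ 2 / (1 + w ^ 2 - 2 * w * Real.cos θ)
      = (1 / 4) * (P (circleMap 0 1 θ) + P (circleMap 0 1 (2 * Real.pi - θ))) := by
    intro θ
    have he : circleMap 0 1 θ = exp (θ * I) := by simp [circleMap]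
    have he' : circleMap 0 1 (2 * Real.pi - θ) = exp (-(θ * I)) := by
      simp only [circleMap, zero_add, ofReal_one, one_mul]
      rw [show ((2 * Real.pi - θ : ℝ) : ℂ) * I = 2 * Real.pi * I + -(θ * I) by push_cast; ring,
        exp_add, exp_two_pi_mul_I, one_mul]
    have h1 := hne (exp (θ * I)) (by rw [norm_exp_ofReal_mul_I])
    have h2 := hne (exp (-(θ * I))) (by
      rw [show -((θ : ℂ) * I) = ((-θ : ℝ) : ℂ) * I by push_cast; ring, norm_exp_ofReal_mul_I])
    have hs : (Real.sin θ : ℂ) = (exp (-(θ * I)) - exp (θ * I)) * I / 2 := by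
      rw [ofReal_sin, Complex.sin]; ring_nf
    have hc : (Real.cos θ : ℂ) = (exp (θ * I) + exp (-(θ * I))) / 2 := by
      rw [ofReal_cos, Complex.cos]; ring_nf
    have hee : exp (θ * I) * exp (-(θ * I)) = 1 := by rw [← exp_add]; simp
    rw [hs, hc, he, he']
    simp only [hP]
    generalize exp (θ * I) = a at *
    generalize exp (-(θ * I)) = b at *
    have hD : 1 + w ^ 2 - 2 * w * ((a + b) / 2) = (1 - w * a) * (1 - w * b) := by
      linear_combination (-w ^ 2) * hee
    rw [hD, div_add_div _ _ h1 h2, ← mul_div_assoc]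
    congr 1
    have hI : I ^ 2 = -1 := I_sq
    linear_combination (1 / 4 * (2 - w * (a + b))) * hee + (b - a) ^ 2 / 4 * hI
  rw [intervalIntegral.integral_congr (fun θ _ => hpt θ),
    intervalIntegral.integral_const_mul, intervalIntegral.integral_add, hrefl,
    intervalIntegral.integral_add_adjacent_intervals, hint]
  · ring
  · exact hPc.intervalIntegrable _ _
  · exact hPc.intervalIntegrable _ _
  · exact hPc.intervalIntegrable _ _
  · exact (hPc.comp (by fun_prop : Continuous fun θ : ℝ => 2 * Real.pi - θ)).intervalIntegrable _ _

/-- The inverse Joukowski map. -/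
theorem exists_joukowski {ζ : ℂ} (hζ : ζ.im ≠ 0) :
    ∃ w : ℂ, w ≠ 0 ∧ ‖w‖ < 1 ∧ ζ = w + w⁻¹ := by
  obtain ⟨w, hw⟩ : ∃ w : ℂ, w ^ 2 - ζ * w + 1 = 0 := by
    obtain ⟨s, hs⟩ := IsAlgClosed.exists_pow_nat_eq (ζ ^ 2 - 4) (n := 2) (by norm_num)
    exact ⟨(ζ + s) / 2, by linear_combination (1 / 4) * hs⟩
  have hw0 : w ≠ 0 := by rintro rfl; simp at hw
  have hsum : ζ = w + w⁻¹ := by field_simp; linear_combination -hw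
  -- The two roots are mutually inverse, so one lies in the open disc unless both are on the unit
  -- circle, where `w + w⁻¹ = 2 Re w` would be real.
  rcases lt_trichotomy ‖w‖ 1 with h | h | h
  · exact ⟨w, hw0, h, hsum⟩
  · exfalso
    apply hζ
    have hn : Complex.normSq w = 1 := by rw [Complex.normSq_eq_norm_sq, h]; norm_num
    rw [hsum, Complex.add_im, Complex.inv_im, hn]
    ring
  · refine ⟨w⁻¹, inv_ne_zero hw0, ?_, by rw [inv_inv, add_comm]; exact hsum⟩
    rw [norm_inv]
    exact inv_lt_one_of_one_lt₀ h

theorem semicircleStieltjes_eq_intervalIntegral {σ : ℝ} (hσ : 0 < σ) (z : ℂ) :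
    semicircleStieltjes σ z = ∫ x in (-(2 * σ))..(2 * σ),
      ((1 / (2 * Real.pi * σ ^ 2) * Real.sqrt (4 * σ ^ 2 - x ^ 2) : ℝ) : ℂ) * (1 / (z - x)) := by
  have hmeas : Measurable fun x => ENNReal.ofReal (semicircleDensity σ x) := by
    apply Measurable.ennreal_ofReal
    unfold semicircleDensity
    exact Measurable.indicator (by fun_prop) measurableSet_Icc
  have hpos : ∀ x, 0 ≤ semicircleDensity σ x := by
    intro x
    unfold semicircleDensity
    apply Set.indicator_nonneg
    intro x _
    positivity
  unfold semicircleStieltjes semicircle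
  rw [integral_withDensity_eq_integral_toReal_smul hmeas (by simp),
    intervalIntegral.integral_of_le (by linarith), ← integral_Icc_eq_integral_Ioc,
    ← integral_indicator measurableSet_Icc]
  congr 1
  ext x
  rw [ENNReal.toReal_ofReal (hpos x)]
  unfold semicircleDensity
  by_cases hx : x ∈ Set.Icc (-(2 * σ)) (2 * σ)
  · simp [hx]
  · simp [hx]

/-- Under `x = -2σ cos θ` the density becomes a multiple of `sin θ` and `z - x` becomes `(σ/w)(1 +
w² + 2w cos θ)`, which is the integral of `integral_sin_sq_div_eq` at `-w`. The minus sign makes the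
substitution increasing on `[0, π]`. -/
theorem semicircleStieltjes_joukowski {σ : ℝ} (hσ : 0 < σ) {z : ℂ} (hz : z.im ≠ 0) {w : ℂ}
    (hw0 : w ≠ 0) (hw : ‖w‖ < 1) (hzw : z = σ * (w + w⁻¹)) :
    semicircleStieltjes σ z = w / σ := by
  rw [semicircleStieltjes_eq_intervalIntegral hσ]
  set G : ℝ → ℂ := fun x =>
    ((1 / (2 * Real.pi * σ ^ 2) * Real.sqrt (4 * σ ^ 2 - x ^ 2) : ℝ) : ℂ) * (1 / (z - x)) with hG
  have hzx : ∀ x : ℝ, z - x ≠ 0 := by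
    intro x h
    apply hz
    have := congrArg Complex.im h
    simpa using this
  have hGc : Continuous G := by
    refine Continuous.mul (Complex.continuous_ofReal.comp (by fun_prop)) ?_
    exact Continuous.div (by fun_prop) (by fun_prop) hzx
  have hsub := intervalIntegral.integral_deriv_smul_comp (a := 0) (b := Real.pi)
    (f := fun θ => -(2 * σ) * Real.cos θ) (f' := fun θ => 2 * σ * Real.sin θ) (g := G)
    (fun x _ => by
      have := (Real.hasDerivAt_cos x).const_mul (-(2 * σ))
      simpa using this)
    (by fun_prop) hGc
  simp only [Real.cos_zero, mul_one, Real.cos_pi, mul_neg, neg_neg] at hsub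
  rw [← hsub]
  have hσ' : (σ : ℂ) ≠ 0 := by exact_mod_cast hσ.ne'
  have hpi : (Real.pi : ℂ) ≠ 0 := by exact_mod_cast Real.pi_ne_zero
  have hpt : ∀ θ ∈ Set.uIcc 0 Real.pi, (2 * σ * Real.sin θ) • (G ∘ fun θ => -(2 * σ) * Real.cos θ) θ
      = (2 * w / (σ * Real.pi)) *
        ((Real.sin θ : ℂ) ^ 2 / (1 + (-w) ^ 2 - 2 * (-w) * Real.cos θ)) := by
    intro θ hθ
    rw [Set.uIcc_of_le Real.pi_pos.le] at hθ
    have hs := Real.sin_nonneg_of_mem_Icc hθ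
    have hsq : Real.sqrt (4 * σ ^ 2 - (-(2 * σ) * Real.cos θ) ^ 2) = 2 * σ * Real.sin θ := by
      rw [show 4 * σ ^ 2 - (-(2 * σ) * Real.cos θ) ^ 2 = (2 * σ * Real.sin θ) ^ 2 by
        have := Real.sin_sq_add_cos_sq θ
        linear_combination (-4 * σ ^ 2) * this]
      exact Real.sqrt_sq (by positivity)
    have hd := hzx (-(2 * σ) * Real.cos θ)
    have hden : z - ((-(2 * σ) * Real.cos θ : ℝ) : ℂ)
        = (σ / w) * (1 + (-w) ^ 2 - 2 * (-w) * Real.cos θ) := by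
      rw [hzw]
      push_cast
      field_simp
      ring
    have hd' : (1 + (-w) ^ 2 - 2 * (-w) * (Real.cos θ : ℂ)) ≠ 0 := by
      intro h
      rw [hden, h, mul_zero] at hd
      exact hd rfl
    simp only [hG, Function.comp_apply, Complex.real_smul]
    rw [hsq, hden]
    push_cast at hd' ⊢
    generalize (1 + (-w) ^ 2 - 2 * (-w) * Complex.cos θ) = D at *
    field_simp
  rw [intervalIntegral.integral_congr hpt, intervalIntegral.integral_const_mul,
    integral_sin_sq_div_eq (by simpa using hw)]
  field_simp

/-- The semicircle Stieltjes transform solves its self-consistent equation, is bounded by `1 / σ`,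
and maps each half plane to the opposite one. -/
theorem semicircleStieltjes_spec {σ : ℝ} (hσ : 0 < σ) {z : ℂ} (hz : z.im ≠ 0) :
    semicircleStieltjes σ z * (z - σ ^ 2 * semicircleStieltjes σ z) = 1 ∧
    ‖semicircleStieltjes σ z‖ ≤ 1 / σ ∧ z.im * (semicircleStieltjes σ z).im ≤ 0 := by
  have hσ' : (σ : ℂ) ≠ 0 := by exact_mod_cast hσ.ne'
  obtain ⟨w, hw0, hw, h⟩ := exists_joukowski (ζ := z / σ) (by
    rw [Complex.div_ofReal_im]
    exact div_ne_zero hz hσ.ne')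
  have hzw : z = σ * (w + w⁻¹) := by rw [← h]; field_simp
  rw [semicircleStieltjes_joukowski hσ hz hw0 hw hzw]
  refine ⟨?_, ?_, ?_⟩
  · rw [hzw]; field_simp; ring
  · rw [norm_div, Complex.norm_real, Real.norm_of_nonneg hσ.le]
    gcongr
  · have h1 : z.im = σ * (w.im - w.im / Complex.normSq w) := by
      rw [hzw, Complex.im_ofReal_mul, Complex.add_im, Complex.inv_im]; ring
    have hn : 0 < Complex.normSq w := Complex.normSq_pos.2 hw0
    have hn1 : Complex.normSq w ≤ 1 := by
      rw [Complex.normSq_eq_norm_sq]; nlinarith [norm_nonneg w]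
    rw [Complex.div_ofReal_im, h1]
    have h2 : 1 ≤ 1 / Complex.normSq w := by rw [le_div_iff₀ hn]; linarith
    have h3 : σ * (w.im - w.im / Complex.normSq w) * (w.im / σ)
        = w.im ^ 2 * (1 - 1 / Complex.normSq w) := by
      field_simp
    rw [h3]
    exact mul_nonpos_of_nonneg_of_nonpos (sq_nonneg _) (by linarith)

/-! ### Deterministic bounds for the resolvent -/

open Matrix

section Resolvent

variable {N : ℕ} {W W' : Matrix (Fin N) (Fin N) ℂ} {z : ℂ}

/-- The normalization `1 / √N` of a Wigner matrix. -/
noncomputable def scale (N : ℕ) : ℝ := 1 / Real.sqrt N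

theorem scale_nonneg (N : ℕ) : 0 ≤ scale N := by unfold scale; positivity

theorem scale_pos [NeZero N] : 0 < scale N := by
  have : (0 : ℝ) < N := by exact_mod_cast Nat.pos_of_neZero N
  unfold scale; positivity

theorem scale_le_one [NeZero N] : scale N ≤ 1 := by
  have : (1 : ℝ) ≤ N := by exact_mod_cast Nat.one_le_iff_ne_zero.2 (NeZero.ne N)
  unfold scale
  rw [div_le_one (by positivity)]
  exact Real.one_le_sqrt.2 this

theorem scale_sq (N : ℕ) : scale N ^ 2 = 1 / N := by
  unfold scale
  rw [div_pow, Real.sq_sqrt (Nat.cast_nonneg N), one_pow]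

theorem natCast_mul_scale_sq [NeZero N] : N * scale N ^ 2 = 1 := by
  have : (N : ℝ) ≠ 0 := by exact_mod_cast NeZero.ne N
  rw [scale_sq]; field_simp

theorem resolventMatrix_def (W : Matrix (Fin N) (Fin N) ℂ) (z : ℂ) :
    resolventMatrix W z = (z • (1 : Matrix (Fin N) (Fin N) ℂ) - (scale N : ℂ) • W)⁻¹ := rfl

/-- Since `⟨x, Wx⟩` is real, the imaginary part of `⟨x, (z - X)x⟩` is `Im z ‖x‖²`; then apply
Cauchy–Schwarz. Both the invertibility of `z - X` and the norm bound on its inverse follow from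
this. -/
theorem abs_im_mul_norm_le (hW : W.IsHermitian) (z : ℂ) (x : EuclideanSpace ℂ (Fin N)) :
    |z.im| * ‖x‖ ≤ ‖toEuclideanLin (z • (1 : Matrix (Fin N) (Fin N) ℂ) - (scale N : ℂ) • W) x‖ := by
  have hsymm := isSymmetric_toEuclideanLin_iff.2 hW
  have h1 : inner ℂ x (toEuclideanLin (z • (1 : Matrix (Fin N) (Fin N) ℂ) - (scale N : ℂ) • W) x)
      = z * ((‖x‖ ^ 2 : ℝ) : ℂ) - scale N * inner ℂ x (toEuclideanLin W x) := by
    rw [map_sub, map_smul, map_smul, LinearMap.sub_apply, LinearMap.smul_apply,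
      LinearMap.smul_apply, inner_sub_right, inner_smul_right, inner_smul_right]
    congr 2
    rw [toLpLin_one, LinearMap.id_apply, inner_self_eq_norm_sq_to_K]
    norm_num
  have h2 : (inner ℂ x (toEuclideanLin W x)).im = 0 := hsymm.im_inner_self_apply x
  have h3 := congrArg Complex.im h1
  rw [Complex.sub_im, Complex.im_mul_ofReal, Complex.im_ofReal_mul, h2, mul_zero, sub_zero] at h3
  have h4 := (Complex.abs_im_le_norm _).trans (norm_inner_le_norm (𝕜 := ℂ) x
    (toEuclideanLin (z • (1 : Matrix (Fin N) (Fin N) ℂ) - (scale N : ℂ) • W) x))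
  rw [h3, abs_mul, abs_of_nonneg (sq_nonneg ‖x‖)] at h4
  rcases (norm_nonneg x).eq_or_lt with h0 | h0
  · rw [← h0, mul_zero]; exact norm_nonneg _
  · refine le_of_mul_le_mul_left ?_ h0
    nlinarith

theorem isUnit_resolvent (hW : W.IsHermitian) (hz : z.im ≠ 0) :
    IsUnit (z • (1 : Matrix (Fin N) (Fin N) ℂ) - (scale N : ℂ) • W) := by
  rw [← mulVec_injective_iff_isUnit]
  refine (injective_iff_map_eq_zero (Matrix.mulVecLin _)).2 fun x hx => ?_
  have h := abs_im_mul_norm_le hW z (WithLp.toLp 2 x)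
  rw [toLpLin_toLp] at h
  have hx' : (z • (1 : Matrix (Fin N) (Fin N) ℂ) - (scale N : ℂ) • W) *ᵥ x = 0 := hx
  rw [toLin'_apply, hx'] at h
  have h0 : ‖(WithLp.toLp 2 x : EuclideanSpace ℂ (Fin N))‖ ≤ 0 := by
    have := abs_pos.2 hz
    by_contra hc
    push Not at hc
    have := mul_pos this hc
    simp at h
    linarith
  have := norm_le_zero_iff.1 h0
  simpa using this

theorem mul_resolventMatrix (hW : W.IsHermitian) (hz : z.im ≠ 0) :
    (z • (1 : Matrix (Fin N) (Fin N) ℂ) - (scale N : ℂ) • W) * resolventMatrix W z = 1 :=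
  mul_nonsing_inv _ ((isUnit_iff_isUnit_det _).1 (isUnit_resolvent hW hz))

theorem resolventMatrix_mul (hW : W.IsHermitian) (hz : z.im ≠ 0) :
    resolventMatrix W z * (z • (1 : Matrix (Fin N) (Fin N) ℂ) - (scale N : ℂ) • W) = 1 :=
  nonsing_inv_mul _ ((isUnit_iff_isUnit_det _).1 (isUnit_resolvent hW hz))

theorem smul_resolventMatrix (hW : W.IsHermitian) (hz : z.im ≠ 0) :
    z • resolventMatrix W z = 1 + (scale N : ℂ) • (W * resolventMatrix W z) := by
  have := mul_resolventMatrix hW hz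
  rw [sub_mul, smul_mul_assoc, one_mul, smul_mul_assoc] at this
  rw [← this]; abel

theorem resolventMatrix_sub (hW : W.IsHermitian) (hW' : W'.IsHermitian) (hz : z.im ≠ 0) :
    resolventMatrix W z - resolventMatrix W' z
      = (scale N : ℂ) • (resolventMatrix W z * (W - W') * resolventMatrix W' z) := by
  have h1 := resolventMatrix_mul hW hz
  have h2 := mul_resolventMatrix hW' hz
  set R := resolventMatrix W z
  set R' := resolventMatrix W' z
  calc R - R' = R * ((z • (1 : Matrix (Fin N) (Fin N) ℂ) - (scale N : ℂ) • W') * R')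
        - (R * (z • (1 : Matrix (Fin N) (Fin N) ℂ) - (scale N : ℂ) • W)) * R' := by
          rw [h1, h2, mul_one, one_mul]
    _ = R * ((scale N : ℂ) • (W - W')) * R' := by
          rw [← Matrix.mul_assoc, ← Matrix.sub_mul, ← Matrix.mul_sub]
          congr 2
          rw [smul_sub]; abel
    _ = _ := by rw [mul_smul_comm, smul_mul_assoc]

theorem resolventMatrix_conjTranspose (hW : W.IsHermitian) :
    (resolventMatrix W z)ᴴ = resolventMatrix W (star z) := by
  rw [resolventMatrix_def, resolventMatrix_def, conjTranspose_nonsing_inv, conjTranspose_sub,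
    conjTranspose_smul, conjTranspose_smul, conjTranspose_one, hW.eq]
  simp

theorem norm_toEuclideanLin_resolventMatrix_le (hW : W.IsHermitian) (hz : z.im ≠ 0)
    (v : EuclideanSpace ℂ (Fin N)) :
    ‖toEuclideanLin (resolventMatrix W z) v‖ ≤ ‖v‖ / |z.im| := by
  have h := abs_im_mul_norm_le hW z (toEuclideanLin (resolventMatrix W z) v)
  rw [← LinearMap.comp_apply, ← toLpLin_mul_same, mul_resolventMatrix hW hz, toLpLin_one,
    LinearMap.id_apply] at h
  rwa [le_div_iff₀ (abs_pos.2 hz), mul_comm]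

theorem sum_norm_sq_resolventMatrix_mulVec_le (hW : W.IsHermitian) (hz : z.im ≠ 0)
    {v : Fin N → ℂ} (hv : ∑ i, ‖v i‖ ^ 2 ≤ 1) :
    ∑ i, ‖(resolventMatrix W z *ᵥ v) i‖ ^ 2 ≤ 1 / |z.im| ^ 2 := by
  have h := norm_toEuclideanLin_resolventMatrix_le hW hz (WithLp.toLp 2 v)
  rw [toLpLin_toLp] at h
  have h2 := pow_le_pow_left₀ (norm_nonneg _) h 2
  rw [div_pow, EuclideanSpace.norm_sq_eq, EuclideanSpace.norm_sq_eq] at h2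
  exact h2.trans (by gcongr)

/-- The adjoint of `R(z)` is `R(z̄)`, so the row bound is the column bound at the conjugate point.
-/
theorem sum_norm_sq_vecMul_resolventMatrix_le (hW : W.IsHermitian) (hz : z.im ≠ 0)
    {v : Fin N → ℂ} (hv : ∑ i, ‖v i‖ ^ 2 ≤ 1) :
    ∑ i, ‖(v ᵥ* resolventMatrix W z) i‖ ^ 2 ≤ 1 / |z.im| ^ 2 := by
  have h := sum_norm_sq_resolventMatrix_mulVec_le (z := star z) hW (by simpa using hz)
    (v := star v) (by simpa using hv)
  have h2 : v ᵥ* resolventMatrix W z = star (resolventMatrix W (star z) *ᵥ star v) := by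
    rw [star_mulVec, star_star, resolventMatrix_conjTranspose hW, star_star]
  rw [h2]
  simpa using h

theorem norm_le_of_sum_norm_sq_le {y : Fin N → ℂ} {η : ℝ} (hη : 0 < η)
    (h : ∑ i, ‖y i‖ ^ 2 ≤ 1 / η ^ 2) (i : Fin N) : ‖y i‖ ≤ 1 / η := by
  have h1 : ‖y i‖ ^ 2 ≤ (1 / η) ^ 2 := by
    rw [div_pow, one_pow]
    exact (Finset.single_le_sum (f := fun i => ‖y i‖ ^ 2) (fun i _ => sq_nonneg _)
      (Finset.mem_univ i)).trans h
  exact le_of_sq_le_sq h1 (by positivity)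

theorem sum_norm_sq_single (j : Fin N) : ∑ i, ‖(Pi.single j (1 : ℂ) : Fin N → ℂ) i‖ ^ 2 = 1 := by
  rw [Finset.sum_eq_single j]
  · simp
  · intro b _ hb; simp [hb]
  · simp

theorem norm_resolventMatrix_apply_le (hW : W.IsHermitian) (hz : z.im ≠ 0) (i j : Fin N) :
    ‖resolventMatrix W z i j‖ ≤ 1 / |z.im| := by
  have h := norm_le_of_sum_norm_sq_le (abs_pos.2 hz)
    (sum_norm_sq_resolventMatrix_mulVec_le hW hz (sum_norm_sq_single j).le) i
  simpa using h

theorem norm_dotProduct_le {p q : Fin N → ℂ} {a b : ℝ} (ha : 0 ≤ a) (hb : 0 ≤ b)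
    (hp : ∑ i, ‖p i‖ ^ 2 ≤ a ^ 2) (hq : ∑ i, ‖q i‖ ^ 2 ≤ b ^ 2) :
    ∑ i, ‖p i‖ * ‖q i‖ ≤ a * b := by
  have h := Finset.sum_mul_sq_le_sq_mul_sq Finset.univ (fun i => ‖p i‖) (fun i => ‖q i‖)
  have h2 : (∑ i, ‖p i‖ * ‖q i‖) ^ 2 ≤ (a * b) ^ 2 := by
    rw [mul_pow]
    exact h.trans (mul_le_mul hp hq (Finset.sum_nonneg fun _ _ => sq_nonneg _) (sq_nonneg _))
  exact le_of_sq_le_sq h2 (by positivity)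

theorem sum_norm_le {p : Fin N → ℂ} {a : ℝ} (ha : 0 ≤ a) (hp : ∑ i, ‖p i‖ ^ 2 ≤ a ^ 2) :
    ∑ i, ‖p i‖ ≤ a * Real.sqrt N := by
  have h := norm_dotProduct_le (p := p) (q := fun _ => 1) ha (Real.sqrt_nonneg N) hp
    (by simp [Real.sq_sqrt])
  simpa using h

/-- The diagonal entries of the resolvent map each half plane to the opposite one. -/
theorem im_mul_im_resolventMatrix_nonpos (hW : W.IsHermitian) (hz : z.im ≠ 0) (i : Fin N) :
    z.im * (resolventMatrix W z i i).im ≤ 0 := by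
  set v : EuclideanSpace ℂ (Fin N) := WithLp.toLp 2 (Pi.single i 1) with hv
  set y := toEuclideanLin (resolventMatrix W z) v with hy
  have h1 : resolventMatrix W z i i = inner ℂ v y := by
    rw [hy, hv, toLpLin_toLp]
    simp [PiLp.inner_apply]
  have h2 : v = toEuclideanLin (z • (1 : Matrix (Fin N) (Fin N) ℂ) - (scale N : ℂ) • W) y := by
    rw [hy, ← LinearMap.comp_apply, ← toLpLin_mul_same, mul_resolventMatrix hW hz, toLpLin_one,
      LinearMap.id_apply]
  have h3 : inner ℂ v y = star z * ((‖y‖ ^ 2 : ℝ) : ℂ)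
      - scale N * inner ℂ (toEuclideanLin W y) y := by
    conv_lhs => rw [h2]
    rw [map_sub, map_smul, map_smul, LinearMap.sub_apply, LinearMap.smul_apply,
      LinearMap.smul_apply, inner_sub_left, inner_smul_left, inner_smul_left, Complex.conj_ofReal]
    congr 2
    rw [toLpLin_one, LinearMap.id_apply, inner_self_eq_norm_sq_to_K]
    norm_num
  have h4 : (inner ℂ (toEuclideanLin W y) y).im = 0 :=
    (isSymmetric_toEuclideanLin_iff.2 hW).im_inner_apply_self y
  rw [h1, h3, Complex.sub_im, Complex.im_mul_ofReal, Complex.im_ofReal_mul, h4]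
  have : (star z).im = - z.im := by simp
  rw [this]
  nlinarith [mul_nonneg (sq_nonneg z.im) (sq_nonneg ‖y‖)]

end Resolvent

/-! ### Deleting one entry together with its mirror image -/

section ZeroOut

variable {N : ℕ}

/-- The matrix `W` with its entries `(i, j)` and `(j, i)` replaced by zero. -/
def zeroOut (W : Matrix (Fin N) (Fin N) ℂ) (i j : Fin N) : Matrix (Fin N) (Fin N) ℂ :=
  of fun a b => if (a = i ∧ b = j) ∨ (a = j ∧ b = i) then 0 else W a b

theorem zeroOut_apply (W : Matrix (Fin N) (Fin N) ℂ) (i j a b : Fin N) :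
    zeroOut W i j a b = if (a = i ∧ b = j) ∨ (a = j ∧ b = i) then 0 else W a b := rfl

theorem zeroOut_comm (W : Matrix (Fin N) (Fin N) ℂ) (i j : Fin N) :
    zeroOut W i j = zeroOut W j i := by
  ext a b
  simp only [zeroOut_apply, or_comm]

theorem zeroOut_isHermitian {W : Matrix (Fin N) (Fin N) ℂ} (hW : W.IsHermitian) (i j : Fin N) :
    (zeroOut W i j).IsHermitian := by
  ext a b
  have h : star (W b a) = W a b := hW.apply a b
  simp only [conjTranspose_apply, zeroOut_apply]
  by_cases hc : (a = i ∧ b = j) ∨ (a = j ∧ b = i)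
  · rw [if_pos hc, if_pos (by tauto), star_zero]
  · rw [if_neg hc, if_neg (by tauto), h]

theorem dotProduct_sub_zeroOut_mulVec {W : Matrix (Fin N) (Fin N) ℂ} {i j : Fin N} (hij : i ≠ j)
    (p q : Fin N → ℂ) :
    p ⬝ᵥ ((W - zeroOut W i j) *ᵥ q) = p i * W i j * q j + p j * W j i * q i := by
  have h : W - zeroOut W i j = single i j (W i j) + single j i (W j i) := by
    ext a b
    simp only [Matrix.sub_apply, zeroOut_apply, Matrix.add_apply, single_apply]
    by_cases h1 : a = i ∧ b = j
    · obtain ⟨rfl, rfl⟩ := h1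
      simp [hij]
    · by_cases h2 : a = j ∧ b = i
      · obtain ⟨rfl, rfl⟩ := h2
        simp [hij]
      · rw [if_neg (by tauto), if_neg (by tauto), if_neg (by tauto)]; simp
  rw [h, add_mulVec, dotProduct_add, single_mulVec, single_mulVec]
  simp [dotProduct, Function.update_apply, mul_assoc]

theorem dotProduct_sub_zeroOut_mulVec_self (W : Matrix (Fin N) (Fin N) ℂ) (i : Fin N)
    (p q : Fin N → ℂ) :
    p ⬝ᵥ ((W - zeroOut W i i) *ᵥ q) = p i * W i i * q i := by
  have h : W - zeroOut W i i = single i i (W i i) := by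
    ext a b
    simp only [Matrix.sub_apply, zeroOut_apply, single_apply]
    by_cases h1 : a = i ∧ b = i
    · obtain ⟨rfl, rfl⟩ := h1
      simp
    · rw [if_neg (by tauto), if_neg (by tauto)]; simp
  rw [h, single_mulVec]
  simp [dotProduct, Function.update_apply, mul_assoc]

theorem norm_dotProduct_sub_zeroOut_mulVec_le {W : Matrix (Fin N) (Fin N) ℂ} (hW : W.IsHermitian)
    (i j : Fin N) (p q : Fin N → ℂ) :
    ‖p ⬝ᵥ ((W - zeroOut W i j) *ᵥ q)‖ ≤ ‖W i j‖ * (‖p i‖ * ‖q j‖ + ‖p j‖ * ‖q i‖) := by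
  have hn : ‖W j i‖ = ‖W i j‖ := by rw [← hW.apply i j, norm_star]
  by_cases hij : i = j
  · subst hij
    rw [dotProduct_sub_zeroOut_mulVec_self, norm_mul, norm_mul]
    nlinarith [norm_nonneg (W i i), norm_nonneg (p i), norm_nonneg (q i),
      mul_nonneg (norm_nonneg (W i i)) (mul_nonneg (norm_nonneg (p i)) (norm_nonneg (q i)))]
  · rw [dotProduct_sub_zeroOut_mulVec hij]
    refine (norm_add_le _ _).trans ?_
    rw [norm_mul, norm_mul, norm_mul, norm_mul, hn]
    exact le_of_eq (by ring)

end ZeroOut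

/-! ### Effect of deleting an entry on the resolvent -/

section Perturbation

variable {N : ℕ} {W : Matrix (Fin N) (Fin N) ℂ} {z : ℂ}

theorem form_sub_form_zeroOut (hW : W.IsHermitian) (hz : z.im ≠ 0) (i j : Fin N)
    (u v : Fin N → ℂ) :
    u ⬝ᵥ (resolventMatrix W z *ᵥ v) - u ⬝ᵥ (resolventMatrix (zeroOut W i j) z *ᵥ v)
      = scale N * ((u ᵥ* resolventMatrix W z) ⬝ᵥ
          ((W - zeroOut W i j) *ᵥ (resolventMatrix (zeroOut W i j) z *ᵥ v))) := by
  rw [← dotProduct_sub, ← sub_mulVec, resolventMatrix_sub hW (zeroOut_isHermitian hW i j) hz,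
    smul_mulVec, dotProduct_smul, smul_eq_mul, ← mulVec_mulVec, ← mulVec_mulVec,
    dotProduct_mulVec u]

/-- Either resolvent may stand on the left in the resolvent identity. The two placements yield error
bounds with coordinates of the deleted matrix, which are independent of the entry, or of the full
matrix, which can be summed over all `(i, j)`. -/
theorem form_sub_form_zeroOut' (hW : W.IsHermitian) (hz : z.im ≠ 0) (i j : Fin N)
    (u v : Fin N → ℂ) :
    u ⬝ᵥ (resolventMatrix W z *ᵥ v) - u ⬝ᵥ (resolventMatrix (zeroOut W i j) z *ᵥ v)
      = scale N * ((u ᵥ* resolventMatrix (zeroOut W i j) z) ⬝ᵥ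
          ((W - zeroOut W i j) *ᵥ (resolventMatrix W z *ᵥ v))) := by
  have h := resolventMatrix_sub (zeroOut_isHermitian hW i j) hW hz
  rw [← neg_sub, ← dotProduct_sub, ← sub_mulVec, h, smul_mulVec, dotProduct_smul, smul_eq_mul,
    ← mulVec_mulVec, ← mulVec_mulVec, dotProduct_mulVec u, ← neg_sub W, neg_mulVec,
    dotProduct_neg]
  ring

theorem norm_form_sub_form_zeroOut_le (hW : W.IsHermitian) (hz : z.im ≠ 0) (i j : Fin N)
    {u : Fin N → ℂ} (hu : ∑ i, ‖u i‖ ^ 2 ≤ 1) (v : Fin N → ℂ) :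
    ‖u ⬝ᵥ (resolventMatrix W z *ᵥ v) - u ⬝ᵥ (resolventMatrix (zeroOut W i j) z *ᵥ v)‖
      ≤ scale N * ‖W i j‖ / |z.im| * (‖(resolventMatrix (zeroOut W i j) z *ᵥ v) i‖
          + ‖(resolventMatrix (zeroOut W i j) z *ᵥ v) j‖) := by
  have hη := abs_pos.2 hz
  have ht := scale_nonneg N
  have hx := norm_le_of_sum_norm_sq_le hη (sum_norm_sq_vecMul_resolventMatrix_le hW hz hu)
  rw [form_sub_form_zeroOut hW hz, norm_mul, Complex.norm_real, Real.norm_of_nonneg ht]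
  have h := norm_dotProduct_sub_zeroOut_mulVec_le hW i j (u ᵥ* resolventMatrix W z)
    (resolventMatrix (zeroOut W i j) z *ᵥ v)
  have h2 : ‖(u ᵥ* resolventMatrix W z) i‖ * ‖(resolventMatrix (zeroOut W i j) z *ᵥ v) j‖
      + ‖(u ᵥ* resolventMatrix W z) j‖ * ‖(resolventMatrix (zeroOut W i j) z *ᵥ v) i‖
      ≤ 1 / |z.im| * ‖(resolventMatrix (zeroOut W i j) z *ᵥ v) j‖
        + 1 / |z.im| * ‖(resolventMatrix (zeroOut W i j) z *ᵥ v) i‖ := by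
    gcongr <;> apply hx
  calc _ ≤ scale N * (‖W i j‖ * _) := mul_le_mul_of_nonneg_left (h.trans
            (mul_le_mul_of_nonneg_left h2 (norm_nonneg _))) ht
    _ = _ := by ring

theorem norm_form_sub_form_zeroOut_le' (hW : W.IsHermitian) (hz : z.im ≠ 0) (i j : Fin N)
    {u : Fin N → ℂ} (hu : ∑ i, ‖u i‖ ^ 2 ≤ 1) (v : Fin N → ℂ) :
    ‖u ⬝ᵥ (resolventMatrix W z *ᵥ v) - u ⬝ᵥ (resolventMatrix (zeroOut W i j) z *ᵥ v)‖
      ≤ scale N * ‖W i j‖ / |z.im| * (‖(resolventMatrix W z *ᵥ v) i‖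
          + ‖(resolventMatrix W z *ᵥ v) j‖) := by
  have hη := abs_pos.2 hz
  have ht := scale_nonneg N
  have hx := norm_le_of_sum_norm_sq_le hη
    (sum_norm_sq_vecMul_resolventMatrix_le (zeroOut_isHermitian hW i j) hz hu)
  rw [form_sub_form_zeroOut' hW hz, norm_mul, Complex.norm_real, Real.norm_of_nonneg ht]
  have h := norm_dotProduct_sub_zeroOut_mulVec_le hW i j (u ᵥ* resolventMatrix (zeroOut W i j) z)
    (resolventMatrix W z *ᵥ v)
  have h2 : ‖(u ᵥ* resolventMatrix (zeroOut W i j) z) i‖ * ‖(resolventMatrix W z *ᵥ v) j‖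
      + ‖(u ᵥ* resolventMatrix (zeroOut W i j) z) j‖ * ‖(resolventMatrix W z *ᵥ v) i‖
      ≤ 1 / |z.im| * ‖(resolventMatrix W z *ᵥ v) j‖
        + 1 / |z.im| * ‖(resolventMatrix W z *ᵥ v) i‖ := by
    gcongr <;> apply hx
  calc _ ≤ scale N * (‖W i j‖ * _) := mul_le_mul_of_nonneg_left (h.trans
            (mul_le_mul_of_nonneg_left h2 (norm_nonneg _))) ht
    _ = _ := by ring

theorem norm_mulVec_sub_zeroOut_le (hW : W.IsHermitian) (hz : z.im ≠ 0) (i j k : Fin N)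
    (v : Fin N → ℂ) :
    ‖(resolventMatrix W z *ᵥ v) k - (resolventMatrix (zeroOut W i j) z *ᵥ v) k‖
      ≤ scale N * ‖W i j‖ / |z.im| * (‖(resolventMatrix (zeroOut W i j) z *ᵥ v) i‖
          + ‖(resolventMatrix (zeroOut W i j) z *ᵥ v) j‖) := by
  simpa using norm_form_sub_form_zeroOut_le hW hz i j (sum_norm_sq_single k).le v

theorem norm_mulVec_sub_zeroOut_le' (hW : W.IsHermitian) (hz : z.im ≠ 0) (i j k : Fin N)
    (v : Fin N → ℂ) :
    ‖(resolventMatrix W z *ᵥ v) k - (resolventMatrix (zeroOut W i j) z *ᵥ v) k‖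
      ≤ scale N * ‖W i j‖ / |z.im| * (‖(resolventMatrix W z *ᵥ v) i‖
          + ‖(resolventMatrix W z *ᵥ v) j‖) := by
  simpa using norm_form_sub_form_zeroOut_le' hW hz i j (sum_norm_sq_single k).le v

theorem norm_vecMul_sub_zeroOut_le' (hW : W.IsHermitian) (hz : z.im ≠ 0) (i j k : Fin N)
    (u : Fin N → ℂ) :
    ‖(u ᵥ* resolventMatrix W z) k - (u ᵥ* resolventMatrix (zeroOut W i j) z) k‖
      ≤ scale N * ‖W i j‖ / |z.im| * (‖(u ᵥ* resolventMatrix W z) i‖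
          + ‖(u ᵥ* resolventMatrix W z) j‖) := by
  have hη := abs_pos.2 hz
  have ht := scale_nonneg N
  have h1 := form_sub_form_zeroOut hW hz i j u (Pi.single k 1)
  rw [dotProduct_mulVec, dotProduct_mulVec, dotProduct_single_one, dotProduct_single_one] at h1
  rw [h1, norm_mul, Complex.norm_real, Real.norm_of_nonneg ht]
  have h := norm_dotProduct_sub_zeroOut_mulVec_le hW i j (u ᵥ* resolventMatrix W z)
    (resolventMatrix (zeroOut W i j) z *ᵥ Pi.single k 1)
  have hy := norm_le_of_sum_norm_sq_le hη (sum_norm_sq_resolventMatrix_mulVec_le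
    (zeroOut_isHermitian hW i j) hz (sum_norm_sq_single k).le)
  have h2 : ‖(u ᵥ* resolventMatrix W z) i‖ *
        ‖(resolventMatrix (zeroOut W i j) z *ᵥ Pi.single k 1) j‖
      + ‖(u ᵥ* resolventMatrix W z) j‖ * ‖(resolventMatrix (zeroOut W i j) z *ᵥ Pi.single k 1) i‖
      ≤ ‖(u ᵥ* resolventMatrix W z) i‖ * (1 / |z.im|)
        + ‖(u ᵥ* resolventMatrix W z) j‖ * (1 / |z.im|) := by
    gcongr <;> apply hy
  calc _ ≤ scale N * (‖W i j‖ * _) := mul_le_mul_of_nonneg_left (h.trans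
            (mul_le_mul_of_nonneg_left h2 (norm_nonneg _))) ht
    _ = _ := by ring

theorem norm_resolventMatrix_sub_zeroOut_le (hW : W.IsHermitian) (hz : z.im ≠ 0)
    (i j a b : Fin N) :
    ‖resolventMatrix W z a b - resolventMatrix (zeroOut W i j) z a b‖
      ≤ 2 * scale N * ‖W i j‖ / |z.im| ^ 2 := by
  have hη := abs_pos.2 hz
  have ht := scale_nonneg N
  have h := norm_mulVec_sub_zeroOut_le hW hz i j a (Pi.single b 1)
  simp only [mulVec_single_one, col_apply] at h
  have hi := norm_resolventMatrix_apply_le (zeroOut_isHermitian hW i j) hz i b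
  have hj := norm_resolventMatrix_apply_le (zeroOut_isHermitian hW i j) hz j b
  calc _ ≤ _ := h
    _ ≤ scale N * ‖W i j‖ / |z.im| * (1 / |z.im| + 1 / |z.im|) := by gcongr
    _ = _ := by field_simp; ring

/-- Second order expansion of the resolvent form in one entry of the matrix. -/
theorem norm_form_sub_form_zeroOut_le_second_order (hW : W.IsHermitian) (hz : z.im ≠ 0)
    (i j : Fin N) (u v : Fin N → ℂ) {x y : Fin N → ℂ}
    (hx : x = u ᵥ* resolventMatrix (zeroOut W i j) z)
    (hy : y = resolventMatrix (zeroOut W i j) z *ᵥ v) :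
    ‖u ⬝ᵥ (resolventMatrix W z *ᵥ v) - u ⬝ᵥ (resolventMatrix (zeroOut W i j) z *ᵥ v)
        - scale N * (x ⬝ᵥ ((W - zeroOut W i j) *ᵥ y))‖
      ≤ (scale N * ‖W i j‖) ^ 2 / |z.im| * ((‖x i‖ + ‖x j‖) * (‖y i‖ + ‖y j‖)) := by
  have ht := scale_nonneg N
  rw [form_sub_form_zeroOut' hW hz, ← mul_sub, ← hx, ← dotProduct_sub, ← mulVec_sub, norm_mul,
    Complex.norm_real, Real.norm_of_nonneg ht]
  have h := norm_dotProduct_sub_zeroOut_mulVec_le hW i j x (resolventMatrix W z *ᵥ v - y)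
  have hk : ∀ k, ‖(resolventMatrix W z *ᵥ v - y) k‖
      ≤ scale N * ‖W i j‖ / |z.im| * (‖y i‖ + ‖y j‖) := by
    intro k
    rw [Pi.sub_apply, hy]
    exact norm_mulVec_sub_zeroOut_le hW hz i j k v
  have h2 : ‖x i‖ * ‖(resolventMatrix W z *ᵥ v - y) j‖ + ‖x j‖ * ‖(resolventMatrix W z *ᵥ v - y) i‖
      ≤ ‖x i‖ * (scale N * ‖W i j‖ / |z.im| * (‖y i‖ + ‖y j‖))
        + ‖x j‖ * (scale N * ‖W i j‖ / |z.im| * (‖y i‖ + ‖y j‖)) := by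
    gcongr <;> apply hk
  calc _ ≤ scale N * (‖W i j‖ * _) := mul_le_mul_of_nonneg_left (h.trans
            (mul_le_mul_of_nonneg_left h2 (norm_nonneg _))) ht
    _ = _ := by ring

/-- For a moderate entry the coordinates of the deleted matrix are controlled by those of the full
one. Coordinate `j` enters only with the small factor `ε`; without it the same-index products in the
variance, which are repeated `N` times, would not be of order `1/N`. -/
theorem norm_zeroOut_mulVec_le (hW : W.IsHermitian) (hz : z.im ≠ 0) (i j : Fin N)
    (v : Fin N → ℂ) {ε : ℝ} (hε : scale N * ‖W i j‖ / |z.im| ≤ ε) (hε1 : ε ≤ 1) :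
    ‖(resolventMatrix (zeroOut W i j) z *ᵥ v) i‖
      ≤ 2 * ‖(resolventMatrix W z *ᵥ v) i‖ + ε * ‖(resolventMatrix W z *ᵥ v) j‖ := by
  have h := norm_mulVec_sub_zeroOut_le' hW hz i j i v
  have h2 := norm_le_norm_add_norm_sub' ((resolventMatrix (zeroOut W i j) z *ᵥ v) i)
    ((resolventMatrix W z *ᵥ v) i)
  rw [norm_sub_rev] at h2
  have h3 := mul_le_mul_of_nonneg_right hε (add_nonneg (norm_nonneg
    ((resolventMatrix W z *ᵥ v) i)) (norm_nonneg ((resolventMatrix W z *ᵥ v) j)))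
  nlinarith [mul_le_mul_of_nonneg_right hε1 (norm_nonneg ((resolventMatrix W z *ᵥ v) i))]

theorem norm_zeroOut_vecMul_le (hW : W.IsHermitian) (hz : z.im ≠ 0) (i j : Fin N)
    (u : Fin N → ℂ) {ε : ℝ} (hε : scale N * ‖W i j‖ / |z.im| ≤ ε) (hε1 : ε ≤ 1) :
    ‖(u ᵥ* resolventMatrix (zeroOut W i j) z) i‖
      ≤ 2 * ‖(u ᵥ* resolventMatrix W z) i‖ + ε * ‖(u ᵥ* resolventMatrix W z) j‖ := by
  have h := norm_vecMul_sub_zeroOut_le' hW hz i j i u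
  have h2 := norm_le_norm_add_norm_sub' ((u ᵥ* resolventMatrix (zeroOut W i j) z) i)
    ((u ᵥ* resolventMatrix W z) i)
  rw [norm_sub_rev] at h2
  have h3 := mul_le_mul_of_nonneg_right hε (add_nonneg (norm_nonneg
    ((u ᵥ* resolventMatrix W z) i)) (norm_nonneg ((u ᵥ* resolventMatrix W z) j)))
  nlinarith [mul_le_mul_of_nonneg_right hε1 (norm_nonneg ((u ᵥ* resolventMatrix W z) i))]

end Perturbation

/-! ### The Efron–Stein inequality -/

section EfronStein

/-- The second moment about a point is the variance plus the squared distance to the mean. -/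
theorem integral_norm_sub_integral_sq_add {α : Type*} [MeasurableSpace α] {μ : Measure α}
    [IsProbabilityMeasure μ] {f : α → ℂ} (hf : MemLp f 2 μ) (c : ℂ) :
    ∫ x, ‖f x - ∫ y, f y ∂μ‖ ^ 2 ∂μ + ‖∫ y, f y ∂μ - c‖ ^ 2 = ∫ x, ‖f x - c‖ ^ 2 ∂μ := by
  set m := ∫ y, f y ∂μ with hm
  have hfi : Integrable f μ := hf.integrable (by norm_num)
  have hpt : ∀ x, ‖f x - c‖ ^ 2 = ‖f x - m‖ ^ 2 + 2 * (inner ℝ (m - c) (f x - m)) + ‖m - c‖ ^ 2 := by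
    intro x
    have := norm_add_sq_real (m - c) (f x - m)
    rw [show m - c + (f x - m) = f x - c by ring] at this
    rw [this]; ring
  have h1 : Integrable (fun x => ‖f x - m‖ ^ 2) μ :=
    (hf.sub (memLp_const m)).integrable_norm_pow (by norm_num)
  have h2 : Integrable (fun x => f x - m) μ := hfi.sub (integrable_const m)
  have h3 : Integrable (fun x => 2 * (inner ℝ (m - c) (f x - m) : ℝ)) μ :=
    (h2.const_inner (𝕜 := ℝ) (m - c)).const_mul 2
  simp_rw [hpt]
  rw [integral_add (by exact h1.add h3) (integrable_const _), integral_add h1 h3,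
    integral_const_mul, integral_inner h2, integral_sub hfi (integrable_const m)]
  simp [← hm]

theorem memLp_two_of_bound {α : Type*} [MeasurableSpace α] {μ : Measure α}
    [IsFiniteMeasure μ] {f : α → ℂ} (hf : Measurable f) {C : ℝ} (hC : ∀ x, ‖f x‖ ≤ C) :
    MemLp f 2 μ :=
  MemLp.of_bound hf.aestronglyMeasurable C (Filter.Eventually.of_forall hC)

theorem integrable_of_bound {α E : Type*} [MeasurableSpace α] {μ : Measure α}
    [IsFiniteMeasure μ] [NormedAddCommGroup E] [MeasurableSpace E] [BorelSpace E]
    [SecondCountableTopology E] {f : α → E}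
    (hf : Measurable f) {C : ℝ} (hC : ∀ x, ‖f x‖ ≤ C) : Integrable f μ :=
  Integrable.of_bound hf.aestronglyMeasurable C (Filter.Eventually.of_forall hC)

/-- **Efron–Stein inequality** for a product measure indexed by `Fin n`. -/
theorem efronStein_pi {E : Type*} [MeasurableSpace E] (e : E) (n : ℕ) (ν : Fin n → Measure E)
    [∀ i, IsProbabilityMeasure (ν i)] {f : (Fin n → E) → ℂ} (hf : Measurable f) {C : ℝ}
    (hC : ∀ x, ‖f x‖ ≤ C) :
    ∫ x, ‖f x - ∫ y, f y ∂(Measure.pi ν)‖ ^ 2 ∂(Measure.pi ν)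
      ≤ ∑ k, ∫ x, ‖f x - f (Function.update x k e)‖ ^ 2 ∂(Measure.pi ν) := by
  induction n with
  | zero =>
    rw [Measure.pi_of_empty ν]
    simp
  | succ n ih =>
    set ν' : Fin n → Measure E := fun i => ν i.succ with hν'
    have hmp := (measurePreserving_piFinSuccAbove ν 0).symm
    simp only [Fin.zero_succAbove] at hmp
    have hcons : ∀ p : E × (Fin n → E),
        (MeasurableEquiv.piFinSuccAbove (fun _ => E) 0).symm p = Fin.cons p.1 p.2 := by
      intro p
      simp [MeasurableEquiv.piFinSuccAbove, Fin.insertNthEquiv]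
    have hcm : Measurable fun p : E × (Fin n → E) => (Fin.cons p.1 p.2 : Fin (n + 1) → E) := by
      have := (MeasurableEquiv.piFinSuccAbove (fun _ : Fin (n + 1) => E) 0).symm.measurable
      simpa only [funext hcons] using this
    have hint : ∀ {G : Type} [NormedAddCommGroup G] [NormedSpace ℝ G]
        (g : (Fin (n + 1) → E) → G), ∫ x, g x ∂(Measure.pi ν)
        = ∫ p, g (Fin.cons p.1 p.2) ∂((ν 0).prod (Measure.pi ν')) := by
      intro G _ _ g
      rw [← hmp.integral_comp' (f := (MeasurableEquiv.piFinSuccAbove (fun _ => E) 0).symm) g]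
      simp_rw [hcons]
      rfl
    set F : E → ℂ := fun a => ∫ y, f (Fin.cons a y) ∂(Measure.pi ν') with hF
    have hfm : Measurable fun p : E × (Fin n → E) => f (Fin.cons p.1 p.2) := hf.comp hcm
    have hfa : ∀ a, Measurable fun y : Fin n → E => f (Fin.cons a y) := fun a =>
      hfm.comp (measurable_const.prodMk measurable_id)
    have hFm : Measurable F := hfm.stronglyMeasurable.integral_prod_right.measurable
    have hFC : ∀ a, ‖F a‖ ≤ C := by
      intro a
      have := norm_integral_le_of_norm_le_const (μ := Measure.pi ν')
        (f := fun y => f (Fin.cons a y)) (C := C) (Filter.Eventually.of_forall fun y => hC _)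
      simpa using this
    have hmean : ∫ y, f y ∂(Measure.pi ν) = ∫ a, F a ∂(ν 0) := by
      rw [hint, integral_prod]
      exact integrable_of_bound hfm (C := C) fun p => hC _
    set m := ∫ a, F a ∂(ν 0) with hm
    have hC0 : 0 ≤ C := (norm_nonneg _).trans (hC fun _ => e)
    have hsq : ∀ a b : ℂ, ‖a‖ ≤ C → ‖b‖ ≤ C → ‖‖a - b‖ ^ 2‖ ≤ (C + C) ^ 2 := by
      intro a b ha hb
      rw [Real.norm_of_nonneg (sq_nonneg _)]
      have := (norm_sub_le a b).trans (add_le_add ha hb)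
      gcongr
    have hmC : ‖m‖ ≤ C := by
      have := norm_integral_le_of_norm_le_const (μ := ν 0)
        (f := F) (C := C) (Filter.Eventually.of_forall hFC)
      simpa using this
    have hupd0 : ∀ (a : E) (y : Fin n → E),
        Function.update (Fin.cons a y : Fin (n + 1) → E) 0 e = Fin.cons e y :=
      fun a y => Fin.update_cons_zero (α := fun _ => E) a y e
    have hupds : ∀ (a : E) (y : Fin n → E) (k : Fin n),
        Function.update (Fin.cons a y : Fin (n + 1) → E) k.succ e
          = Fin.cons a (Function.update y k e) :=
      fun a y k => (Fin.cons_update (α := fun _ => E) a y k e).symm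
    have hiA : Integrable (fun p : E × (Fin n → E) => ‖f (Fin.cons p.1 p.2) - F p.1‖ ^ 2)
        ((ν 0).prod (Measure.pi ν')) :=
      integrable_of_bound ((hfm.sub (hFm.comp measurable_fst)).norm.pow_const 2)
        (C := (C + C) ^ 2) fun p => hsq _ _ (hC _) (hFC _)
    have hiM : Integrable (fun p : E × (Fin n → E) => ‖f (Fin.cons p.1 p.2) - m‖ ^ 2)
        ((ν 0).prod (Measure.pi ν')) :=
      integrable_of_bound ((hfm.sub measurable_const).norm.pow_const 2)
        (C := (C + C) ^ 2) fun p => hsq _ _ (hC _) hmC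
    have hi0 : Integrable (fun p : E × (Fin n → E) =>
        ‖f (Fin.cons p.1 p.2) - f (Fin.cons e p.2)‖ ^ 2) ((ν 0).prod (Measure.pi ν')) :=
      integrable_of_bound ((hfm.sub ((hfa e).comp measurable_snd)).norm.pow_const 2)
        (C := (C + C) ^ 2) fun p => hsq _ _ (hC _) (hC _)
    have hik : ∀ k, Integrable (fun p : E × (Fin n → E) =>
        ‖f (Fin.cons p.1 p.2) - f (Fin.cons p.1 (Function.update p.2 k e))‖ ^ 2)
        ((ν 0).prod (Measure.pi ν')) := fun k => by
      have hu : Measurable fun p : E × (Fin n → E) => (p.1, Function.update p.2 k e) :=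
        measurable_fst.prodMk
          ((measurable_update' (a := k)).comp (measurable_snd.prodMk measurable_const))
      have hfu : Measurable fun p : E × (Fin n → E) =>
          f (Fin.cons p.1 (Function.update p.2 k e)) := hfm.comp hu
      exact integrable_of_bound ((hfm.sub hfu).norm.pow_const 2)
        (C := (C + C) ^ 2) fun p => hsq _ _ (hC _) (hC _)
    rw [hmean, hint, integral_prod _ hiM, Fin.sum_univ_succ, hint]
    simp_rw [hupd0]
    have hk : ∀ k : Fin n, ∫ x, ‖f x - f (Function.update x k.succ e)‖ ^ 2 ∂(Measure.pi ν)
        = ∫ a, ∫ y, ‖f (Fin.cons a y) - f (Fin.cons a (Function.update y k e))‖ ^ 2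
            ∂(Measure.pi ν') ∂(ν 0) := by
      intro k
      rw [hint, ← integral_prod _ (hik k)]
      simp_rw [hupds]
    simp_rw [hk]
    have hsplit : ∀ a, ∫ y, ‖f (Fin.cons a y) - m‖ ^ 2 ∂(Measure.pi ν')
        = ∫ y, ‖f (Fin.cons a y) - F a‖ ^ 2 ∂(Measure.pi ν') + ‖F a - m‖ ^ 2 := fun a =>
      (integral_norm_sub_integral_sq_add (memLp_two_of_bound (hfa a) fun y => hC _) m).symm
    simp_rw [hsplit]
    have hiF : Integrable (fun a => ‖F a - m‖ ^ 2) (ν 0) :=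
      integrable_of_bound ((hFm.sub measurable_const).norm.pow_const 2)
        (C := (C + C) ^ 2) fun p => hsq _ _ (hFC _) hmC
    -- Total variance: the variance of the conditional mean `F` accounts for the coordinate `0`, and
    -- the mean conditional variance for the remaining ones.
    rw [integral_add hiA.integral_prod_left hiF, add_comm]
    refine add_le_add ?_ ?_
    -- The variance of `F` is at most its second moment about any point. Choosing `F e` makes
    -- replacement by the constant `e` suffice, without an independent copy.
    · have h1 := integral_norm_sub_integral_sq_add
        (memLp_two_of_bound (μ := ν 0) hFm hFC) (F e)
      rw [integral_prod _ hi0]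
      have h2 : ∫ a, ‖F a - F e‖ ^ 2 ∂(ν 0)
          ≤ ∫ a, ∫ y, ‖f (Fin.cons a y) - f (Fin.cons e y)‖ ^ 2 ∂(Measure.pi ν') ∂(ν 0) := by
        refine integral_mono ?_ hi0.integral_prod_left fun a => ?_
        · exact integrable_of_bound ((hFm.sub measurable_const).norm.pow_const 2)
            (C := (C + C) ^ 2) fun p => hsq _ _ (hFC _) (hFC _)
        · have hd : F a - F e = ∫ y, (f (Fin.cons a y) - f (Fin.cons e y)) ∂(Measure.pi ν') :=
            (integral_sub (integrable_of_bound (hfa a) fun y => hC _)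
              (integrable_of_bound (hfa e) fun y => hC _)).symm
          have h3 := integral_norm_sub_integral_sq_add (μ := Measure.pi ν')
            (f := fun y => f (Fin.cons a y) - f (Fin.cons e y))
            (memLp_two_of_bound (C := C + C) ((hfa a).sub (hfa e)) fun y =>
              (norm_sub_le _ _).trans (add_le_add (hC _) (hC _))) 0
          simp only [sub_zero] at h3
          rw [← hd] at h3
          -- Nonnegativity of the variance plays the role of Jensen's inequality for the squared
          -- norm.
          have h4 : 0 ≤ ∫ y, ‖f (Fin.cons a y) - f (Fin.cons e y) - (F a - F e)‖ ^ 2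
              ∂(Measure.pi ν') := integral_nonneg fun _ => sq_nonneg _
          dsimp only
          linarith
      have h5 := sq_nonneg ‖∫ a, F a ∂(ν 0) - F e‖
      linarith
    · rw [← integral_finsetSum _ fun k _ => (hik k).integral_prod_left]
      refine integral_mono hiA.integral_prod_left
        (integrable_finsetSum _ fun k _ => (hik k).integral_prod_left) fun a => ?_
      exact ih ν' (hfa a) fun y => hC _

/-- **Efron–Stein inequality** for a bounded function of finitely many independent variables. -/
theorem efronStein {Ω E ι : Type*} [MeasurableSpace Ω] {μ : Measure Ω} [IsProbabilityMeasure μ]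
    [MeasurableSpace E] [Fintype ι] [DecidableEq ι] (e : E) {Y : ι → Ω → E}
    (hY : iIndepFun Y μ) (hm : ∀ i, Measurable (Y i)) {f : (ι → E) → ℂ} (hf : Measurable f)
    {C : ℝ} (hC : ∀ x, ‖f x‖ ≤ C) :
    ∫ ω, ‖f (fun i => Y i ω) - ∫ ω', f (fun i => Y i ω') ∂μ‖ ^ 2 ∂μ
      ≤ ∑ k, ∫ ω, ‖f (fun i => Y i ω) - f (Function.update (fun i => Y i ω) k e)‖ ^ 2 ∂μ := by
  set q := Fintype.equivFin ι
  set Z : Fin (Fintype.card ι) → Ω → E := fun k => Y (q.symm k) with hZ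
  have hZi : iIndepFun Z μ := hY.precomp q.symm.injective
  have hlaw := hZi.map_fun_eq_pi_map (fun k => (hm _).aemeasurable)
  have hZm : Measurable fun ω k => Z k ω := measurable_pi_lambda _ fun k => hm _
  have hrm : Measurable fun (x : Fin (Fintype.card ι) → E) i => x (q i) :=
    measurable_pi_lambda _ fun i => measurable_pi_apply _
  set f' : (Fin (Fintype.card ι) → E) → ℂ := fun x => f fun i => x (q i) with hf'
  have hf'm : Measurable f' := hf.comp hrm
  have : ∀ k, IsProbabilityMeasure (μ.map (Z k)) := fun k =>
    Measure.isProbabilityMeasure_map (hm _).aemeasurable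
  have key := efronStein_pi e _ (fun k => μ.map (Z k)) hf'm (C := C) fun x => hC _
  rw [← hlaw] at key
  have hfZ : ∀ ω, f' (fun k => Z k ω) = f fun i => Y i ω := by
    intro ω; simp [hf', hZ]
  have hmean : ∫ y, f' y ∂(μ.map fun ω k => Z k ω) = ∫ ω', f (fun i => Y i ω') ∂μ := by
    rw [integral_map hZm.aemeasurable hf'm.aestronglyMeasurable]
    simp_rw [hfZ]
  have hvm : Measurable fun x => ‖f' x - ∫ ω', f (fun i => Y i ω') ∂μ‖ ^ 2 :=
    (hf'm.sub measurable_const).norm.pow_const 2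
  rw [hmean, integral_map hZm.aemeasurable hvm.aestronglyMeasurable] at key
  simp_rw [hfZ] at key
  refine key.trans (le_of_eq ?_)
  rw [← Equiv.sum_comp q]
  refine Finset.sum_congr rfl fun i _ => ?_
  have hum : Measurable fun x : Fin (Fintype.card ι) → E => Function.update x (q i) e :=
    (measurable_update' (a := q i)).comp (measurable_id.prodMk measurable_const)
  have hdm : Measurable fun x => ‖f' x - f' (Function.update x (q i) e)‖ ^ 2 :=
    (hf'm.sub (hf'm.comp hum)).norm.pow_const 2
  rw [integral_map hZm.aemeasurable hdm.aestronglyMeasurable]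
  simp_rw [hfZ]
  congr 1
  ext ω
  congr 4
  simp only [hf']
  congr 1
  ext j
  by_cases hj : j = i
  · subst hj; simp
  · simp [hj, hZ]

end EfronStein

/-! ### Independence of functions of disjoint groups of variables -/

section Independence

variable {Ω : Type*} [mΩ : MeasurableSpace Ω] {μ : Measure Ω}

/-- Functions of disjoint blocks of independent variables are independent. -/
theorem iIndepFun_of_disjoint_blocks {ι κ E F : Type*} [mE : MeasurableSpace E]
    [mF : MeasurableSpace F] {X : ι → Ω → E} (hX : iIndepFun X μ) (hm : ∀ i, Measurable (X i))
    (S : κ → Set ι) (hS : Pairwise fun p q => Disjoint (S p) (S q)) {Z : κ → Ω → F}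
    (hZ : ∀ p, Measurable[⨆ i ∈ S p, mE.comap (X i)] (Z p)) : iIndepFun Z μ := by
  classical
  have hμ : IsProbabilityMeasure μ := hX.isProbabilityMeasure
  rw [iIndepFun_iff_measure_inter_preimage_eq_mul]
  intro T A hA
  induction T using Finset.induction_on with
  | empty => simp
  | insert a T ha ih =>
    rw [Finset.set_biInter_insert, Finset.prod_insert ha,
      ← ih fun i hi => hA i (Finset.mem_insert_of_mem hi)]
    have hdisj : Disjoint (S a) (⋃ q ∈ T, S q) := by
      rw [Set.disjoint_iUnion₂_right]
      intro q hq
      exact hS fun h => ha (h ▸ hq)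
    have hind := indep_iSup_of_disjoint (fun i => (hm i).comap_le) hX.iIndep hdisj
    refine (Indep_iff _ _ _).1 hind _ _ (hZ a (hA a (Finset.mem_insert_self a T))) ?_
    refine MeasurableSet.biInter T.countable_toSet fun q hq => ?_
    have hle : (⨆ i ∈ S q, mE.comap (X i)) ≤ ⨆ i ∈ ⋃ q ∈ T, S q, mE.comap (X i) :=
      biSup_mono fun i hi => Set.mem_biUnion hq hi
    exact hle _ (hZ q (hA q (Finset.mem_insert_of_mem hq)))

/-- One of several independent variables is independent of a function of the others. -/
theorem indepFun_of_measurable_rest {ι E F : Type*} [mE : MeasurableSpace E]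
    [mF : MeasurableSpace F] {X : ι → Ω → E} (hX : iIndepFun X μ) (hm : ∀ i, Measurable (X i))
    (p : ι) {Z : Ω → F} (hZ : Measurable[⨆ i ∈ ({p}ᶜ : Set ι), mE.comap (X i)] Z) :
    IndepFun (X p) Z μ := by
  have hdisj : Disjoint ({p} : Set ι) {p}ᶜ := disjoint_compl_right
  have hind := indep_iSup_of_disjoint (fun i => (hm i).comap_le) hX.iIndep hdisj
  rw [IndepFun_iff_Indep]
  refine indep_of_indep_of_le_left (indep_of_indep_of_le_right hind hZ.comap_le) ?_
  exact le_iSup₂_of_le p rfl le_rfl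

end Independence

/-! ### Hermitian matrices as functions of their upper triangular entries -/

section HermitianOfEntries

variable {N : ℕ}

/-- The Hermitian matrix with prescribed entries on and above the diagonal, the imaginary parts of
the prescribed diagonal entries being discarded. -/
noncomputable def hermitianOfEntries (y : {p : Fin N × Fin N // p.1 ≤ p.2} → ℂ) :
    Matrix (Fin N) (Fin N) ℂ :=
  of fun a b => if h : a < b then y ⟨(a, b), h.le⟩
    else if h' : b < a then star (y ⟨(b, a), h'.le⟩) else ((y ⟨(a, a), le_rfl⟩).re : ℂ)

theorem hermitianOfEntries_apply (y : {p : Fin N × Fin N // p.1 ≤ p.2} → ℂ) (a b : Fin N) :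
    hermitianOfEntries y a b = if h : a < b then y ⟨(a, b), h.le⟩
      else if h' : b < a then star (y ⟨(b, a), h'.le⟩) else ((y ⟨(a, a), le_rfl⟩).re : ℂ) := rfl

theorem hermitianOfEntries_isHermitian (y : {p : Fin N × Fin N // p.1 ≤ p.2} → ℂ) :
    (hermitianOfEntries y).IsHermitian := by
  ext a b
  rw [conjTranspose_apply, hermitianOfEntries_apply, hermitianOfEntries_apply]
  rcases lt_trichotomy a b with h | rfl | h
  · simp [h, h.not_gt]
  · simp
  · simp [h, h.not_gt]

theorem hermitianOfEntries_entries {W : Matrix (Fin N) (Fin N) ℂ} (hW : W.IsHermitian) :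
    hermitianOfEntries (fun p => W p.1.1 p.1.2) = W := by
  ext a b
  rw [hermitianOfEntries_apply]
  rcases lt_trichotomy a b with h | rfl | h
  · simp [h]
  · simpa using hW.coe_re_apply_self a
  · simp only [h.not_gt, h, dite_true, dite_false]
    exact hW.apply a b

theorem hermitianOfEntries_update (y : {p : Fin N × Fin N // p.1 ≤ p.2} → ℂ)
    (p : {p : Fin N × Fin N // p.1 ≤ p.2}) :
    hermitianOfEntries (Function.update y p 0) = zeroOut (hermitianOfEntries y) p.1.1 p.1.2 := by
  obtain ⟨⟨i, j⟩, hij⟩ := p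
  simp only at hij
  ext a b
  rw [zeroOut_apply, hermitianOfEntries_apply, hermitianOfEntries_apply]
  simp only [Function.update_apply, Subtype.mk.injEq, Prod.mk.injEq]
  rcases lt_trichotomy a b with h | rfl | h
  · have : ¬ (a = j ∧ b = i) := by rintro ⟨rfl, rfl⟩; exact absurd hij h.not_ge
    simp [h, this]
  · simp only [lt_irrefl, dite_false]
    by_cases h1 : a = i ∧ a = j
    · obtain ⟨rfl, rfl⟩ := h1; simp
    · have h2 : ¬ (a = j ∧ a = i) := by tauto
      simp [h1, h2]
  · have : ¬ (a = i ∧ b = j) := by rintro ⟨rfl, rfl⟩; exact absurd hij h.not_ge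
    simp only [h.not_gt, h, dite_true, dite_false, this, false_or, and_comm (a := b = i)]
    split_ifs <;> simp

theorem measurable_hermitianOfEntries_apply (a b : Fin N) :
    Measurable fun y : {p : Fin N × Fin N // p.1 ≤ p.2} → ℂ => hermitianOfEntries y a b := by
  simp only [hermitianOfEntries_apply]
  rcases lt_trichotomy a b with h | rfl | h
  · simp only [h, dite_true]; exact measurable_pi_apply _
  · simp only [lt_irrefl, dite_false]
    exact Complex.measurable_ofReal.comp (Complex.measurable_re.comp (measurable_pi_apply _))
  · simp only [h.not_gt, h, dite_true, dite_false]
    exact (continuous_star.measurable).comp (measurable_pi_apply _)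

end HermitianOfEntries

/-! ### Measurability of resolvent quantities -/

section Measurability

variable {N : ℕ} {Ω : Type*} [MeasurableSpace Ω] {W : Ω → Matrix (Fin N) (Fin N) ℂ}

theorem measurable_resolventMatrix (hW : ∀ i j, Measurable fun ω => W ω i j) (z : ℂ)
    (a b : Fin N) : Measurable fun ω => resolventMatrix (W ω) z a b := by
  have hid : Continuous fun x : Fin N → Fin N → ℂ => (of x : Matrix (Fin N) (Fin N) ℂ) :=
    continuous_id
  have hc : Continuous fun x : Fin N → Fin N → ℂ =>
      z • (1 : Matrix (Fin N) (Fin N) ℂ) - (scale N : ℂ) • of x :=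
    Continuous.sub continuous_const (hid.fun_const_smul (scale N : ℂ))
  have h1 : Measurable fun x : Fin N → Fin N → ℂ => resolventMatrix (of x) z a b := by
    simp only [resolventMatrix_def, Matrix.inv_def, Ring.inverse_eq_inv', Matrix.smul_apply,
      smul_eq_mul]
    refine Measurable.mul ?_ ?_
    · exact (hc.matrix_det.measurable).inv
    · exact ((hc.matrix_adjugate).matrix_elem a b).measurable
  have h2 : Measurable fun ω => (fun i j => W ω i j : Fin N → Fin N → ℂ) :=
    measurable_pi_lambda _ fun i => measurable_pi_lambda _ fun j => hW i j
  exact h1.comp h2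

theorem measurable_resolventMatrix_mulVec (hW : ∀ i j, Measurable fun ω => W ω i j) (z : ℂ)
    (v : Fin N → ℂ) (a : Fin N) : Measurable fun ω => (resolventMatrix (W ω) z *ᵥ v) a := by
  simp only [mulVec, dotProduct]
  exact Finset.measurable_sum _ fun b _ => (measurable_resolventMatrix hW z a b).mul_const _

theorem measurable_vecMul_resolventMatrix (hW : ∀ i j, Measurable fun ω => W ω i j) (z : ℂ)
    (v : Fin N → ℂ) (a : Fin N) : Measurable fun ω => (v ᵥ* resolventMatrix (W ω) z) a := by
  simp only [vecMul, dotProduct]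
  exact Finset.measurable_sum _ fun b _ => (measurable_resolventMatrix hW z b a).const_mul _

theorem measurable_form (hW : ∀ i j, Measurable fun ω => W ω i j) (z : ℂ)
    (u v : Fin N → ℂ) : Measurable fun ω => u ⬝ᵥ (resolventMatrix (W ω) z *ᵥ v) := by
  simp only [dotProduct]
  exact Finset.measurable_sum _ fun b _ =>
    (measurable_resolventMatrix_mulVec hW z v b).const_mul _

theorem measurable_zeroOut (hW : ∀ i j, Measurable fun ω => W ω i j) (i j a b : Fin N) :
    Measurable fun ω => zeroOut (W ω) i j a b := by
  simp only [zeroOut_apply]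
  split_ifs
  · exact measurable_const
  · exact hW a b

end Measurability

/-! ### A common model for the two symmetry classes -/

section Model

/-- The common features of real symmetric and Hermitian Wigner matrices: the complex entries on and
above the diagonal are independent and centered, the off-diagonal entries `w` satisfy
`E |w|² = σ²` and `E w² = τ`, and the relevant absolute moments are bounded by `L`. -/
structure IsWignerModel {Ω : Type*} [MeasurableSpace Ω] (μ : Measure Ω) {N : ℕ}
    (σ τ L : ℝ) (W : Ω → Matrix (Fin N) (Fin N) ℂ) : Prop where
  measurable_entry : ∀ i j, Measurable (fun ω => W ω i j)
  isHermitian : ∀ ω, (W ω).IsHermitian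
  indep : iIndepFun (fun (p : {p : Fin N × Fin N // p.1 ≤ p.2}) ω => W ω p.1.1 p.1.2) μ
  one_le : 1 ≤ L
  abs_le : |τ| ≤ σ ^ 2
  mean : ∀ i j, ∫ ω, W ω i j ∂μ = 0
  integral_norm_sq : ∀ i j, i ≠ j → ∫ ω, ‖W ω i j‖ ^ 2 ∂μ = σ ^ 2
  integral_sq : ∀ i j, i ≠ j → ∫ ω, W ω i j ^ 2 ∂μ = τ
  integrable_pow : ∀ i j, ∀ k ≤ 4, (k ≤ 2 ∨ i ≠ j) → Integrable (fun ω => ‖W ω i j‖ ^ k) μ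
  moment_le : ∀ i j, ∀ k ≤ 4, (k ≤ 2 ∨ i ≠ j) → ∫ ω, ‖W ω i j‖ ^ k ∂μ ≤ L

theorem pow_le_one_add_pow {x : ℝ} (hx : 0 ≤ x) {k n : ℕ} (hkn : k ≤ n) : x ^ k ≤ 1 + x ^ n := by
  rcases le_total x 1 with h | h
  · have := pow_le_one₀ (n := k) hx h
    have := pow_nonneg hx n
    linarith
  · have := pow_le_pow_right₀ h hkn
    linarith

theorem integrable_pow_of_le {Ω E : Type*} [MeasurableSpace Ω] {μ : Measure Ω}
    [IsProbabilityMeasure μ] [NormedAddCommGroup E] [MeasurableSpace E] [BorelSpace E]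
    [SecondCountableTopology E] {w : Ω → E} (hw : Measurable w) {k n : ℕ} (hkn : k ≤ n)
    (h : Integrable (fun ω => ‖w ω‖ ^ n) μ) : Integrable (fun ω => ‖w ω‖ ^ k) μ := by
  refine Integrable.mono' ((integrable_const (1 : ℝ)).add h)
    (hw.norm.pow_const k).aestronglyMeasurable (Filter.Eventually.of_forall fun ω => ?_)
  rw [Real.norm_of_nonneg (by positivity)]
  exact pow_le_one_add_pow (norm_nonneg _) hkn

theorem integral_pow_le_of_le {Ω E : Type*} [MeasurableSpace Ω] {μ : Measure Ω}
    [IsProbabilityMeasure μ] [NormedAddCommGroup E] [MeasurableSpace E] [BorelSpace E]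
    [SecondCountableTopology E] {w : Ω → E} (hw : Measurable w) {k n : ℕ} (hkn : k ≤ n)
    (h : Integrable (fun ω => ‖w ω‖ ^ n) μ) {m : ℝ} (hm : ∫ ω, ‖w ω‖ ^ n ∂μ ≤ m) :
    ∫ ω, ‖w ω‖ ^ k ∂μ ≤ 1 + m := by
  have h1 : ∫ ω, ‖w ω‖ ^ k ∂μ ≤ ∫ ω, (1 + ‖w ω‖ ^ n) ∂μ :=
    integral_mono (integrable_pow_of_le hw hkn h) ((integrable_const _).add h) fun ω =>
      pow_le_one_add_pow (norm_nonneg _) hkn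
  rw [integral_add (integrable_const _) h] at h1
  simp at h1
  linarith

/-- For real entries `E w² = E|w|²`, hence `τ = σ²`. Lower moments are bounded by one plus the fifth
(off the diagonal) or third (on it), so `1 + |m₅| + |c₃|` bounds all of them; the absolute values
also make it at least `1`. -/
theorem IsRealSymmetricWigner.isWignerModel {Ω : Type u} [MeasurableSpace Ω] {μ : Measure Ω}
    [IsProbabilityMeasure μ] {N : ℕ} {σ m₅ c₃ : ℝ} {V : Ω → Matrix (Fin N) (Fin N) ℝ}
    (hV : IsRealSymmetricWigner μ σ m₅ c₃ V) :
    IsWignerModel μ σ (σ ^ 2) (1 + |m₅| + |c₃|) (fun ω => (V ω).map Complex.ofReal) := by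
  have hmean : ∀ i j, ∫ ω, V ω i j ∂μ = 0 := by
    intro i j
    by_cases h : i = j
    · subst h; exact hV.mean_diag i
    · exact hV.mean_offDiag i j h
  have hsq : ∀ i j, i ≠ j → ∫ ω, V ω i j ^ 2 ∂μ = σ ^ 2 := by
    intro i j hij
    rw [← hV.variance_offDiag i j hij,
      variance_of_integral_eq_zero (hV.measurable_entry i j).aemeasurable (hmean i j)]
  refine ⟨?_, ?_, ?_, ?_, ?_, ?_, ?_, ?_, ?_, ?_⟩
  · intro i j
    exact Complex.measurable_ofReal.comp (hV.measurable_entry i j)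
  · intro ω
    ext i j
    simp [(hV.isSymm ω).apply]
  · exact hV.indep.comp (fun _ => Complex.ofReal) fun _ => Complex.measurable_ofReal
  · linarith [abs_nonneg m₅, abs_nonneg c₃]
  · rw [abs_of_nonneg (sq_nonneg σ)]
  · intro i j
    simp only [map_apply]
    rw [integral_complex_ofReal, hmean, Complex.ofReal_zero]
  · intro i j hij
    simpa using hsq i j hij
  · intro i j hij
    simp only [map_apply]
    have := hsq i j hij
    rw [← this, ← integral_complex_ofReal]
    simp
  · intro i j k hk hij
    simp only [map_apply, Complex.norm_real]
    by_cases h : i = j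
    · subst h
      refine integrable_pow_of_le (n := 3) (hV.measurable_entry i i) (by simp at hij; omega) ?_
      simpa using hV.integrable_diag i
    · refine integrable_pow_of_le (n := 5) (hV.measurable_entry i j) (by omega) ?_
      simpa using hV.integrable_offDiag i j h
  · intro i j k hk hij
    simp only [map_apply, Complex.norm_real]
    by_cases h : i = j
    · subst h
      have := integral_pow_le_of_le (n := 3) (k := k) (hV.measurable_entry i i)
        (by simp at hij; omega) (by simpa using hV.integrable_diag i)
        (by simpa using hV.moment_diag i)
      linarith [abs_nonneg m₅, le_abs_self c₃]
    · have := integral_pow_le_of_le (n := 5) (k := k) (hV.measurable_entry i j)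
        (by omega) (by simpa using hV.integrable_offDiag i j h)
        (by simpa using hV.moment_offDiag i j h)
      linarith [abs_nonneg c₃, le_abs_self m₅]

/-- Each complex entry is a function of its own block of real coordinates: real and imaginary part
off the diagonal, a single real number on it. -/
theorem IsHermitianWigner.indep_entries {Ω : Type u} [MeasurableSpace Ω] {μ : Measure Ω}
    {N : ℕ} {σ m₅ c₃ : ℝ} {W : Ω → Matrix (Fin N) (Fin N) ℂ}
    (hW : IsHermitianWigner μ σ m₅ c₃ W) :
    iIndepFun (fun (p : {p : Fin N × Fin N // p.1 ≤ p.2}) ω => W ω p.1.1 p.1.2) μ := by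
  have hm : ∀ c, Measurable (hermitianCoordinates W c) := by
    rintro ((p | p) | i)
    · exact Complex.measurable_re.comp (hW.measurable_entry _ _)
    · exact Complex.measurable_im.comp (hW.measurable_entry _ _)
    · exact Complex.measurable_re.comp (hW.measurable_entry _ _)
  -- `loc` sends a real coordinate to its matrix position; the blocks are its fibres.
  let loc : ({p : Fin N × Fin N // p.1 < p.2} ⊕ {p : Fin N × Fin N // p.1 < p.2}) ⊕ Fin N →
      Fin N × Fin N := Sum.elim (Sum.elim Subtype.val Subtype.val) fun i => (i, i)
  refine iIndepFun_of_disjoint_blocks hW.indep hm (fun p => loc ⁻¹' {p.1}) ?_ ?_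
  · intro p q hpq
    exact Disjoint.preimage loc (by simpa using fun h => hpq (Subtype.ext h))
  · rintro ⟨⟨i, j⟩, hij⟩
    simp only at hij ⊢
    have hc : ∀ c, loc c = (i, j) →
        Measurable[⨆ c ∈ loc ⁻¹' {(i, j)}, (borel ℝ).comap (hermitianCoordinates W c)]
          (hermitianCoordinates W c) := by
      intro c hc
      rw [measurable_iff_comap_le]
      exact le_iSup₂_of_le c hc (le_of_eq (by rw [BorelSpace.measurable_eq (α := ℝ)]))
    rw [BorelSpace.measurable_eq (α := ℝ)]
    rcases hij.lt_or_eq with h | h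
    · have h1 := hc (Sum.inl (Sum.inl ⟨(i, j), h⟩)) rfl
      have h2 := hc (Sum.inl (Sum.inr ⟨(i, j), h⟩)) rfl
      have : (fun ω => W ω i j) = fun ω =>
          ((hermitianCoordinates W (Sum.inl (Sum.inl ⟨(i, j), h⟩)) ω : ℝ) : ℂ)
          + ((hermitianCoordinates W (Sum.inl (Sum.inr ⟨(i, j), h⟩)) ω : ℝ) : ℂ) * Complex.I := by
        ext ω
        exact (Complex.re_add_im _).symm
      rw [this]
      exact (Complex.measurable_ofReal.comp h1).add
        ((Complex.measurable_ofReal.comp h2).mul_const _)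
    · subst h
      have h1 := hc (Sum.inr i) rfl
      have : (fun ω => W ω i i) = fun ω =>
          ((hermitianCoordinates W (Sum.inr i) ω : ℝ) : ℂ) := by
        ext ω
        exact ((hW.isHermitian ω).coe_re_apply_self i).symm
      rw [this]
      exact Complex.measurable_ofReal.comp h1

/-- Here `τ = 0`: in `E w²` the variances of the real and imaginary parts cancel, and the mixed term
vanishes by independence and centering. Below the diagonal the claim follows by conjugation. -/
theorem IsHermitianWigner.isWignerModel {Ω : Type u} [MeasurableSpace Ω] {μ : Measure Ω}
    [IsProbabilityMeasure μ] {N : ℕ} {σ m₅ c₃ : ℝ} {W : Ω → Matrix (Fin N) (Fin N) ℂ}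
    (hW : IsHermitianWigner μ σ m₅ c₃ W) :
    IsWignerModel μ σ 0 (1 + |m₅| + |c₃|) W := by
  have hpow : ∀ i j, ∀ k ≤ 4, (k ≤ 2 ∨ i ≠ j) → Integrable (fun ω => ‖W ω i j‖ ^ k) μ := by
    intro i j k hk hij
    by_cases h : i = j
    · subst h
      exact integrable_pow_of_le (n := 3) (hW.measurable_entry i i) (by simp at hij; omega)
        (hW.integrable_diag i)
    · exact integrable_pow_of_le (n := 5) (hW.measurable_entry i j) (by omega)
        (hW.integrable_offDiag i j h)
  have hmean : ∀ i j, ∫ ω, W ω i j ∂μ = 0 := by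
    intro i j
    by_cases h : i = j
    · subst h; exact hW.mean_diag i
    · exact hW.mean_offDiag i j h
  have hint : ∀ i j, Integrable (fun ω => W ω i j) μ := by
    intro i j
    have := hpow i j 1 (by norm_num) (Or.inl (by norm_num))
    simp only [pow_one] at this
    exact (integrable_norm_iff (hW.measurable_entry i j).aestronglyMeasurable).1 this
  have hrem : ∀ i j, Measurable fun ω => (W ω i j).re := fun i j =>
    Complex.measurable_re.comp (hW.measurable_entry i j)
  have himm : ∀ i j, Measurable fun ω => (W ω i j).im := fun i j =>
    Complex.measurable_im.comp (hW.measurable_entry i j)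
  have hre0 : ∀ i j, ∫ ω, (W ω i j).re ∂μ = 0 := by
    intro i j
    have := integral_re (𝕜 := ℂ) (hint i j)
    simp only [RCLike.re_eq_complex_re] at this
    rw [this, hmean]; rfl
  have him0 : ∀ i j, ∫ ω, (W ω i j).im ∂μ = 0 := by
    intro i j
    have := integral_im (𝕜 := ℂ) (hint i j)
    simp only [RCLike.im_eq_complex_im] at this
    rw [this, hmean]; rfl
  have hre2 : ∀ i j, i ≠ j → ∫ ω, (W ω i j).re ^ 2 ∂μ = σ ^ 2 / 2 := by
    intro i j hij
    rw [← hW.variance_re_offDiag i j hij,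
      variance_of_integral_eq_zero (hrem i j).aemeasurable (hre0 i j)]
  have him2 : ∀ i j, i ≠ j → ∫ ω, (W ω i j).im ^ 2 ∂μ = σ ^ 2 / 2 := by
    intro i j hij
    rw [← hW.variance_im_offDiag i j hij,
      variance_of_integral_eq_zero (himm i j).aemeasurable (him0 i j)]
  have hire2 : ∀ i j, Integrable (fun ω => (W ω i j).re ^ 2) μ := by
    intro i j
    refine (hpow i j 2 (by norm_num) (Or.inl le_rfl)).mono'
      ((hrem i j).pow_const 2).aestronglyMeasurable (Filter.Eventually.of_forall fun ω => ?_)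
    rw [Real.norm_of_nonneg (sq_nonneg _), ← sq_abs]
    exact pow_le_pow_left₀ (abs_nonneg _) (Complex.abs_re_le_norm _) 2
  have hiim2 : ∀ i j, Integrable (fun ω => (W ω i j).im ^ 2) μ := by
    intro i j
    refine (hpow i j 2 (by norm_num) (Or.inl le_rfl)).mono'
      ((himm i j).pow_const 2).aestronglyMeasurable (Filter.Eventually.of_forall fun ω => ?_)
    rw [Real.norm_of_nonneg (sq_nonneg _), ← sq_abs]
    exact pow_le_pow_left₀ (abs_nonneg _) (Complex.abs_im_le_norm _) 2
  have hsqlt : ∀ i j, i < j → ∫ ω, W ω i j ^ 2 ∂μ = 0 := by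
    intro i j hij
    have hind : IndepFun (fun ω => (W ω i j).re) (fun ω => (W ω i j).im) μ :=
      hW.indep.indepFun (i := Sum.inl (Sum.inl ⟨(i, j), hij⟩))
        (j := Sum.inl (Sum.inr ⟨(i, j), hij⟩)) (by simp)
    have hprod : ∫ ω, (W ω i j).re * (W ω i j).im ∂μ = 0 := by
      rw [hind.integral_fun_mul_eq_mul_integral (hrem i j).aestronglyMeasurable
        (himm i j).aestronglyMeasurable, hre0, zero_mul]
    have hpi : Integrable (fun ω => (W ω i j).re * (W ω i j).im) μ := by
      refine ((hire2 i j).add (hiim2 i j)).mono'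
        ((hrem i j).mul (himm i j)).aestronglyMeasurable (Filter.Eventually.of_forall fun ω => ?_)
      rw [Real.norm_eq_abs, abs_le, Pi.add_apply]
      constructor <;> nlinarith [sq_nonneg ((W ω i j).re + (W ω i j).im),
        sq_nonneg ((W ω i j).re - (W ω i j).im), sq_nonneg (W ω i j).re, sq_nonneg (W ω i j).im]
    have hpt : ∀ ω, W ω i j ^ 2 = (((W ω i j).re ^ 2 - (W ω i j).im ^ 2 : ℝ) : ℂ)
        + ((2 * ((W ω i j).re * (W ω i j).im) : ℝ) : ℂ) * Complex.I := by
      intro ω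
      conv_lhs => rw [← Complex.re_add_im (W ω i j)]
      push_cast
      linear_combination ((W ω i j).im : ℂ) ^ 2 * Complex.I_sq
    simp_rw [hpt]
    rw [integral_add, integral_mul_const, integral_complex_ofReal, integral_complex_ofReal,
      integral_sub (hire2 i j) (hiim2 i j), hre2 i j hij.ne, him2 i j hij.ne, integral_const_mul,
      hprod]
    · simp
    · exact ((hire2 i j).sub (hiim2 i j)).ofReal
    · exact ((hpi.const_mul 2).ofReal).mul_const _
  refine ⟨hW.measurable_entry, hW.isHermitian, hW.indep_entries, ?_, ?_, hmean, ?_, ?_, hpow, ?_⟩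
  · linarith [abs_nonneg m₅, abs_nonneg c₃]
  · rw [abs_zero]; positivity
  · intro i j hij
    have : ∀ ω, ‖W ω i j‖ ^ 2 = (W ω i j).re ^ 2 + (W ω i j).im ^ 2 := by
      intro ω
      rw [← Complex.normSq_eq_norm_sq, Complex.normSq_apply]; ring
    simp_rw [this]
    rw [integral_add (hire2 i j) (hiim2 i j), hre2 i j hij, him2 i j hij]
    ring
  · intro i j hij
    rw [Complex.ofReal_zero]
    rcases hij.lt_or_gt with h | h
    · exact hsqlt i j h
    · have : ∀ ω, W ω i j ^ 2 = starRingEnd ℂ (W ω j i ^ 2) := by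
        intro ω
        rw [map_pow]
        congr 1
        exact ((hW.isHermitian ω).apply i j).symm
      simp_rw [this]
      rw [integral_conj, hsqlt j i h, map_zero]
  · intro i j k hk hij
    by_cases h : i = j
    · subst h
      have := integral_pow_le_of_le (n := 3) (k := k) (hW.measurable_entry i i)
        (by simp at hij; omega) (hW.integrable_diag i) (hW.moment_diag i)
      linarith [abs_nonneg m₅, le_abs_self c₃]
    · have := integral_pow_le_of_le (n := 5) (k := k) (hW.measurable_entry i j)
        (by omega) (hW.integrable_offDiag i j h) (hW.moment_offDiag i j h)
      linarith [abs_nonneg c₃, le_abs_self m₅]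

theorem IsWigner.exists_isWignerModel {Ω : Type u} [MeasurableSpace Ω] {μ : Measure Ω}
    [IsProbabilityMeasure μ] {N : ℕ} {σ m₅ c₃ : ℝ} {W : Ω → Matrix (Fin N) (Fin N) ℂ}
    (hW : IsWigner μ σ m₅ c₃ W) : ∃ τ, IsWignerModel μ σ τ (1 + |m₅| + |c₃|) W := by
  rcases hW with ⟨V, hV, h⟩ | hW
  · obtain rfl : W = fun ω => (V ω).map Complex.ofReal := funext h
    exact ⟨_, hV.isWignerModel⟩
  · exact ⟨_, hW.isWignerModel⟩

end Model

/-! ### An entry is independent of the matrix from which it is deleted -/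

section ZeroOutIndependence

variable {Ω : Type*} [MeasurableSpace Ω] {μ : Measure Ω} {N : ℕ} {σ τ L : ℝ}
  {W : Ω → Matrix (Fin N) (Fin N) ℂ}

/-- The deleted matrix is rebuilt by `hermitianOfEntries` from the upper triangular entries with the
one at `(i, j)` overwritten by `0`, so it is measurable with respect to the other entries. -/
theorem IsWignerModel.indepFun_zeroOut_of_le (hW : IsWignerModel μ σ τ L W) {i j : Fin N}
    (hij : i ≤ j) : IndepFun (fun ω => W ω i j)
      (fun ω => (fun a b => zeroOut (W ω) i j a b : Fin N → Fin N → ℂ)) μ := by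
  set Y : {p : Fin N × Fin N // p.1 ≤ p.2} → Ω → ℂ := fun p ω => W ω p.1.1 p.1.2 with hY
  have hYm : ∀ p, Measurable (Y p) := fun p => hW.measurable_entry _ _
  refine indepFun_of_measurable_rest (X := Y) hW.indep hYm ⟨(i, j), hij⟩ ?_
  have hz : ∀ ω, zeroOut (W ω) i j
      = hermitianOfEntries (Function.update (fun p => Y p ω) ⟨(i, j), hij⟩ 0) := by
    intro ω
    rw [hermitianOfEntries_update, hermitianOfEntries_entries (hW.isHermitian ω)]
  simp_rw [hz]
  refine @measurable_pi_lambda _ _ _ (_) _ _ fun a => @measurable_pi_lambda _ _ _ (_) _ _ fun b => ?_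
  refine (measurable_hermitianOfEntries_apply a b).comp ?_
  refine @measurable_pi_lambda _ _ _ (_) _ _ fun q => ?_
  by_cases hq : q = ⟨(i, j), hij⟩
  · subst hq
    simp only [Function.update_self]
    exact measurable_const
  · simp only [Function.update_of_ne hq]
    rw [measurable_iff_comap_le]
    exact le_iSup₂_of_le q hq le_rfl

theorem IsWignerModel.indepFun_zeroOut (hW : IsWignerModel μ σ τ L W) (i j : Fin N) :
    IndepFun (fun ω => W ω i j)
      (fun ω => (fun a b => zeroOut (W ω) i j a b : Fin N → Fin N → ℂ)) μ := by
  rcases le_total i j with h | h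
  · exact hW.indepFun_zeroOut_of_le h
  · have h1 := (hW.indepFun_zeroOut_of_le h).comp (φ := fun w : ℂ => star w)
      continuous_star.measurable measurable_id
    have h2 : ((fun w : ℂ => star w) ∘ fun ω => W ω j i) = fun ω => W ω i j := by
      ext ω
      exact (hW.isHermitian ω).apply i j
    rw [h2] at h1
    simp_rw [zeroOut_comm _ j i] at h1
    exact h1

theorem IsWignerModel.integral_mul_zeroOut (hW : IsWignerModel μ σ τ L W)
    {𝕜 : Type*} [RCLike 𝕜] (i j : Fin N) {φ : ℂ → 𝕜} (hφ : Measurable φ)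
    {g : Matrix (Fin N) (Fin N) ℂ → 𝕜} (hg : Measurable fun x : Fin N → Fin N → ℂ => g (of x)) :
    ∫ ω, φ (W ω i j) * g (zeroOut (W ω) i j) ∂μ
      = (∫ ω, φ (W ω i j) ∂μ) * ∫ ω, g (zeroOut (W ω) i j) ∂μ := by
  have hm : Measurable fun ω => (fun a b => zeroOut (W ω) i j a b : Fin N → Fin N → ℂ) :=
    measurable_pi_lambda _ fun a => measurable_pi_lambda _ fun b =>
      measurable_zeroOut hW.measurable_entry i j a b
  exact (hW.indepFun_zeroOut i j).integral_fun_comp_mul_comp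
    (hW.measurable_entry i j).aemeasurable hm.aemeasurable hφ.aestronglyMeasurable
    hg.aestronglyMeasurable

/-- A bound that holds when the entry `(i, j)` is at most `2 L` controls, up to a factor `2`, the
expectation of any nonnegative quantity not involving this entry. -/
theorem IsWignerModel.integral_zeroOut_le [IsProbabilityMeasure μ] (hW : IsWignerModel μ σ τ L W)
    (i j : Fin N) {g : Matrix (Fin N) (Fin N) ℂ → ℝ}
    (hg : Measurable fun x : Fin N → Fin N → ℂ => g (of x)) (hg0 : ∀ A, 0 ≤ g A)
    {G : Ω → ℝ} (hG0 : ∀ ω, 0 ≤ G ω) (hG : Integrable G μ)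
    (h : ∀ ω, ‖W ω i j‖ ≤ 2 * L → g (zeroOut (W ω) i j) ≤ G ω) :
    ∫ ω, g (zeroOut (W ω) i j) ∂μ ≤ 2 * ∫ ω, G ω ∂μ := by
  have hL := hW.one_le
  set φ : ℂ → ℝ := Set.indicator {w | ‖w‖ ≤ 2 * L} 1 with hφ
  have hS : MeasurableSet {w : ℂ | ‖w‖ ≤ 2 * L} := measurableSet_le measurable_norm measurable_const
  have hφm : Measurable φ := measurable_one.indicator hS
  have hφ01 : ∀ w, 0 ≤ φ w ∧ φ w ≤ 1 := by
    intro w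
    simp only [hφ, Set.indicator_apply]
    split_ifs <;> simp
  have hφi : Integrable (fun ω => φ (W ω i j)) μ :=
    integrable_of_bound (hφm.comp (hW.measurable_entry i j)) (C := 1) fun ω => by
      rw [Real.norm_of_nonneg (hφ01 _).1]; exact (hφ01 _).2
  have hmk : ∀ w, 1 - φ w ≤ ‖w‖ ^ 1 / (2 * L) := by
    intro w
    simp only [hφ, Set.indicator_apply, Set.mem_ofPred_eq]
    split_ifs with hw
    · simp; positivity
    · rw [le_div_iff₀ (by positivity)]; simp; linarith
  -- Markov's inequality: `E|w| ≤ L`, so `|w| ≤ 2L` has probability at least `1/2`.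
  have hP : 1 / 2 ≤ ∫ ω, φ (W ω i j) ∂μ := by
    have h1 : ∫ ω, (1 - φ (W ω i j)) ∂μ ≤ ∫ ω, ‖W ω i j‖ ^ 1 / (2 * L) ∂μ :=
      integral_mono ((integrable_const _).sub hφi)
        ((hW.integrable_pow i j 1 (by norm_num) (Or.inl (by norm_num))).div_const _)
        fun ω => hmk _
    rw [integral_sub (integrable_const _) hφi, integral_div] at h1
    have h2 := hW.moment_le i j 1 (by norm_num) (Or.inl (by norm_num))
    have h3 : (∫ ω, ‖W ω i j‖ ^ 1 ∂μ) / (2 * L) ≤ 1 / 2 := by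
      rw [div_le_div_iff₀ (by positivity) (by norm_num)]; linarith
    simp only [integral_const, probReal_univ, smul_eq_mul, mul_one] at h1
    linarith
  have hle : ∫ ω, φ (W ω i j) * g (zeroOut (W ω) i j) ∂μ ≤ ∫ ω, G ω ∂μ := by
    refine integral_mono_of_nonneg (Filter.Eventually.of_forall fun ω => ?_) hG
      (Filter.Eventually.of_forall fun ω => ?_)
    · exact mul_nonneg (hφ01 _).1 (hg0 _)
    · by_cases hw : ‖W ω i j‖ ≤ 2 * L
      · calc _ ≤ 1 * g (zeroOut (W ω) i j) := mul_le_mul_of_nonneg_right (hφ01 _).2 (hg0 _)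
          _ ≤ _ := by rw [one_mul]; exact h ω hw
      · have : φ (W ω i j) = 0 := by simp [hφ, hw]
        simp only [this, zero_mul]
        exact hG0 ω
  -- By independence the truncated expectation of `g` is the full one times the probability of the
  -- event, which is at least `1/2`.
  rw [hW.integral_mul_zeroOut i j hφm hg] at hle
  have h0 : 0 ≤ ∫ ω, g (zeroOut (W ω) i j) ∂μ := integral_nonneg fun ω => hg0 _
  nlinarith

/-- A moment of an entry times a bounded function of the other entries is integrable. -/
theorem IsWignerModel.integrable_pow_mul_zeroOut (hW : IsWignerModel μ σ τ L W) (i j : Fin N)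
    {k : ℕ} (hk : k ≤ 4) (hk' : k ≤ 2 ∨ i ≠ j) {g : Ω → ℝ} (hg : Integrable g μ) {C : ℝ}
    (hC : ∀ ω, ‖g ω‖ ≤ C) : Integrable (fun ω => ‖W ω i j‖ ^ k * g ω) μ :=
  (hW.integrable_pow i j k hk hk').mul_bdd hg.aestronglyMeasurable
    (Filter.Eventually.of_forall hC)

end ZeroOutIndependence

/-! ### Contribution of a single entry to the variance -/

section Variance

/-- The squared modulus of a coordinate of the row vector `u R(z)`. -/
noncomputable def rowSq {N : ℕ} (z : ℂ) (u : Fin N → ℂ) (W : Matrix (Fin N) (Fin N) ℂ)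
    (i : Fin N) : ℝ := ‖(u ᵥ* resolventMatrix W z) i‖ ^ 2

/-- The squared modulus of a coordinate of the column vector `R(z) v`. -/
noncomputable def colSq {N : ℕ} (z : ℂ) (v : Fin N → ℂ) (W : Matrix (Fin N) (Fin N) ℂ)
    (i : Fin N) : ℝ := ‖(resolventMatrix W z *ᵥ v) i‖ ^ 2

section Pointwise

variable {N : ℕ} {W : Matrix (Fin N) (Fin N) ℂ} {z : ℂ} {u v : Fin N → ℂ}

theorem rowSq_nonneg (i : Fin N) : 0 ≤ rowSq z u W i := sq_nonneg _

theorem colSq_nonneg (i : Fin N) : 0 ≤ colSq z v W i := sq_nonneg _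

theorem rowSq_le (hW : W.IsHermitian) (hz : z.im ≠ 0) (hu : ∑ i, ‖u i‖ ^ 2 ≤ 1) (i : Fin N) :
    rowSq z u W i ≤ 1 / |z.im| ^ 2 :=
  (Finset.single_le_sum (f := fun i => rowSq z u W i) (fun i _ => rowSq_nonneg i)
    (Finset.mem_univ i)).trans (sum_norm_sq_vecMul_resolventMatrix_le hW hz hu)

theorem colSq_le (hW : W.IsHermitian) (hz : z.im ≠ 0) (hv : ∑ i, ‖v i‖ ^ 2 ≤ 1) (i : Fin N) :
    colSq z v W i ≤ 1 / |z.im| ^ 2 :=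
  (Finset.single_le_sum (f := fun i => colSq z v W i) (fun i _ => colSq_nonneg i)
    (Finset.mem_univ i)).trans (sum_norm_sq_resolventMatrix_mulVec_le hW hz hv)

/-- The first order term yields only cross products of index `i` with index `j`, whose double sum is
at most a product of two bounded sums. Same-index products, which get repeated `N` times, occur only
in the remainder, with an extra factor `t² = 1/N`. -/
theorem norm_form_sub_sq_le (hW : W.IsHermitian) (hz : z.im ≠ 0) (i j : Fin N)
    (u v : Fin N → ℂ) :
    ‖u ⬝ᵥ (resolventMatrix W z *ᵥ v) - u ⬝ᵥ (resolventMatrix (zeroOut W i j) z *ᵥ v)‖ ^ 2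
      ≤ 4 * scale N ^ 2 * (‖W i j‖ ^ 2 *
          (rowSq z u (zeroOut W i j) i * colSq z v (zeroOut W i j) j
            + rowSq z u (zeroOut W i j) j * colSq z v (zeroOut W i j) i))
        + 8 * scale N ^ 4 / |z.im| ^ 2 * (‖W i j‖ ^ 4 *
          ((rowSq z u (zeroOut W i j) i + rowSq z u (zeroOut W i j) j)
            * (colSq z v (zeroOut W i j) i + colSq z v (zeroOut W i j) j))) := by
  have ht := scale_nonneg N
  set x := u ᵥ* resolventMatrix (zeroOut W i j) z with hx
  set y := resolventMatrix (zeroOut W i j) z *ᵥ v with hy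
  have h1 := norm_form_sub_form_zeroOut_le_second_order hW hz i j u v hx hy
  have h2 := norm_dotProduct_sub_zeroOut_mulVec_le hW i j x y
  set d := u ⬝ᵥ (resolventMatrix W z *ᵥ v) - u ⬝ᵥ y with hd
  set w := ‖W i j‖ with hw
  have h3 : ‖d‖ ≤ scale N * (w * (‖x i‖ * ‖y j‖ + ‖x j‖ * ‖y i‖))
      + (scale N * w) ^ 2 / |z.im| * ((‖x i‖ + ‖x j‖) * (‖y i‖ + ‖y j‖)) := by
    have h4 : ‖(scale N : ℂ) * (x ⬝ᵥ ((W - zeroOut W i j) *ᵥ y))‖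
        ≤ scale N * (w * (‖x i‖ * ‖y j‖ + ‖x j‖ * ‖y i‖)) := by
      rw [norm_mul, Complex.norm_real, Real.norm_of_nonneg ht]
      exact mul_le_mul_of_nonneg_left h2 ht
    have h5 := norm_le_norm_add_norm_sub' d ((scale N : ℂ) * (x ⬝ᵥ ((W - zeroOut W i j) *ᵥ y)))
    linarith
  have e1 : rowSq z u (zeroOut W i j) i = ‖x i‖ ^ 2 := rfl
  have e2 : rowSq z u (zeroOut W i j) j = ‖x j‖ ^ 2 := rfl
  have e3 : colSq z v (zeroOut W i j) i = ‖y i‖ ^ 2 := rfl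
  have e4 : colSq z v (zeroOut W i j) j = ‖y j‖ ^ 2 := rfl
  rw [e1, e2, e3, e4]
  generalize ‖x i‖ = a at *
  generalize ‖x j‖ = b at *
  generalize ‖y i‖ = c at *
  generalize ‖y j‖ = e at *
  have h6 := pow_le_pow_left₀ (norm_nonneg d) h3 2
  refine h6.trans ((add_sq_le).trans ?_)
  rw [mul_add]
  refine add_le_add ?_ ?_
  · have : (a * e + b * c) ^ 2 ≤ 2 * (a ^ 2 * e ^ 2 + b ^ 2 * c ^ 2) := by
      have := add_sq_le (a := a * e) (b := b * c)
      rwa [mul_pow, mul_pow] at this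
    calc 2 * (scale N * (w * (a * e + b * c))) ^ 2
        = 2 * (scale N ^ 2 * w ^ 2) * (a * e + b * c) ^ 2 := by ring
      _ ≤ 2 * (scale N ^ 2 * w ^ 2) * (2 * (a ^ 2 * e ^ 2 + b ^ 2 * c ^ 2)) := by gcongr
      _ = _ := by ring
  · have h7 : ((a + b) * (c + e)) ^ 2 ≤ 4 * ((a ^ 2 + b ^ 2) * (c ^ 2 + e ^ 2)) := by
      rw [mul_pow]
      calc (a + b) ^ 2 * (c + e) ^ 2 ≤ (2 * (a ^ 2 + b ^ 2)) * (2 * (c ^ 2 + e ^ 2)) := by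
            gcongr <;> exact add_sq_le
        _ = _ := by ring
    calc 2 * ((scale N * w) ^ 2 / |z.im| * ((a + b) * (c + e))) ^ 2
        = 2 * (scale N ^ 4 / |z.im| ^ 2 * w ^ 4) * ((a + b) * (c + e)) ^ 2 := by ring
      _ ≤ 2 * (scale N ^ 4 / |z.im| ^ 2 * w ^ 4) * (4 * ((a ^ 2 + b ^ 2) * (c ^ 2 + e ^ 2))) := by
          gcongr
      _ = _ := by ring

/-- A diagonal index is summed only once, so a first order bound is enough and only the second
moment of the entry is needed. -/
theorem norm_form_sub_sq_le_diag (hW : W.IsHermitian) (hz : z.im ≠ 0) (i : Fin N)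
    (hu : ∑ i, ‖u i‖ ^ 2 ≤ 1) (v : Fin N → ℂ) :
    ‖u ⬝ᵥ (resolventMatrix W z *ᵥ v) - u ⬝ᵥ (resolventMatrix (zeroOut W i i) z *ᵥ v)‖ ^ 2
      ≤ 4 * scale N ^ 2 / |z.im| ^ 2 * (‖W i i‖ ^ 2 * colSq z v (zeroOut W i i) i) := by
  have h := pow_le_pow_left₀ (norm_nonneg _) (norm_form_sub_form_zeroOut_le hW hz i i hu v) 2
  refine h.trans (le_of_eq ?_)
  unfold colSq
  ring

theorem sq_le_of_le_two_mul_add {a b c ε : ℝ} (ha : 0 ≤ a) (h : a ≤ 2 * b + ε * c) :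
    a ^ 2 ≤ 8 * b ^ 2 + 2 * ε ^ 2 * c ^ 2 := by
  have h1 := pow_le_pow_left₀ ha h 2
  have h2 := add_sq_le (a := 2 * b) (b := ε * c)
  nlinarith

theorem colSq_zeroOut_le (hW : W.IsHermitian) (hz : z.im ≠ 0) (i j : Fin N) (v : Fin N → ℂ)
    {ε : ℝ} (hε : scale N * ‖W i j‖ / |z.im| ≤ ε) (hε1 : ε ≤ 1) :
    colSq z v (zeroOut W i j) i ≤ 8 * colSq z v W i + 2 * ε ^ 2 * colSq z v W j :=
  sq_le_of_le_two_mul_add (norm_nonneg _) (norm_zeroOut_mulVec_le hW hz i j v hε hε1)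

theorem rowSq_zeroOut_le (hW : W.IsHermitian) (hz : z.im ≠ 0) (i j : Fin N) (u : Fin N → ℂ)
    {ε : ℝ} (hε : scale N * ‖W i j‖ / |z.im| ≤ ε) (hε1 : ε ≤ 1) :
    rowSq z u (zeroOut W i j) i ≤ 8 * rowSq z u W i + 2 * ε ^ 2 * rowSq z u W j :=
  sq_le_of_le_two_mul_add (norm_nonneg _) (norm_zeroOut_vecMul_le hW hz i j u hε hε1)

/-- Both orders of the pair `(i, j)` at once. -/
theorem sq_zeroOut_le (hW : W.IsHermitian) (hz : z.im ≠ 0) (i j : Fin N) (u v : Fin N → ℂ)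
    {ε : ℝ} (hε : scale N * ‖W i j‖ / |z.im| ≤ ε) (hε1 : ε ≤ 1) :
    (rowSq z u (zeroOut W i j) i ≤ 8 * rowSq z u W i + 2 * ε ^ 2 * rowSq z u W j ∧
      rowSq z u (zeroOut W i j) j ≤ 8 * rowSq z u W j + 2 * ε ^ 2 * rowSq z u W i) ∧
    (colSq z v (zeroOut W i j) i ≤ 8 * colSq z v W i + 2 * ε ^ 2 * colSq z v W j ∧
      colSq z v (zeroOut W i j) j ≤ 8 * colSq z v W j + 2 * ε ^ 2 * colSq z v W i) := by
  have hn : ‖W j i‖ = ‖W i j‖ := by rw [← hW.apply i j, norm_star]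
  have hε' : scale N * ‖W j i‖ / |z.im| ≤ ε := by rwa [hn]
  refine ⟨⟨rowSq_zeroOut_le hW hz i j u hε hε1, ?_⟩, colSq_zeroOut_le hW hz i j v hε hε1, ?_⟩
  · rw [zeroOut_comm]; exact rowSq_zeroOut_le hW hz j i u hε' hε1
  · rw [zeroOut_comm]; exact colSq_zeroOut_le hW hz j i v hε' hε1

end Pointwise

/-- Passing from the deleted to the full matrix turns cross products into cross products plus
same-index products, and the latter keep the factor `e`, later `ε²`, of order `1/N` for fixed `z`.
-/
theorem cross_products_le {a b c d a' b' c' d' e : ℝ} (ha : 0 ≤ a) (hb : 0 ≤ b) (hc : 0 ≤ c)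
    (hd : 0 ≤ d) (hc' : 0 ≤ c') (hd' : 0 ≤ d') (he : 0 ≤ e)
    (he1 : e ≤ 1)
    (h1 : a' ≤ 8 * a + 2 * e * b) (h2 : b' ≤ 8 * b + 2 * e * a) (h3 : c' ≤ 8 * c + 2 * e * d)
    (h4 : d' ≤ 8 * d + 2 * e * c) :
    a' * d' + b' * c' ≤ 68 * (a * d + b * c) + 32 * e * (a * c + b * d) ∧
    (a' + b') * (c' + d') ≤ 100 * (a * d + b * c + (a * c + b * d)) := by
  constructor
  · have h5 : a' * d' ≤ (8 * a + 2 * e * b) * (8 * d + 2 * e * c) :=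
      mul_le_mul h1 h4 hd' (by positivity)
    have h6 : b' * c' ≤ (8 * b + 2 * e * a) * (8 * c + 2 * e * d) :=
      mul_le_mul h2 h3 hc' (by positivity)
    have h7 : e * e * (a * d + b * c) ≤ 1 * (a * d + b * c) := by
      apply mul_le_mul_of_nonneg_right _ (by positivity)
      nlinarith
    nlinarith
  · have h5 : a' + b' ≤ 10 * (a + b) := by nlinarith
    have h6 : c' + d' ≤ 10 * (c + d) := by nlinarith
    calc (a' + b') * (c' + d') ≤ (10 * (a + b)) * (10 * (c + d)) :=
          mul_le_mul h5 h6 (by positivity) (by positivity)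
      _ = _ := by ring

variable {Ω : Type*} [MeasurableSpace Ω] {μ : Measure Ω} [IsProbabilityMeasure μ] {N : ℕ}
  {σ τ L : ℝ} {W : Ω → Matrix (Fin N) (Fin N) ℂ} {z : ℂ} {u v : Fin N → ℂ}

theorem measurable_rowSq (hW : ∀ i j, Measurable fun ω => W ω i j) (i : Fin N) :
    Measurable fun ω => rowSq z u (W ω) i :=
  (measurable_vecMul_resolventMatrix hW z u i).norm.pow_const 2

theorem measurable_colSq (hW : ∀ i j, Measurable fun ω => W ω i j) (i : Fin N) :
    Measurable fun ω => colSq z v (W ω) i :=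
  (measurable_resolventMatrix_mulVec hW z v i).norm.pow_const 2

theorem measurable_of_apply (i j : Fin N) :
    Measurable fun x : Fin N → Fin N → ℂ => (of x : Matrix (Fin N) (Fin N) ℂ) i j :=
  (measurable_pi_apply j).comp (measurable_pi_apply i)

theorem integrable_rowSq_mul_colSq (hW : ∀ i j, Measurable fun ω => W ω i j)
    (hH : ∀ ω, (W ω).IsHermitian) (hz : z.im ≠ 0) (hu : ∑ i, ‖u i‖ ^ 2 ≤ 1)
    (hv : ∑ i, ‖v i‖ ^ 2 ≤ 1) (i j : Fin N) :
    Integrable (fun ω => rowSq z u (W ω) i * colSq z v (W ω) j) μ := by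
  refine integrable_of_bound ((measurable_rowSq hW i).mul (measurable_colSq hW j))
    (C := 1 / |z.im| ^ 2 * (1 / |z.im| ^ 2)) fun ω => ?_
  rw [Real.norm_of_nonneg (mul_nonneg (rowSq_nonneg i) (colSq_nonneg j))]
  exact mul_le_mul (rowSq_le (hH ω) hz hu i) (colSq_le (hH ω) hz hv j) (colSq_nonneg j)
    (by positivity)

theorem integrable_colSq (hW : ∀ i j, Measurable fun ω => W ω i j)
    (hH : ∀ ω, (W ω).IsHermitian) (hz : z.im ≠ 0) (hv : ∑ i, ‖v i‖ ^ 2 ≤ 1) (j : Fin N) :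
    Integrable (fun ω => colSq z v (W ω) j) μ := by
  refine integrable_of_bound (measurable_colSq hW j) (C := 1 / |z.im| ^ 2) fun ω => ?_
  rw [Real.norm_of_nonneg (colSq_nonneg j)]
  exact colSq_le (hH ω) hz hv j

/-- The moments of the entry factor out by independence, and the remaining expectations return to
the full matrix through `integral_zeroOut_le` and `cross_products_le`. The constants are `4·2·68`,
`8·2·100` and `4·2·32`, the middle factor being the price of the truncation. -/
theorem IsWignerModel.integral_norm_form_sub_sq_le (hW : IsWignerModel μ σ τ L W)
    (hz : z.im ≠ 0) (hu : ∑ i, ‖u i‖ ^ 2 ≤ 1) (hv : ∑ i, ‖v i‖ ^ 2 ≤ 1)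
    {i j : Fin N} (hij : i ≠ j) {ε : ℝ} (hε : scale N * (2 * L) / |z.im| = ε) (hε1 : ε ≤ 1) :
    ∫ ω, ‖u ⬝ᵥ (resolventMatrix (W ω) z *ᵥ v)
        - u ⬝ᵥ (resolventMatrix (zeroOut (W ω) i j) z *ᵥ v)‖ ^ 2 ∂μ
      ≤ ∫ ω, ((544 * L * scale N ^ 2 + 1600 * L * scale N ^ 4 / |z.im| ^ 2) *
            (rowSq z u (W ω) i * colSq z v (W ω) j + rowSq z u (W ω) j * colSq z v (W ω) i)
          + (256 * L * scale N ^ 2 * ε ^ 2 + 1600 * L * scale N ^ 4 / |z.im| ^ 2) *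
            (rowSq z u (W ω) i * colSq z v (W ω) i + rowSq z u (W ω) j * colSq z v (W ω) j)) ∂μ := by
  have hη := abs_pos.2 hz
  have ht := scale_nonneg N
  have hL := hW.one_le
  have hm := hW.measurable_entry
  have hH := hW.isHermitian
  have hm0 := measurable_zeroOut hm i j
  have hH0 : ∀ ω, (zeroOut (W ω) i j).IsHermitian := fun ω => zeroOut_isHermitian (hH ω) i j
  have hε0 : 0 ≤ ε := by rw [← hε]; positivity
  set A : Matrix (Fin N) (Fin N) ℂ → ℝ := fun M =>
    rowSq z u M i * colSq z v M j + rowSq z u M j * colSq z v M i with hA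
  set B : Matrix (Fin N) (Fin N) ℂ → ℝ := fun M =>
    (rowSq z u M i + rowSq z u M j) * (colSq z v M i + colSq z v M j) with hB
  set D : Matrix (Fin N) (Fin N) ℂ → ℝ := fun M =>
    rowSq z u M i * colSq z v M i + rowSq z u M j * colSq z v M j with hD
  have hBAD : ∀ M, B M = A M + D M := fun M => by simp only [hA, hB, hD]; ring
  have hA0 : ∀ M, 0 ≤ A M := fun M => add_nonneg (mul_nonneg (rowSq_nonneg _) (colSq_nonneg _))
    (mul_nonneg (rowSq_nonneg _) (colSq_nonneg _))
  have hD0 : ∀ M, 0 ≤ D M := fun M => add_nonneg (mul_nonneg (rowSq_nonneg _) (colSq_nonneg _))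
    (mul_nonneg (rowSq_nonneg _) (colSq_nonneg _))
  have hB0 : ∀ M, 0 ≤ B M := fun M => by rw [hBAD]; exact add_nonneg (hA0 M) (hD0 M)
  have hAm : Measurable fun x : Fin N → Fin N → ℂ => A (of x) :=
    ((measurable_rowSq measurable_of_apply i).mul (measurable_colSq measurable_of_apply j)).add
      ((measurable_rowSq measurable_of_apply j).mul (measurable_colSq measurable_of_apply i))
  have hBm : Measurable fun x : Fin N → Fin N → ℂ => B (of x) :=
    ((measurable_rowSq measurable_of_apply i).add (measurable_rowSq measurable_of_apply j)).mul
      ((measurable_colSq measurable_of_apply i).add (measurable_colSq measurable_of_apply j))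
  have hAi : Integrable (fun ω => A (W ω)) μ :=
    (integrable_rowSq_mul_colSq hm hH hz hu hv i j).add
      (integrable_rowSq_mul_colSq hm hH hz hu hv j i)
  have hDi : Integrable (fun ω => D (W ω)) μ :=
    (integrable_rowSq_mul_colSq hm hH hz hu hv i i).add
      (integrable_rowSq_mul_colSq hm hH hz hu hv j j)
  have hAi0 : Integrable (fun ω => A (zeroOut (W ω) i j)) μ :=
    (integrable_rowSq_mul_colSq hm0 hH0 hz hu hv i j).add
      (integrable_rowSq_mul_colSq hm0 hH0 hz hu hv j i)
  have hDi0 : Integrable (fun ω => D (zeroOut (W ω) i j)) μ :=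
    (integrable_rowSq_mul_colSq hm0 hH0 hz hu hv i i).add
      (integrable_rowSq_mul_colSq hm0 hH0 hz hu hv j j)
  have hBi0 : Integrable (fun ω => B (zeroOut (W ω) i j)) μ := by
    simp_rw [hBAD]; exact hAi0.add hDi0
  have hBC : ∀ ω, ‖B (zeroOut (W ω) i j)‖
      ≤ (1 / |z.im| ^ 2 + 1 / |z.im| ^ 2) * (1 / |z.im| ^ 2 + 1 / |z.im| ^ 2) := by
    intro ω
    rw [Real.norm_of_nonneg (hB0 _)]
    exact mul_le_mul (add_le_add (rowSq_le (hH0 ω) hz hu i) (rowSq_le (hH0 ω) hz hu j))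
      (add_le_add (colSq_le (hH0 ω) hz hv i) (colSq_le (hH0 ω) hz hv j))
      (add_nonneg (colSq_nonneg _) (colSq_nonneg _)) (by positivity)
  have hAC : ∀ ω, ‖A (zeroOut (W ω) i j)‖
      ≤ (1 / |z.im| ^ 2 + 1 / |z.im| ^ 2) * (1 / |z.im| ^ 2 + 1 / |z.im| ^ 2) := by
    intro ω
    refine le_trans ?_ (hBC ω)
    rw [Real.norm_of_nonneg (hA0 _), Real.norm_of_nonneg (hB0 _), hBAD]
    linarith [hD0 (zeroOut (W ω) i j)]
  have hcmp : ∀ ω, ‖W ω i j‖ ≤ 2 * L →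
      A (zeroOut (W ω) i j) ≤ 68 * A (W ω) + 32 * ε ^ 2 * D (W ω) ∧
      B (zeroOut (W ω) i j) ≤ 100 * (A (W ω) + D (W ω)) := by
    intro ω hω
    have hε' : scale N * ‖W ω i j‖ / |z.im| ≤ ε := by rw [← hε]; gcongr
    obtain ⟨⟨h1, h2⟩, h3, h4⟩ := sq_zeroOut_le (hH ω) hz i j u v hε' hε1
    exact cross_products_le (rowSq_nonneg _) (rowSq_nonneg _) (colSq_nonneg _) (colSq_nonneg _)
      (colSq_nonneg _) (colSq_nonneg _) (sq_nonneg ε)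
      (pow_le_one₀ hε0 hε1) h1 h2 h3 h4
  have hEA : ∫ ω, A (zeroOut (W ω) i j) ∂μ
      ≤ 2 * ∫ ω, (68 * A (W ω) + 32 * ε ^ 2 * D (W ω)) ∂μ :=
    hW.integral_zeroOut_le i j hAm hA0
      (fun ω => by have := hA0 (W ω); have := hD0 (W ω); positivity)
      ((hAi.const_mul _).add (hDi.const_mul _)) fun ω hω => (hcmp ω hω).1
  have hEB : ∫ ω, B (zeroOut (W ω) i j) ∂μ ≤ 2 * ∫ ω, (100 * (A (W ω) + D (W ω))) ∂μ :=
    hW.integral_zeroOut_le i j hBm hB0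
      (fun ω => by have := hA0 (W ω); have := hD0 (W ω); positivity)
      ((hAi.add hDi).const_mul _) fun ω hω => (hcmp ω hω).2
  have hi1 := hW.integrable_pow_mul_zeroOut i j (k := 2) (by norm_num) (Or.inr hij) hAi0 hAC
  have hi2 := hW.integrable_pow_mul_zeroOut i j (k := 4) (by norm_num) (Or.inr hij) hBi0 hBC
  have hmain : ∫ ω, ‖u ⬝ᵥ (resolventMatrix (W ω) z *ᵥ v)
        - u ⬝ᵥ (resolventMatrix (zeroOut (W ω) i j) z *ᵥ v)‖ ^ 2 ∂μ
      ≤ ∫ ω, (4 * scale N ^ 2 * (‖W ω i j‖ ^ 2 * A (zeroOut (W ω) i j))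
        + 8 * scale N ^ 4 / |z.im| ^ 2 * (‖W ω i j‖ ^ 4 * B (zeroOut (W ω) i j))) ∂μ :=
    integral_mono_of_nonneg (Filter.Eventually.of_forall fun ω => sq_nonneg _)
      ((hi1.const_mul _).add (hi2.const_mul _))
      (Filter.Eventually.of_forall fun ω => norm_form_sub_sq_le (hH ω) hz i j u v)
  rw [integral_add (hi1.const_mul _) (hi2.const_mul _), integral_const_mul, integral_const_mul,
    hW.integral_mul_zeroOut i j (φ := fun w => ‖w‖ ^ 2) (measurable_norm.pow_const 2) hAm,
    hW.integral_mul_zeroOut i j (φ := fun w => ‖w‖ ^ 4) (measurable_norm.pow_const 4) hBm] at hmain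
  refine hmain.trans ?_
  have hw2 := hW.moment_le i j 2 (by norm_num) (Or.inr hij)
  have hw4 := hW.moment_le i j 4 (by norm_num) (Or.inr hij)
  rw [integral_add (hAi.const_mul _) (hDi.const_mul _), integral_const_mul,
    integral_const_mul] at hEA
  rw [integral_const_mul, integral_add hAi hDi] at hEB
  rw [integral_add (hAi.const_mul _) (hDi.const_mul _), integral_const_mul, integral_const_mul]
  have hnA : 0 ≤ ∫ ω, A (zeroOut (W ω) i j) ∂μ := integral_nonneg fun ω => hA0 _
  have hnB : 0 ≤ ∫ ω, B (zeroOut (W ω) i j) ∂μ := integral_nonneg fun ω => hB0 _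
  have h1 := mul_le_mul hw2 hEA hnA (by linarith)
  have h2 := mul_le_mul hw4 hEB hnB (by linarith)
  have h3 := mul_le_mul_of_nonneg_left h1 (show 0 ≤ 4 * scale N ^ 2 by positivity)
  have h4 := mul_le_mul_of_nonneg_left h2 (show 0 ≤ 8 * scale N ^ 4 / |z.im| ^ 2 by positivity)
  refine (add_le_add h3 h4).trans (le_of_eq ?_)
  ring

theorem IsWignerModel.integral_norm_form_sub_sq_le_diag (hW : IsWignerModel μ σ τ L W)
    (hz : z.im ≠ 0) (hu : ∑ i, ‖u i‖ ^ 2 ≤ 1) (hv : ∑ i, ‖v i‖ ^ 2 ≤ 1)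
    (i : Fin N) (hε1 : scale N * (2 * L) / |z.im| ≤ 1) :
    ∫ ω, ‖u ⬝ᵥ (resolventMatrix (W ω) z *ᵥ v)
        - u ⬝ᵥ (resolventMatrix (zeroOut (W ω) i i) z *ᵥ v)‖ ^ 2 ∂μ
      ≤ ∫ ω, 80 * L * scale N ^ 2 / |z.im| ^ 2 * colSq z v (W ω) i ∂μ := by
  have hη := abs_pos.2 hz
  have ht := scale_nonneg N
  have hL := hW.one_le
  have hm := hW.measurable_entry
  have hH := hW.isHermitian
  have hm0 := measurable_zeroOut hm i i
  have hH0 : ∀ ω, (zeroOut (W ω) i i).IsHermitian := fun ω => zeroOut_isHermitian (hH ω) i i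
  have hi0 := integrable_colSq (μ := μ) hm0 hH0 hz hv i
  have hi := integrable_colSq (μ := μ) hm hH hz hv i
  have hE : ∫ ω, colSq z v (zeroOut (W ω) i i) i ∂μ ≤ 2 * ∫ ω, 10 * colSq z v (W ω) i ∂μ := by
    refine hW.integral_zeroOut_le i i (g := fun M => colSq z v M i)
      (measurable_colSq measurable_of_apply i) (fun M => colSq_nonneg i)
      (fun ω => by have := colSq_nonneg (z := z) (v := v) (W := W ω) i; positivity)
      (hi.const_mul _) fun ω hω => ?_
    have hε' : scale N * ‖W ω i i‖ / |z.im| ≤ 1 := le_trans (by gcongr) hε1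
    have := colSq_zeroOut_le (hH ω) hz i i v hε' le_rfl
    linarith
  have hi1 := hW.integrable_pow_mul_zeroOut i i (k := 2) (by norm_num) (Or.inl le_rfl) hi0
    (C := 1 / |z.im| ^ 2) (fun ω => by
      rw [Real.norm_of_nonneg (colSq_nonneg i)]; exact colSq_le (hH0 ω) hz hv i)
  have hmain : ∫ ω, ‖u ⬝ᵥ (resolventMatrix (W ω) z *ᵥ v)
        - u ⬝ᵥ (resolventMatrix (zeroOut (W ω) i i) z *ᵥ v)‖ ^ 2 ∂μ
      ≤ ∫ ω, 4 * scale N ^ 2 / |z.im| ^ 2 *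
        (‖W ω i i‖ ^ 2 * colSq z v (zeroOut (W ω) i i) i) ∂μ :=
    integral_mono_of_nonneg (Filter.Eventually.of_forall fun ω => sq_nonneg _)
      (hi1.const_mul _)
      (Filter.Eventually.of_forall fun ω => norm_form_sub_sq_le_diag (hH ω) hz i hu v)
  rw [integral_const_mul,
    hW.integral_mul_zeroOut i i (φ := fun w => ‖w‖ ^ 2) (measurable_norm.pow_const 2)
      (g := fun M => colSq z v M i) (measurable_colSq measurable_of_apply i)] at hmain
  rw [integral_const_mul] at hE ⊢
  have hw2 := hW.moment_le i i 2 (by norm_num) (Or.inl le_rfl)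
  have h1 := mul_le_mul hw2 hE (integral_nonneg fun ω => colSq_nonneg i) (by linarith)
  have h3 := mul_le_mul_of_nonneg_left h1
    (show 0 ≤ 4 * scale N ^ 2 / |z.im| ^ 2 by positivity)
  refine hmain.trans (h3.trans (le_of_eq ?_))
  ring

end Variance

/-! ### The variance bound -/

section VarianceBound

theorem norm_form_le {N : ℕ} {W : Matrix (Fin N) (Fin N) ℂ} {z : ℂ} {u v : Fin N → ℂ}
    (hW : W.IsHermitian) (hz : z.im ≠ 0) (hu : ∑ i, ‖u i‖ ^ 2 ≤ 1)
    (hv : ∑ i, ‖v i‖ ^ 2 ≤ 1) : ‖u ⬝ᵥ (resolventMatrix W z *ᵥ v)‖ ≤ 1 / |z.im| := by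
  have hη := abs_pos.2 hz
  have h := norm_dotProduct_le (p := u) (q := resolventMatrix W z *ᵥ v) (a := 1) (b := 1 / |z.im|)
    (by norm_num) (by positivity) (by simpa using hu)
    (by simpa [div_pow] using sum_norm_sq_resolventMatrix_mulVec_le hW hz hv)
  calc _ ≤ ∑ i, ‖u i * (resolventMatrix W z *ᵥ v) i‖ := norm_sum_le _ _
    _ = ∑ i, ‖u i‖ * ‖(resolventMatrix W z *ᵥ v) i‖ := by simp_rw [norm_mul]
    _ ≤ _ := by simpa using h

/-- Cross products sum to `2(∑X)(∑Y)`, with no factor `n`; same-index products sum to `2n ∑ XY`.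
This is why `β` must be a factor `n` smaller than `α` to contribute at the same order. -/
theorem sum_sum_products_le {n : ℕ} {X Y : Fin n → ℝ} {e α β γ : ℝ} (hX : ∀ i, 0 ≤ X i)
    (hY : ∀ i, 0 ≤ Y i) (hα : 0 ≤ α) (hβ : 0 ≤ β) (hγ : 0 ≤ γ) (hXe : ∑ i, X i ≤ e)
    (hYe : ∑ i, Y i ≤ e) :
    ∑ i, ∑ j, (α * (X i * Y j + X j * Y i) + β * (X i * Y i + X j * Y j)
        + if i = j then γ * Y i else 0)
      ≤ 2 * α * (e * e) + 2 * β * n * (e * e) + γ * e := by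
  have hX0 : 0 ≤ ∑ i, X i := Finset.sum_nonneg fun i _ => hX i
  have hY0 : 0 ≤ ∑ i, Y i := Finset.sum_nonneg fun i _ => hY i
  have he : 0 ≤ e := hX0.trans hXe
  have hprod : (∑ i, X i) * ∑ i, Y i ≤ e * e := mul_le_mul hXe hYe hY0 he
  have hdiag : ∑ i, X i * Y i ≤ e * e := by
    refine le_trans ?_ hprod
    rw [Finset.sum_mul]
    exact Finset.sum_le_sum fun i _ => mul_le_mul_of_nonneg_left
      (Finset.single_le_sum (fun i _ => hY i) (Finset.mem_univ i)) (hX i)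
  have hA : ∑ i, ∑ j, (X i * Y j + X j * Y i) = 2 * ((∑ i, X i) * ∑ i, Y i) := by
    simp_rw [Finset.sum_add_distrib, ← Finset.mul_sum, ← Finset.sum_mul]
    rw [← Finset.mul_sum]
    ring
  have hD : ∑ i, ∑ j, (X i * Y i + X j * Y j) = 2 * n * ∑ i, X i * Y i := by
    simp_rw [Finset.sum_add_distrib]
    simp only [Finset.sum_const, Finset.card_univ, Fintype.card_fin, nsmul_eq_mul,
      ← Finset.mul_sum]
    ring
  have hsplit : ∑ i, ∑ j, (α * (X i * Y j + X j * Y i) + β * (X i * Y i + X j * Y j)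
        + if i = j then γ * Y i else 0)
      = α * ∑ i, ∑ j, (X i * Y j + X j * Y i) + β * ∑ i, ∑ j, (X i * Y i + X j * Y j)
        + γ * ∑ i, Y i := by
    simp_rw [Finset.mul_sum, ← Finset.sum_add_distrib]
    refine Finset.sum_congr rfl fun i _ => ?_
    rw [Finset.sum_add_distrib]
    simp
  rw [hsplit, hA, hD]
  have h1 := mul_le_mul_of_nonneg_left hprod (show 0 ≤ 2 * α by positivity)
  have h2 := mul_le_mul_of_nonneg_left hdiag (show 0 ≤ 2 * β * n by positivity)
  have h3 := mul_le_mul_of_nonneg_left hYe hγ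
  linarith

variable {Ω : Type*} [MeasurableSpace Ω] {μ : Measure Ω} [IsProbabilityMeasure μ] {N : ℕ}
  {σ τ L : ℝ} {W : Ω → Matrix (Fin N) (Fin N) ℂ} {z : ℂ} {u v : Fin N → ℂ}

theorem IsWignerModel.memLp_form (hW : IsWignerModel μ σ τ L W) (hz : z.im ≠ 0)
    (hu : ∑ i, ‖u i‖ ^ 2 ≤ 1) (hv : ∑ i, ‖v i‖ ^ 2 ≤ 1) :
    MemLp (fun ω => u ⬝ᵥ (resolventMatrix (W ω) z *ᵥ v)) 2 μ :=
  memLp_two_of_bound (measurable_form hW.measurable_entry z u v) fun ω =>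
    norm_form_le (hW.isHermitian ω) hz hu hv

theorem IsWignerModel.variance_form_le_sum (hW : IsWignerModel μ σ τ L W) (hz : z.im ≠ 0)
    (hu : ∑ i, ‖u i‖ ^ 2 ≤ 1) (hv : ∑ i, ‖v i‖ ^ 2 ≤ 1) :
    complexVariance μ (fun ω => u ⬝ᵥ (resolventMatrix (W ω) z *ᵥ v))
      ≤ ∑ i, ∑ j, ∫ ω, ‖u ⬝ᵥ (resolventMatrix (W ω) z *ᵥ v)
        - u ⬝ᵥ (resolventMatrix (zeroOut (W ω) i j) z *ᵥ v)‖ ^ 2 ∂μ := by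
  -- The boundedness is required for every argument, not just almost surely; `hermitianOfEntries` is
  -- Hermitian for every input because it keeps only real parts on the diagonal.
  have h := efronStein (0 : ℂ) hW.indep (fun p => hW.measurable_entry _ _)
    (f := fun y => u ⬝ᵥ (resolventMatrix (hermitianOfEntries y) z *ᵥ v))
    (measurable_form measurable_hermitianOfEntries_apply z u v)
    (C := 1 / |z.im|) fun y => norm_form_le (hermitianOfEntries_isHermitian y) hz hu hv
  simp_rw [hermitianOfEntries_update, hermitianOfEntries_entries (hW.isHermitian _)] at h
  refine h.trans ?_
  rw [← Fintype.sum_prod_type' (f := fun i j => ∫ ω, ‖u ⬝ᵥ (resolventMatrix (W ω) z *ᵥ v)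
        - u ⬝ᵥ (resolventMatrix (zeroOut (W ω) i j) z *ᵥ v)‖ ^ 2 ∂μ)]
  rw [← Finset.sum_subtype (Finset.univ.filter fun p : Fin N × Fin N => p.1 ≤ p.2) (by simp)
    (fun p : Fin N × Fin N => ∫ ω, ‖u ⬝ᵥ (resolventMatrix (W ω) z *ᵥ v)
        - u ⬝ᵥ (resolventMatrix (zeroOut (W ω) p.1 p.2) z *ᵥ v)‖ ^ 2 ∂μ)]
  exact Finset.sum_le_sum_of_subset_of_nonneg (Finset.filter_subset _ _)
    fun p _ _ => integral_nonneg fun ω => sq_nonneg _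

/-- The variance of a resolvent form of a Wigner matrix. -/
theorem IsWignerModel.variance_form_le [NeZero N] (hW : IsWignerModel μ σ τ L W) (hz : z.im ≠ 0)
    (hu : ∑ i, ‖u i‖ ^ 2 ≤ 1) (hv : ∑ i, ‖v i‖ ^ 2 ≤ 1) :
    complexVariance μ (fun ω => u ⬝ᵥ (resolventMatrix (W ω) z *ᵥ v))
      ≤ 10000 * L ^ 3 * scale N ^ 2 * ((|z.im|⁻¹) ^ 4 + (|z.im|⁻¹) ^ 6) := by
  have hη := abs_pos.2 hz
  have ht := scale_pos (N := N)
  have ht1 := scale_le_one (N := N)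
  have hNt := natCast_mul_scale_sq (N := N)
  have hL := hW.one_le
  have hm := hW.measurable_entry
  have hH := hW.isHermitian
  have hx0 : 0 < |z.im|⁻¹ := inv_pos.2 hη
  set x := |z.im|⁻¹ with hx
  set t := scale N with ht'
  have hdiv : ∀ a : ℝ, ∀ k : ℕ, a / |z.im| ^ k = a * x ^ k := by
    intro a k; rw [hx, inv_pow, div_eq_mul_inv]
  have hL2 : 1 ≤ L ^ 2 := one_le_pow₀ hL
  have hL3 : L ≤ L ^ 3 := by nlinarith
  -- The comparison of deleted and full matrices requires `2Lt/η ≤ 1`; in the opposite case the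
  -- trivial bound `x²` on the variance is already good enough.
  rcases le_or_gt (t * (2 * L) / |z.im|) 1 with hε1 | hε1
  · set ε := t * (2 * L) / |z.im| with hε
    have hεx : ε = 2 * L * t * x := by rw [hε, hx, div_eq_mul_inv]; ring
    set α := 544 * L * t ^ 2 + 1600 * L * t ^ 4 / |z.im| ^ 2 with hα
    set β := 256 * L * t ^ 2 * ε ^ 2 + 1600 * L * t ^ 4 / |z.im| ^ 2 with hβ
    set γ := 80 * L * t ^ 2 / |z.im| ^ 2 with hγ
    have hα0 : 0 ≤ α := by positivity
    have hβ0 : 0 ≤ β := by positivity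
    have hγ0 : 0 ≤ γ := by positivity
    set H : Fin N → Fin N → Ω → ℝ := fun i j ω =>
      α * (rowSq z u (W ω) i * colSq z v (W ω) j + rowSq z u (W ω) j * colSq z v (W ω) i)
      + β * (rowSq z u (W ω) i * colSq z v (W ω) i + rowSq z u (W ω) j * colSq z v (W ω) j)
      + if i = j then γ * colSq z v (W ω) i else 0 with hHdef
    have hXY := fun i j => integrable_rowSq_mul_colSq (μ := μ) hm hH hz hu hv i j
    have hHi : ∀ i j, Integrable (H i j) μ := by
      intro i j
      refine (((hXY i j).add (hXY j i)).const_mul α).add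
        (((hXY i i).add (hXY j j)).const_mul β) |>.add ?_
      split_ifs
      · exact (integrable_colSq hm hH hz hv i).const_mul γ
      · exact integrable_const _
    have hT : ∀ i j, ∫ ω, ‖u ⬝ᵥ (resolventMatrix (W ω) z *ᵥ v)
        - u ⬝ᵥ (resolventMatrix (zeroOut (W ω) i j) z *ᵥ v)‖ ^ 2 ∂μ ≤ ∫ ω, H i j ω ∂μ := by
      intro i j
      by_cases hij : i = j
      · subst hij
        refine (hW.integral_norm_form_sub_sq_le_diag hz hu hv i hε1).trans ?_
        refine integral_mono ((integrable_colSq hm hH hz hv i).const_mul γ) (hHi i i) fun ω => ?_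
        have h1 := mul_nonneg (rowSq_nonneg (z := z) (u := u) (W := W ω) i)
          (colSq_nonneg (z := z) (v := v) (W := W ω) i)
        simp only [hHdef, if_true]
        have h2 := mul_nonneg hα0 (add_nonneg h1 h1)
        have h3 := mul_nonneg hβ0 (add_nonneg h1 h1)
        linarith
      · refine (hW.integral_norm_form_sub_sq_le hz hu hv hij hε.symm hε1).trans (le_of_eq ?_)
        simp only [hHdef, if_neg hij, add_zero]
        rfl
    refine (hW.variance_form_le_sum hz hu hv).trans ?_
    have hsum : ∑ i, ∑ j, ∫ ω, ‖u ⬝ᵥ (resolventMatrix (W ω) z *ᵥ v)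
        - u ⬝ᵥ (resolventMatrix (zeroOut (W ω) i j) z *ᵥ v)‖ ^ 2 ∂μ
        ≤ ∫ ω, ∑ i, ∑ j, H i j ω ∂μ := by
      rw [integral_finsetSum _ fun i _ => integrable_finsetSum _ fun j _ => hHi i j]
      refine Finset.sum_le_sum fun i _ => ?_
      rw [integral_finsetSum _ fun j _ => hHi i j]
      exact Finset.sum_le_sum fun j _ => hT i j
    have hbd : ∫ ω, ∑ i, ∑ j, H i j ω ∂μ
        ≤ ∫ _ω, (2 * α * (x ^ 2 * x ^ 2) + 2 * β * N * (x ^ 2 * x ^ 2) + γ * x ^ 2) ∂μ := by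
      refine integral_mono (integrable_finsetSum _ fun i _ => integrable_finsetSum _ fun j _ =>
        hHi i j) (integrable_const _) fun ω => ?_
      refine sum_sum_products_le (fun i => rowSq_nonneg i) (fun i => colSq_nonneg i) hα0 hβ0 hγ0
        ?_ ?_
      · exact (sum_norm_sq_vecMul_resolventMatrix_le (hH ω) hz hu).trans (by rw [hdiv, one_mul])
      · exact (sum_norm_sq_resolventMatrix_mulVec_le (hH ω) hz hv).trans (by rw [hdiv, one_mul])
    refine hsum.trans (hbd.trans ?_)
    rw [integral_const, probReal_univ, one_smul, hα, hβ, hγ, hdiv, hdiv, hεx]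
    -- Each term of `β` carries `t⁴`, so one factor `t²` cancels the `N` produced by the same-index
    -- sum.
    have e1 : 2 * (544 * L * t ^ 2 + 1600 * L * t ^ 4 * x ^ 2) * (x ^ 2 * x ^ 2)
        + 2 * (256 * L * t ^ 2 * (2 * L * t * x) ^ 2 + 1600 * L * t ^ 4 * x ^ 2) * N *
          (x ^ 2 * x ^ 2) + 80 * L * t ^ 2 * x ^ 2 * x ^ 2
        = 1168 * (L * (t ^ 2 * x ^ 4)) + 3200 * (L * (t ^ 2 * x ^ 6)) * t ^ 2
          + (2048 * (L ^ 3 * (t ^ 2 * x ^ 6)) + 3200 * (L * (t ^ 2 * x ^ 6))) * (N * t ^ 2) := by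
      ring
    rw [e1, hNt]
    have ht2 : t ^ 2 ≤ 1 := pow_le_one₀ ht.le ht1
    have p1 : 0 ≤ t ^ 2 * x ^ 4 := by positivity
    have p2 : 0 ≤ t ^ 2 * x ^ 6 := by positivity
    have q1 := mul_le_mul_of_nonneg_right hL3 p1
    have q2 := mul_le_mul_of_nonneg_right hL3 p2
    have q3 : L * (t ^ 2 * x ^ 6) * t ^ 2 ≤ L * (t ^ 2 * x ^ 6) * 1 :=
      mul_le_mul_of_nonneg_left ht2 (by positivity)
    have p3 : 0 ≤ L ^ 3 * (t ^ 2 * x ^ 4) := by positivity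
    have p4 : 0 ≤ L ^ 3 * (t ^ 2 * x ^ 6) := by positivity
    linarith
  · have h1 := integral_norm_sub_integral_sq_add (hW.memLp_form hz hu hv) 0
    have h2 : ∫ ω, ‖u ⬝ᵥ (resolventMatrix (W ω) z *ᵥ v) - 0‖ ^ 2 ∂μ ≤ ∫ _ω, x ^ 2 ∂μ := by
      refine integral_mono_of_nonneg (Filter.Eventually.of_forall fun ω => sq_nonneg _)
        (integrable_const _) (Filter.Eventually.of_forall fun ω => ?_)
      simp only [sub_zero]
      have := norm_form_le (hH ω) hz hu hv
      rw [one_div] at this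
      exact pow_le_pow_left₀ (norm_nonneg _) this 2
    rw [integral_const, probReal_univ, one_smul] at h2
    have h3 : complexVariance μ (fun ω => u ⬝ᵥ (resolventMatrix (W ω) z *ᵥ v)) ≤ x ^ 2 := by
      unfold complexVariance
      have := sq_nonneg ‖∫ y, u ⬝ᵥ (resolventMatrix (W y) z *ᵥ v) ∂μ - 0‖
      linarith
    -- Multiplying `x²` by the square of a quantity larger than `1` supplies the missing factor `t²
    -- x²`.
    have h4 : 1 < 2 * L * t * x := by
      rw [div_eq_mul_inv, ← hx] at hε1; linarith
    have h5 : 1 ≤ (2 * L * t * x) ^ 2 := one_le_pow₀ h4.le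
    have h6 : x ^ 2 * 1 ≤ x ^ 2 * (2 * L * t * x) ^ 2 := mul_le_mul_of_nonneg_left h5 (sq_nonneg x)
    have h7 : x ^ 2 * (2 * L * t * x) ^ 2 = 4 * (L ^ 2 * (t ^ 2 * x ^ 4)) := by ring
    have h8 : L ^ 2 ≤ L ^ 3 := pow_le_pow_right₀ hL (by norm_num)
    have p1 : 0 ≤ t ^ 2 * x ^ 4 := by positivity
    have p3 : 0 ≤ L ^ 3 * (t ^ 2 * x ^ 4) := by positivity
    have p4 : 0 ≤ L ^ 3 * (t ^ 2 * x ^ 6) := by positivity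
    have h9 := mul_le_mul_of_nonneg_right h8 p1
    linarith

end VarianceBound

/-! ### Expansion of the terms of the resolvent equation -/

section Expansion

section Pointwise

variable {N : ℕ} {W : Matrix (Fin N) (Fin N) ℂ} {z : ℂ}

/-- Second order expansion of `W i k * (R(z) v) k` in the entry `W i k`. -/
theorem norm_entry_mul_mulVec_sub_le (hW : W.IsHermitian) (hz : z.im ≠ 0) {i k : Fin N}
    (hik : i ≠ k) (v : Fin N → ℂ) {R₀ : Matrix (Fin N) (Fin N) ℂ} {y y₀ : Fin N → ℂ}
    (hR₀ : R₀ = resolventMatrix (zeroOut W i k) z) (hy : y = resolventMatrix W z *ᵥ v)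
    (hy₀ : y₀ = R₀ *ᵥ v) :
    ‖W i k * y k - W i k * y₀ k
        - scale N * (W i k ^ 2 * (R₀ k i * y₀ k) + ((‖W i k‖ ^ 2 : ℝ) : ℂ) * (R₀ k k * y₀ i))‖
      ≤ 2 * scale N ^ 2 / |z.im| ^ 2 * (‖W i k‖ ^ 3 * (‖y₀ i‖ + ‖y₀ k‖)) := by
  have ht := scale_nonneg N
  have hη := abs_pos.2 hz
  have hH₀ := zeroOut_isHermitian hW i k
  have h := norm_form_sub_form_zeroOut_le_second_order hW hz i k (Pi.single k 1) v rfl rfl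
  rw [dotProduct_sub_zeroOut_mulVec hik, ← hR₀, ← hy, ← hy₀] at h
  simp only [single_one_dotProduct, single_one_vecMul, row_apply] at h
  have hcc : W i k * W k i = ((‖W i k‖ ^ 2 : ℝ) : ℂ) := by
    rw [← hW.apply k i, Complex.star_def, Complex.mul_conj, Complex.normSq_eq_norm_sq]
  have heq : W i k * y k - W i k * y₀ k
        - scale N * (W i k ^ 2 * (R₀ k i * y₀ k) + ((‖W i k‖ ^ 2 : ℝ) : ℂ) * (R₀ k k * y₀ i))
      = W i k * (y k - y₀ k - scale N * (R₀ k i * W i k * y₀ k + R₀ k k * W k i * y₀ i)) := by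
    rw [← hcc]; ring
  rw [heq, norm_mul]
  have h1 : ‖R₀ k i‖ ≤ 1 / |z.im| := by rw [hR₀]; exact norm_resolventMatrix_apply_le hH₀ hz k i
  have h2 : ‖R₀ k k‖ ≤ 1 / |z.im| := by rw [hR₀]; exact norm_resolventMatrix_apply_le hH₀ hz k k
  calc _ ≤ ‖W i k‖ * ((scale N * ‖W i k‖) ^ 2 / |z.im| *
        ((1 / |z.im| + 1 / |z.im|) * (‖y₀ i‖ + ‖y₀ k‖))) := by
        refine mul_le_mul_of_nonneg_left (h.trans ?_) (norm_nonneg _)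
        gcongr
    _ = _ := by field_simp; ring

/-- Used in the terms already carrying `t²`, where restoring the deleted entry in both factors costs
only one more `t`. -/
theorem norm_resolvent_mul_mulVec_sub_le (hW : W.IsHermitian) (hz : z.im ≠ 0) (i k a b c : Fin N)
    (hc : c = i ∨ c = k) (v : Fin N → ℂ) {R₀ : Matrix (Fin N) (Fin N) ℂ} {y y₀ : Fin N → ℂ}
    (hR₀ : R₀ = resolventMatrix (zeroOut W i k) z) (hy : y = resolventMatrix W z *ᵥ v)
    (hy₀ : y₀ = R₀ *ᵥ v) :
    ‖R₀ a b * y₀ c - resolventMatrix W z a b * y c‖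
      ≤ 3 * scale N / |z.im| ^ 2 * (‖W i k‖ ^ 1 * (‖y₀ i‖ + ‖y₀ k‖)) := by
  have ht := scale_nonneg N
  have hη := abs_pos.2 hz
  have h1 := norm_resolventMatrix_sub_zeroOut_le hW hz i k a b
  have h2 := norm_mulVec_sub_zeroOut_le hW hz i k c v
  have h3 := norm_resolventMatrix_apply_le hW hz a b
  rw [← hR₀] at h1
  rw [← hR₀, ← hy, ← hy₀] at h2
  have hcle : ‖y₀ c‖ ≤ ‖y₀ i‖ + ‖y₀ k‖ := by
    rcases hc with rfl | rfl
    · linarith [norm_nonneg (y₀ k)]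
    · linarith [norm_nonneg (y₀ i)]
  have heq : R₀ a b * y₀ c - resolventMatrix W z a b * y c
      = -((resolventMatrix W z a b - R₀ a b) * y₀ c + resolventMatrix W z a b * (y c - y₀ c)) := by
    ring
  rw [heq, norm_neg]
  calc _ ≤ _ := norm_add_le _ _
    _ ≤ 2 * scale N * ‖W i k‖ / |z.im| ^ 2 * (‖y₀ i‖ + ‖y₀ k‖)
        + 1 / |z.im| * (scale N * ‖W i k‖ / |z.im| * (‖y₀ i‖ + ‖y₀ k‖)) := by
        rw [norm_mul, norm_mul]
        gcongr
    _ = _ := by field_simp; ring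

end Pointwise

variable {Ω : Type*} [MeasurableSpace Ω] {μ : Measure Ω} {N : ℕ}
  {σ τ L : ℝ} {W : Ω → Matrix (Fin N) (Fin N) ℂ} {z : ℂ} {u v : Fin N → ℂ}

theorem IsWignerModel.integrable_entry (hW : IsWignerModel μ σ τ L W) (i j : Fin N) :
    Integrable (fun ω => W ω i j) μ := by
  have h := hW.integrable_pow i j 1 (by norm_num) (Or.inl (by norm_num))
  simp only [pow_one] at h
  exact (integrable_norm_iff (hW.measurable_entry i j).aestronglyMeasurable).1 h

theorem IsWignerModel.integrable_entry_mul (hW : IsWignerModel μ σ τ L W) (i j : Fin N)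
    {g : Ω → ℂ} (hg : Integrable g μ) {C : ℝ} (hC : ∀ ω, ‖g ω‖ ≤ C) :
    Integrable (fun ω => W ω i j * g ω) μ :=
  (hW.integrable_entry i j).mul_bdd hg.aestronglyMeasurable (Filter.Eventually.of_forall hC)

theorem IsWignerModel.integrable_entry_sq_mul (hW : IsWignerModel μ σ τ L W) (i j : Fin N)
    {g : Ω → ℂ} (hg : Integrable g μ) {C : ℝ} (hC : ∀ ω, ‖g ω‖ ≤ C) :
    Integrable (fun ω => W ω i j ^ 2 * g ω) μ := by
  refine Integrable.mul_bdd ?_ hg.aestronglyMeasurable (Filter.Eventually.of_forall hC)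
  rw [← integrable_norm_iff ((hW.measurable_entry i j).pow_const 2).aestronglyMeasurable]
  simpa using hW.integrable_pow i j 2 (by norm_num) (Or.inl le_rfl)

theorem IsWignerModel.integrable_norm_sq_mul (hW : IsWignerModel μ σ τ L W) (i j : Fin N)
    {g : Ω → ℂ} (hg : Integrable g μ) {C : ℝ} (hC : ∀ ω, ‖g ω‖ ≤ C) :
    Integrable (fun ω => ((‖W ω i j‖ ^ 2 : ℝ) : ℂ) * g ω) μ :=
  (hW.integrable_pow i j 2 (by norm_num) (Or.inl le_rfl)).ofReal.mul_bdd hg.aestronglyMeasurable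
    (Filter.Eventually.of_forall hC)

theorem norm_integral_le_of_norm_le_const_mul {f : Ω → ℂ} {g : Ω → ℝ} {c : ℝ} (hg : Integrable g μ)
    (h : ∀ ω, ‖f ω‖ ≤ c * g ω) : ‖∫ ω, f ω ∂μ‖ ≤ c * ∫ ω, g ω ∂μ := by
  rw [← integral_const_mul]
  exact norm_integral_le_of_norm_le (hg.const_mul c) (Filter.Eventually.of_forall h)

theorem integral_sub_sub_const_mul_add {f₁ f₂ f₃ f₄ : Ω → ℂ} (h₁ : Integrable f₁ μ)
    (h₂ : Integrable f₂ μ) (h₃ : Integrable f₃ μ) (h₄ : Integrable f₄ μ) (c : ℂ) :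
    ∫ ω, (f₁ ω - f₂ ω - c * (f₃ ω + f₄ ω)) ∂μ
      = ∫ ω, f₁ ω ∂μ - ∫ ω, f₂ ω ∂μ - c * (∫ ω, f₃ ω ∂μ + ∫ ω, f₄ ω ∂μ) := by
  have h12 : Integrable (fun ω => f₁ ω - f₂ ω) μ := h₁.sub h₂
  have h34 : Integrable (fun ω => f₃ ω + f₄ ω) μ := h₃.add h₄
  rw [integral_sub h12 (h34.const_mul c), integral_sub h₁ h₂, integral_const_mul,
    integral_add h₃ h₄]

variable [IsProbabilityMeasure μ]

theorem norm_mulVec_apply_le {W : Matrix (Fin N) (Fin N) ℂ} (hW : W.IsHermitian) (hz : z.im ≠ 0)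
    (hv : ∑ i, ‖v i‖ ^ 2 ≤ 1) (i : Fin N) : ‖(resolventMatrix W z *ᵥ v) i‖ ≤ 1 / |z.im| :=
  norm_le_of_sum_norm_sq_le (abs_pos.2 hz) (sum_norm_sq_resolventMatrix_mulVec_le hW hz hv) i

theorem integrable_mulVec (hm : ∀ i j, Measurable fun ω => W ω i j)
    (hH : ∀ ω, (W ω).IsHermitian) (hz : z.im ≠ 0) (hv : ∑ i, ‖v i‖ ^ 2 ≤ 1) (i : Fin N) :
    Integrable (fun ω => (resolventMatrix (W ω) z *ᵥ v) i) μ :=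
  integrable_of_bound (measurable_resolventMatrix_mulVec hm z v i) fun ω =>
    norm_mulVec_apply_le (hH ω) hz hv i

theorem norm_resolvent_mul_mulVec_le {W : Matrix (Fin N) (Fin N) ℂ} (hW : W.IsHermitian)
    (hz : z.im ≠ 0) (hv : ∑ i, ‖v i‖ ^ 2 ≤ 1) (a b c : Fin N) :
    ‖resolventMatrix W z a b * (resolventMatrix W z *ᵥ v) c‖ ≤ 1 / |z.im| * (1 / |z.im|) := by
  rw [norm_mul]
  exact mul_le_mul (norm_resolventMatrix_apply_le hW hz a b) (norm_mulVec_apply_le hW hz hv c)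
    (norm_nonneg _) (by positivity)

theorem integrable_resolvent_mul_mulVec (hm : ∀ i j, Measurable fun ω => W ω i j)
    (hH : ∀ ω, (W ω).IsHermitian) (hz : z.im ≠ 0) (hv : ∑ i, ‖v i‖ ^ 2 ≤ 1) (a b c : Fin N) :
    Integrable (fun ω => resolventMatrix (W ω) z a b * (resolventMatrix (W ω) z *ᵥ v) c) μ :=
  integrable_of_bound
    ((measurable_resolventMatrix hm z a b).mul (measurable_resolventMatrix_mulVec hm z v c))
    fun ω => norm_resolvent_mul_mulVec_le (hH ω) hz hv a b c

/-- The expected size of the coordinates `i`, `k` of `R(z) v`, weighted with a moment of the entry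
`(i, k)`, is not changed much when this entry is replaced by zero. -/
theorem IsWignerModel.integral_pow_mul_norm_le (hW : IsWignerModel μ σ τ L W) (hz : z.im ≠ 0)
    (hv : ∑ i, ‖v i‖ ^ 2 ≤ 1) (i k : Fin N) (hε : scale N * (2 * L) / |z.im| ≤ 1) {n : ℕ}
    (hn : n ≤ 4) (hn' : n ≤ 2 ∨ i ≠ k) :
    Integrable (fun ω => ‖W ω i k‖ ^ n * (‖(resolventMatrix (zeroOut (W ω) i k) z *ᵥ v) i‖
        + ‖(resolventMatrix (zeroOut (W ω) i k) z *ᵥ v) k‖)) μ ∧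
    ∫ ω, ‖W ω i k‖ ^ n * (‖(resolventMatrix (zeroOut (W ω) i k) z *ᵥ v) i‖
        + ‖(resolventMatrix (zeroOut (W ω) i k) z *ᵥ v) k‖) ∂μ
      ≤ 6 * L * ∫ ω, (‖(resolventMatrix (W ω) z *ᵥ v) i‖
        + ‖(resolventMatrix (W ω) z *ᵥ v) k‖) ∂μ := by
  have hη := abs_pos.2 hz
  have ht := scale_nonneg N
  have hL := hW.one_le
  have hm := hW.measurable_entry
  have hH := hW.isHermitian
  have hm0 := measurable_zeroOut hm i k
  have hH0 : ∀ ω, (zeroOut (W ω) i k).IsHermitian := fun ω => zeroOut_isHermitian (hH ω) i k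
  set S : Matrix (Fin N) (Fin N) ℂ → ℝ := fun M =>
    ‖(resolventMatrix M z *ᵥ v) i‖ + ‖(resolventMatrix M z *ᵥ v) k‖ with hS
  have hSm : Measurable fun x : Fin N → Fin N → ℂ => S (of x) :=
    (measurable_resolventMatrix_mulVec measurable_of_apply z v i).norm.add
      (measurable_resolventMatrix_mulVec measurable_of_apply z v k).norm
  have hS0 : ∀ M, 0 ≤ S M := fun M => add_nonneg (norm_nonneg _) (norm_nonneg _)
  have hSi : Integrable (fun ω => S (W ω)) μ :=
    (integrable_mulVec hm hH hz hv i).norm.add (integrable_mulVec hm hH hz hv k).norm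
  have hSi0 : Integrable (fun ω => S (zeroOut (W ω) i k)) μ :=
    (integrable_mulVec hm0 hH0 hz hv i).norm.add (integrable_mulVec hm0 hH0 hz hv k).norm
  refine ⟨hW.integrable_pow_mul_zeroOut i k hn hn' hSi0 (C := 1 / |z.im| + 1 / |z.im|)
    fun ω => ?_, ?_⟩
  · rw [Real.norm_of_nonneg (hS0 _)]
    exact add_le_add (norm_mulVec_apply_le (hH0 ω) hz hv i) (norm_mulVec_apply_le (hH0 ω) hz hv k)
  · have hE : ∫ ω, S (zeroOut (W ω) i k) ∂μ ≤ 2 * ∫ ω, 3 * S (W ω) ∂μ := by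
      refine hW.integral_zeroOut_le i k hSm hS0
        (fun ω => by have := hS0 (W ω); positivity) (hSi.const_mul _) fun ω hω => ?_
      have hn : ‖W ω k i‖ = ‖W ω i k‖ := by rw [← (hH ω).apply i k, norm_star]
      have hε' : scale N * ‖W ω i k‖ / |z.im| ≤ 1 := le_trans (by gcongr) hε
      have h1 := norm_zeroOut_mulVec_le (hH ω) hz i k v hε' le_rfl
      have h2 := norm_zeroOut_mulVec_le (hH ω) hz k i v (by rwa [hn]) le_rfl
      rw [zeroOut_comm] at h2
      simp only [hS]
      linarith
    rw [hW.integral_mul_zeroOut i k (φ := fun w => ‖w‖ ^ n) (measurable_norm.pow_const n) hSm]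
    have h1 := mul_le_mul (hW.moment_le i k n hn hn') hE (integral_nonneg fun ω => hS0 _)
      (by linarith)
    refine h1.trans (le_of_eq ?_)
    rw [integral_const_mul]
    ring

/-- The error in the expansion of the `(i, k)` term of `E ⟨u, X R v⟩`. -/
noncomputable def expansionError (μ : Measure Ω) (σ τ : ℝ) (W : Ω → Matrix (Fin N) (Fin N) ℂ)
    (z : ℂ) (v : Fin N → ℂ) (i k : Fin N) : ℂ :=
  scale N * ∫ ω, W ω i k * (resolventMatrix (W ω) z *ᵥ v) k ∂μ
    - scale N ^ 2 * (σ ^ 2 * ∫ ω, resolventMatrix (W ω) z k k * (resolventMatrix (W ω) z *ᵥ v) i ∂μ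
      + τ * ∫ ω, resolventMatrix (W ω) z k i * (resolventMatrix (W ω) z *ᵥ v) k ∂μ)

/-- Each factor involving the deleted matrix is independent of the entry: centering removes the
zeroth order, and the second moments `σ²` and `τ` appear at first order. The third moment remainder
gives `12 L t³`, and restoring the entry in the two main terms gives `36 σ² L t³`. -/
theorem IsWignerModel.norm_expansionError_le_of_ne (hW : IsWignerModel μ σ τ L W) (hz : z.im ≠ 0)
    (hv : ∑ i, ‖v i‖ ^ 2 ≤ 1) {i k : Fin N} (hik : i ≠ k)
    (hε : scale N * (2 * L) / |z.im| ≤ 1) :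
    ‖expansionError μ σ τ W z v i k‖
      ≤ L * (36 * σ ^ 2 + 12) * scale N ^ 3 / |z.im| ^ 2
        * ∫ ω, (‖(resolventMatrix (W ω) z *ᵥ v) i‖ + ‖(resolventMatrix (W ω) z *ᵥ v) k‖) ∂μ := by
  have hη := abs_pos.2 hz
  have ht := scale_nonneg N
  have hL := hW.one_le
  have hm := hW.measurable_entry
  have hH := hW.isHermitian
  have hm0 := measurable_zeroOut hm i k
  have hH0 : ∀ ω, (zeroOut (W ω) i k).IsHermitian := fun ω => zeroOut_isHermitian (hH ω) i k
  set t := scale N with ht'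
  set R : Ω → Matrix (Fin N) (Fin N) ℂ := fun ω => resolventMatrix (W ω) z with hR
  set R₀ : Ω → Matrix (Fin N) (Fin N) ℂ := fun ω => resolventMatrix (zeroOut (W ω) i k) z with hR₀
  set I := ∫ ω, (‖(R ω *ᵥ v) i‖ + ‖(R ω *ᵥ v) k‖) ∂μ with hI
  have hI0 : 0 ≤ I := integral_nonneg fun ω => add_nonneg (norm_nonneg _) (norm_nonneg _)
  have iy := integrable_mulVec (μ := μ) hm hH hz hv k
  have iy0 := integrable_mulVec (μ := μ) hm0 hH0 hz hv k
  have iRy : ∀ a b c, Integrable (fun ω => R ω a b * (R ω *ᵥ v) c) μ :=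
    fun a b c => integrable_resolvent_mul_mulVec hm hH hz hv a b c
  have iRy0 : ∀ a b c, Integrable (fun ω => R₀ ω a b * (R₀ ω *ᵥ v) c) μ :=
    fun a b c => integrable_resolvent_mul_mulVec hm0 hH0 hz hv a b c
  have j1 : Integrable (fun ω => W ω i k * (R ω *ᵥ v) k) μ :=
    hW.integrable_entry_mul i k iy fun ω => norm_mulVec_apply_le (hH ω) hz hv k
  have j2 : Integrable (fun ω => W ω i k * (R₀ ω *ᵥ v) k) μ :=
    hW.integrable_entry_mul i k iy0 fun ω => norm_mulVec_apply_le (hH0 ω) hz hv k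
  have j3 := hW.integrable_entry_sq_mul i k (iRy0 k i k)
    fun ω => norm_resolvent_mul_mulVec_le (hH0 ω) hz hv k i k
  have j4 := hW.integrable_norm_sq_mul i k (iRy0 k k i)
    fun ω => norm_resolvent_mul_mulVec_le (hH0 ω) hz hv k k i
  have mRy0 : ∀ a b c : Fin N, Measurable fun x : Fin N → Fin N → ℂ =>
      resolventMatrix (of x) z a b * (resolventMatrix (of x) z *ᵥ v) c := fun a b c =>
    (measurable_resolventMatrix measurable_of_apply z a b).mul
      (measurable_resolventMatrix_mulVec measurable_of_apply z v c)
  have e2 : ∫ ω, W ω i k * (R₀ ω *ᵥ v) k ∂μ = 0 := by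
    have := hW.integral_mul_zeroOut i k (φ := fun w => w) measurable_id
      (g := fun M => (resolventMatrix M z *ᵥ v) k)
      (measurable_resolventMatrix_mulVec measurable_of_apply z v k)
    rw [this, hW.mean, zero_mul]
  have e3 : ∫ ω, W ω i k ^ 2 * (R₀ ω k i * (R₀ ω *ᵥ v) k) ∂μ
      = τ * ∫ ω, R₀ ω k i * (R₀ ω *ᵥ v) k ∂μ := by
    have := hW.integral_mul_zeroOut i k (φ := fun w => w ^ 2) (measurable_id.pow_const 2)
      (g := fun M => resolventMatrix M z k i * (resolventMatrix M z *ᵥ v) k) (mRy0 k i k)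
    rw [this, hW.integral_sq i k hik]
  have e4 : ∫ ω, ((‖W ω i k‖ ^ 2 : ℝ) : ℂ) * (R₀ ω k k * (R₀ ω *ᵥ v) i) ∂μ
      = σ ^ 2 * ∫ ω, R₀ ω k k * (R₀ ω *ᵥ v) i ∂μ := by
    have := hW.integral_mul_zeroOut i k (φ := fun w => ((‖w‖ ^ 2 : ℝ) : ℂ))
      (Complex.measurable_ofReal.comp (measurable_norm.pow_const 2))
      (g := fun M => resolventMatrix M z k k * (resolventMatrix M z *ᵥ v) i) (mRy0 k k i)
    rw [this, integral_complex_ofReal, hW.integral_norm_sq i k hik]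
    push_cast
    rfl
  obtain ⟨s3, b3⟩ := hW.integral_pow_mul_norm_le hz hv i k hε (n := 3) (by norm_num) (Or.inr hik)
  obtain ⟨s1, b1⟩ := hW.integral_pow_mul_norm_le hz hv i k hε (n := 1) (by norm_num) (Or.inr hik)
  have n1 : ‖∫ ω, (W ω i k * (R ω *ᵥ v) k - W ω i k * (R₀ ω *ᵥ v) k
        - t * (W ω i k ^ 2 * (R₀ ω k i * (R₀ ω *ᵥ v) k)
          + ((‖W ω i k‖ ^ 2 : ℝ) : ℂ) * (R₀ ω k k * (R₀ ω *ᵥ v) i))) ∂μ‖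
      ≤ 2 * t ^ 2 / |z.im| ^ 2 * (6 * L * I) :=
    (norm_integral_le_of_norm_le_const_mul s3 fun ω =>
      norm_entry_mul_mulVec_sub_le (hH ω) hz hik v rfl rfl rfl).trans
      (mul_le_mul_of_nonneg_left b3 (by positivity))
  have n2 : ‖∫ ω, (R₀ ω k i * (R₀ ω *ᵥ v) k - R ω k i * (R ω *ᵥ v) k) ∂μ‖
      ≤ 3 * t / |z.im| ^ 2 * (6 * L * I) :=
    (norm_integral_le_of_norm_le_const_mul s1 fun ω =>
      norm_resolvent_mul_mulVec_sub_le (hH ω) hz i k k i k (Or.inr rfl) v rfl rfl rfl).trans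
      (mul_le_mul_of_nonneg_left b1 (by positivity))
  have n3 : ‖∫ ω, (R₀ ω k k * (R₀ ω *ᵥ v) i - R ω k k * (R ω *ᵥ v) i) ∂μ‖
      ≤ 3 * t / |z.im| ^ 2 * (6 * L * I) :=
    (norm_integral_le_of_norm_le_const_mul s1 fun ω =>
      norm_resolvent_mul_mulVec_sub_le (hH ω) hz i k k k i (Or.inl rfl) v rfl rfl rfl).trans
      (mul_le_mul_of_nonneg_left b1 (by positivity))
  rw [integral_sub_sub_const_mul_add j1 j2 j3 j4, e2, e3, e4] at n1
  rw [integral_sub (iRy0 k i k) (iRy k i k)] at n2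
  rw [integral_sub (iRy0 k k i) (iRy k k i)] at n3
  -- The first bracket is the expansion remainder bounded by `n1`; the second is the cost of
  -- restoring the entry, bounded by `n2` and `n3`.
  have hdec : expansionError μ σ τ W z v i k
      = t * (∫ ω, W ω i k * (R ω *ᵥ v) k ∂μ - 0
          - t * (τ * ∫ ω, R₀ ω k i * (R₀ ω *ᵥ v) k ∂μ
            + σ ^ 2 * ∫ ω, R₀ ω k k * (R₀ ω *ᵥ v) i ∂μ))
        + t ^ 2 * (τ * (∫ ω, R₀ ω k i * (R₀ ω *ᵥ v) k ∂μ - ∫ ω, R ω k i * (R ω *ᵥ v) k ∂μ)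
          + σ ^ 2 * (∫ ω, R₀ ω k k * (R₀ ω *ᵥ v) i ∂μ - ∫ ω, R ω k k * (R ω *ᵥ v) i ∂μ)) := by
    unfold expansionError
    ring
  rw [hdec]
  have hnt : ‖(t : ℂ)‖ = t := by rw [Complex.norm_real, Real.norm_of_nonneg ht]
  have hnτ : ‖(τ : ℂ)‖ ≤ σ ^ 2 := by rw [Complex.norm_real]; exact hW.abs_le
  have hnσ : ‖(σ : ℂ)‖ ^ 2 = σ ^ 2 := by rw [Complex.norm_real, Real.norm_eq_abs, sq_abs]
  refine (norm_add_le _ _).trans ?_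
  rw [norm_mul, norm_mul, norm_pow, hnt]
  have n4 : ‖(τ : ℂ) * (∫ ω, R₀ ω k i * (R₀ ω *ᵥ v) k ∂μ - ∫ ω, R ω k i * (R ω *ᵥ v) k ∂μ)
      + (σ : ℂ) ^ 2 * (∫ ω, R₀ ω k k * (R₀ ω *ᵥ v) i ∂μ - ∫ ω, R ω k k * (R ω *ᵥ v) i ∂μ)‖
      ≤ σ ^ 2 * (3 * t / |z.im| ^ 2 * (6 * L * I)) + σ ^ 2 * (3 * t / |z.im| ^ 2 * (6 * L * I)) := by
    refine (norm_add_le _ _).trans (add_le_add ?_ ?_)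
    · rw [norm_mul]; exact mul_le_mul hnτ n2 (norm_nonneg _) (sq_nonneg σ)
    · rw [norm_mul, norm_pow, hnσ]; exact mul_le_mul_of_nonneg_left n3 (sq_nonneg σ)
  refine (add_le_add (mul_le_mul_of_nonneg_left n1 ht)
    (mul_le_mul_of_nonneg_left n4 (sq_nonneg t))).trans (le_of_eq ?_)
  ring

/-- There is no need to match the first order terms: the centered entry gains one power of `t`, the
subtracted terms are bounded trivially, and order `t²` is enough for a single sum. -/
theorem IsWignerModel.norm_expansionError_self_le (hW : IsWignerModel μ σ τ L W) (hz : z.im ≠ 0)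
    (hv : ∑ i, ‖v i‖ ^ 2 ≤ 1) (i : Fin N) (hε : scale N * (2 * L) / |z.im| ≤ 1) :
    ‖expansionError μ σ τ W z v i i‖
      ≤ (12 * L + 2 * σ ^ 2) * scale N ^ 2 / |z.im|
        * ∫ ω, ‖(resolventMatrix (W ω) z *ᵥ v) i‖ ∂μ := by
  have hη := abs_pos.2 hz
  have ht := scale_nonneg N
  have hL := hW.one_le
  have hm := hW.measurable_entry
  have hH := hW.isHermitian
  have hm0 := measurable_zeroOut hm i i
  have hH0 : ∀ ω, (zeroOut (W ω) i i).IsHermitian := fun ω => zeroOut_isHermitian (hH ω) i i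
  set t := scale N with ht'
  have iy := integrable_mulVec (μ := μ) hm hH hz hv i
  have iy0 := integrable_mulVec (μ := μ) hm0 hH0 hz hv i
  set I := ∫ ω, ‖(resolventMatrix (W ω) z *ᵥ v) i‖ ∂μ with hI
  have j1 := hW.integrable_entry_mul i i iy fun ω => norm_mulVec_apply_le (hH ω) hz hv i
  have j2 := hW.integrable_entry_mul i i iy0 fun ω => norm_mulVec_apply_le (hH0 ω) hz hv i
  have e2 : ∫ ω, W ω i i * (resolventMatrix (zeroOut (W ω) i i) z *ᵥ v) i ∂μ = 0 := by
    have := hW.integral_mul_zeroOut i i (φ := fun w => w) measurable_id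
      (g := fun M => (resolventMatrix M z *ᵥ v) i)
      (measurable_resolventMatrix_mulVec measurable_of_apply z v i)
    rw [this, hW.mean, zero_mul]
  obtain ⟨s2, b2⟩ := hW.integral_pow_mul_norm_le hz hv i i hε (n := 2) (by norm_num)
    (Or.inl le_rfl)
  have b2' : ∫ ω, (‖(resolventMatrix (W ω) z *ᵥ v) i‖ + ‖(resolventMatrix (W ω) z *ᵥ v) i‖) ∂μ
      = 2 * I := by
    rw [integral_add iy.norm iy.norm]; ring
  rw [b2'] at b2
  have n1 : ‖∫ ω, (W ω i i * (resolventMatrix (W ω) z *ᵥ v) i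
        - W ω i i * (resolventMatrix (zeroOut (W ω) i i) z *ᵥ v) i) ∂μ‖
      ≤ t / |z.im| * (6 * L * (2 * I)) := by
    refine (norm_integral_le_of_norm_le_const_mul s2 fun ω => ?_).trans
      (mul_le_mul_of_nonneg_left b2 (by positivity))
    rw [← mul_sub, norm_mul]
    refine (mul_le_mul_of_nonneg_left (norm_mulVec_sub_zeroOut_le (hH ω) hz i i i v)
      (norm_nonneg _)).trans (le_of_eq ?_)
    ring
  rw [integral_sub j1 j2, e2, sub_zero] at n1
  have n2 : ‖∫ ω, resolventMatrix (W ω) z i i * (resolventMatrix (W ω) z *ᵥ v) i ∂μ‖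
      ≤ 1 / |z.im| * I := by
    refine norm_integral_le_of_norm_le_const_mul iy.norm fun ω => ?_
    rw [norm_mul]
    exact mul_le_mul_of_nonneg_right (norm_resolventMatrix_apply_le (hH ω) hz i i) (norm_nonneg _)
  have hnt : ‖(t : ℂ)‖ = t := by rw [Complex.norm_real, Real.norm_of_nonneg ht]
  have hnτ : ‖(τ : ℂ)‖ ≤ σ ^ 2 := by rw [Complex.norm_real]; exact hW.abs_le
  have hnσ : ‖(σ : ℂ)‖ ^ 2 = σ ^ 2 := by rw [Complex.norm_real, Real.norm_eq_abs, sq_abs]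
  have hnn : ‖(σ : ℂ) ^ 2 + τ‖ ≤ 2 * σ ^ 2 := by
    refine (norm_add_le _ _).trans ?_
    rw [norm_pow, hnσ]; linarith
  unfold expansionError
  rw [← add_mul]
  refine (norm_sub_le _ _).trans ?_
  rw [norm_mul, norm_mul, norm_mul, norm_pow, hnt]
  have hI0 : 0 ≤ I := integral_nonneg fun ω => norm_nonneg _
  have h1 := mul_le_mul_of_nonneg_left n1 ht
  have h2 := mul_le_mul_of_nonneg_left (mul_le_mul hnn n2 (norm_nonneg _) (by positivity))
    (sq_nonneg t)
  refine (add_le_add h1 h2).trans (le_of_eq ?_)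
  ring

end Expansion

/-! ### The approximate self-consistent equation -/

section SelfConsistent

variable {Ω : Type*} [MeasurableSpace Ω] {μ : Measure Ω} [IsProbabilityMeasure μ] {N : ℕ}
  {σ τ L : ℝ} {W : Ω → Matrix (Fin N) (Fin N) ℂ} {z : ℂ} {u v : Fin N → ℂ}

theorem mul_form_eq {W : Matrix (Fin N) (Fin N) ℂ} (hW : W.IsHermitian) (hz : z.im ≠ 0)
    (u v : Fin N → ℂ) :
    z * (u ⬝ᵥ (resolventMatrix W z *ᵥ v)) = u ⬝ᵥ v
      + ∑ i, ∑ k, u i * (scale N * (W i k * (resolventMatrix W z *ᵥ v) k)) := by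
  rw [← smul_eq_mul, ← dotProduct_smul, ← smul_mulVec, smul_resolventMatrix hW hz, add_mulVec,
    one_mulVec, dotProduct_add, smul_mulVec, dotProduct_smul, ← mulVec_mulVec]
  congr 1
  simp only [dotProduct, mulVec, smul_eq_mul, Finset.mul_sum]
  refine Finset.sum_congr rfl fun i _ => Finset.sum_congr rfl fun k _ =>
    Finset.sum_congr rfl fun j _ => ?_
  ring

/-- The expectation of the resolvent equation, expanded entry by entry. -/
theorem IsWignerModel.integral_form_eq (hW : IsWignerModel μ σ τ L W) (hz : z.im ≠ 0)
    (u : Fin N → ℂ) (hv : ∑ i, ‖v i‖ ^ 2 ≤ 1) :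
    z * ∫ ω, u ⬝ᵥ (resolventMatrix (W ω) z *ᵥ v) ∂μ - u ⬝ᵥ v
        - σ ^ 2 * (scale N ^ 2 * ∑ k, ∫ ω, resolventMatrix (W ω) z k k
            * (u ⬝ᵥ (resolventMatrix (W ω) z *ᵥ v)) ∂μ)
      = τ * scale N ^ 2 * ∫ ω, (resolventMatrix (W ω) z *ᵥ v) ⬝ᵥ (resolventMatrix (W ω) z *ᵥ u) ∂μ
        + ∑ i, ∑ k, u i * expansionError μ σ τ W z v i k := by
  have hm := hW.measurable_entry
  have hH := hW.isHermitian
  have iRy := fun a b c => integrable_resolvent_mul_mulVec (μ := μ) hm hH hz hv a b c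
  have j1 := fun i k => hW.integrable_entry_mul i k (integrable_mulVec (μ := μ) hm hH hz hv k)
    fun ω => norm_mulVec_apply_le (hH ω) hz hv k
  have h1 : z * ∫ ω, u ⬝ᵥ (resolventMatrix (W ω) z *ᵥ v) ∂μ = u ⬝ᵥ v
      + ∑ i, ∑ k, u i * (scale N * ∫ ω, W ω i k * (resolventMatrix (W ω) z *ᵥ v) k ∂μ) := by
    have ji : ∀ i k, Integrable
        (fun ω => u i * (scale N * (W ω i k * (resolventMatrix (W ω) z *ᵥ v) k))) μ :=
      fun i k => ((j1 i k).const_mul _).const_mul _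
    rw [← integral_const_mul]
    simp_rw [mul_form_eq (hH _) hz]
    rw [integral_add (integrable_const _)
      (integrable_finsetSum _ fun i _ => integrable_finsetSum _ fun k _ => ji i k),
      integral_finsetSum _ fun i _ => integrable_finsetSum _ fun k _ => ji i k]
    simp_rw [integral_finsetSum _ fun k _ => ji _ k, integral_const_mul]
    simp
  have h2 : ∑ k, ∫ ω, resolventMatrix (W ω) z k k * (u ⬝ᵥ (resolventMatrix (W ω) z *ᵥ v)) ∂μ
      = ∑ i, ∑ k, u i * ∫ ω, resolventMatrix (W ω) z k k * (resolventMatrix (W ω) z *ᵥ v) i ∂μ := by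
    rw [Finset.sum_comm]
    refine Finset.sum_congr rfl fun k _ => ?_
    simp_rw [← integral_const_mul]
    rw [← integral_finsetSum _ fun i _ => (iRy k k i).const_mul _]
    congr 1
    ext ω
    rw [dotProduct, Finset.mul_sum]
    exact Finset.sum_congr rfl fun i _ => by ring
  -- The `τ` terms assemble into the bilinear pairing of `Rv` and `Ru`, at most `1/η²` in modulus,
  -- so after multiplication by `t²` they are only an error.
  have h3 : ∫ ω, (resolventMatrix (W ω) z *ᵥ v) ⬝ᵥ (resolventMatrix (W ω) z *ᵥ u) ∂μ
      = ∑ i, ∑ k, u i * ∫ ω, resolventMatrix (W ω) z k i * (resolventMatrix (W ω) z *ᵥ v) k ∂μ := by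
    simp_rw [← integral_const_mul]
    simp_rw [← integral_finsetSum _ fun k _ => (iRy k _ k).const_mul _]
    rw [← integral_finsetSum _ fun i _ => integrable_finsetSum _ fun k _ => (iRy k i k).const_mul _]
    congr 1
    ext ω
    rw [Finset.sum_comm, dotProduct]
    refine Finset.sum_congr rfl fun k _ => ?_
    rw [show (resolventMatrix (W ω) z *ᵥ u) k = ∑ i, resolventMatrix (W ω) z k i * u i from rfl,
      Finset.mul_sum]
    exact Finset.sum_congr rfl fun i _ => by ring
  rw [h1, h2, h3]
  simp only [expansionError, Finset.mul_sum]
  rw [add_sub_cancel_left, sub_eq_iff_eq_add, ← Finset.sum_add_distrib, ← Finset.sum_add_distrib]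
  refine Finset.sum_congr rfl fun i _ => ?_
  rw [← Finset.sum_add_distrib, ← Finset.sum_add_distrib]
  exact Finset.sum_congr rfl fun k _ => by ring

/-- Two applications of Cauchy–Schwarz against the constant vector give `∑‖p i‖ ∑‖q k‖ ≤ √N · b√N`.
The double sum thus costs `N` rather than `N²`, which `t³` absorbs, leaving `t`. -/
theorem sum_sum_norm_le {p q : Fin N → ℂ} {b : ℝ} (hb : 0 ≤ b) (hp : ∑ i, ‖p i‖ ^ 2 ≤ 1)
    (hq : ∑ i, ‖q i‖ ^ 2 ≤ b ^ 2) (α β : ℝ) (hα : 0 ≤ α) (hβ : 0 ≤ β) :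
    ∑ i, ∑ k, ‖p i‖ * (α * (‖q i‖ + ‖q k‖) + if i = k then β * ‖q i‖ else 0)
      ≤ 2 * α * N * b + β * b := by
  have h1 : ∑ i, ‖p i‖ * ‖q i‖ ≤ b := by
    have := norm_dotProduct_le zero_le_one hb (by simpa using hp) hq
    simpa using this
  have h2 : (∑ i, ‖p i‖) * ∑ k, ‖q k‖ ≤ N * b := by
    have h3 : ∑ i, ‖p i‖ ≤ 1 * Real.sqrt N := sum_norm_le zero_le_one (by simpa using hp)
    have h4 := sum_norm_le hb hq
    calc _ ≤ 1 * Real.sqrt N * (b * Real.sqrt N) :=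
          mul_le_mul h3 h4 (Finset.sum_nonneg fun _ _ => norm_nonneg _) (by positivity)
      _ = (Real.sqrt N * Real.sqrt N) * b := by ring
      _ = _ := by rw [Real.mul_self_sqrt (Nat.cast_nonneg N)]
  have h5 : ∑ i, ∑ k, ‖p i‖ * (α * (‖q i‖ + ‖q k‖) + if i = k then β * ‖q i‖ else 0)
      = α * (N * ∑ i, ‖p i‖ * ‖q i‖) + α * ((∑ i, ‖p i‖) * ∑ k, ‖q k‖)
        + β * ∑ i, ‖p i‖ * ‖q i‖ := by
    rw [Finset.sum_mul, Finset.mul_sum, Finset.mul_sum, Finset.mul_sum, Finset.mul_sum,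
      ← Finset.sum_add_distrib, ← Finset.sum_add_distrib]
    refine Finset.sum_congr rfl fun i _ => ?_
    simp only [mul_add, Finset.sum_add_distrib, Finset.sum_const, Finset.card_univ,
      Fintype.card_fin, nsmul_eq_mul, ← Finset.mul_sum, Finset.sum_ite_eq, Finset.mem_univ, if_true]
    ring
  rw [h5]
  have h6 := mul_le_mul_of_nonneg_left h1 (show 0 ≤ α * N by positivity)
  have h7 := mul_le_mul_of_nonneg_left h2 hα
  have h8 := mul_le_mul_of_nonneg_left h1 hβ
  linarith

theorem IsWignerModel.norm_sum_expansionError_le [NeZero N] (hW : IsWignerModel μ σ τ L W)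
    (hz : z.im ≠ 0) (hu : ∑ i, ‖u i‖ ^ 2 ≤ 1) (hv : ∑ i, ‖v i‖ ^ 2 ≤ 1)
    (hε : scale N * (2 * L) / |z.im| ≤ 1) :
    ‖∑ i, ∑ k, u i * expansionError μ σ τ W z v i k‖
      ≤ L * (36 * σ ^ 2 + 12) * scale N * (2 * (|z.im|⁻¹) ^ 3 + (|z.im|⁻¹) ^ 2) := by
  have hη := abs_pos.2 hz
  have ht := scale_nonneg N
  have ht1 := scale_le_one (N := N)
  have hNt := natCast_mul_scale_sq (N := N)
  have hL := hW.one_le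
  have hm := hW.measurable_entry
  have hH := hW.isHermitian
  have hx0 : 0 < |z.im|⁻¹ := inv_pos.2 hη
  set x := |z.im|⁻¹ with hx
  set t := scale N with ht'
  set c := L * (36 * σ ^ 2 + 12) with hc
  have hc0 : 0 ≤ c := by positivity
  set y : Ω → Fin N → ℂ := fun ω => resolventMatrix (W ω) z *ᵥ v with hy
  have iy : ∀ i, Integrable (fun ω => ‖y ω i‖) μ := fun i => (integrable_mulVec hm hH hz hv i).norm
  set α := c * t ^ 3 * x ^ 2 with hα
  set β := c * t ^ 2 * x with hβ
  have hα0 : 0 ≤ α := by positivity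
  have hβ0 : 0 ≤ β := by positivity
  have iH : ∀ i k, Integrable (fun ω => ‖u i‖ * (α * (‖y ω i‖ + ‖y ω k‖)
      + if i = k then β * ‖y ω i‖ else 0)) μ := by
    intro i k
    refine Integrable.const_mul (((iy i).add (iy k)).const_mul α |>.add ?_) _
    split_ifs
    · exact (iy i).const_mul β
    · exact integrable_const _
  have hterm : ∀ i k, ‖u i * expansionError μ σ τ W z v i k‖ ≤
      ∫ ω, ‖u i‖ * (α * (‖y ω i‖ + ‖y ω k‖) + if i = k then β * ‖y ω i‖ else 0) ∂μ := by
    intro i k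
    rw [norm_mul, integral_const_mul]
    refine mul_le_mul_of_nonneg_left ?_ (norm_nonneg _)
    by_cases hik : i = k
    · subst hik
      have h1 := hW.norm_expansionError_self_le hz hv i hε
      have h2 : ∫ ω, β * ‖y ω i‖ ∂μ
          ≤ ∫ ω, (α * (‖y ω i‖ + ‖y ω i‖) + if i = i then β * ‖y ω i‖ else 0) ∂μ := by
        simp only [if_true]
        refine integral_mono ((iy i).const_mul β)
          ((((iy i).add (iy i)).const_mul α).add ((iy i).const_mul β)) fun ω => ?_
        have : 0 ≤ α * (‖y ω i‖ + ‖y ω i‖) := by positivity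
        linarith
      refine h1.trans (le_trans ?_ h2)
      rw [integral_const_mul]
      refine mul_le_mul_of_nonneg_right ?_ (integral_nonneg fun ω => norm_nonneg _)
      rw [div_eq_mul_inv, ← hx, hβ]
      -- The off-diagonal constant also serves on the diagonal, because `L ≥ 1`.
      have : 12 * L + 2 * σ ^ 2 ≤ c := by rw [hc]; nlinarith [sq_nonneg σ]
      gcongr
    · have h1 := hW.norm_expansionError_le_of_ne hz hv hik hε
      simp only [if_neg hik, add_zero]
      rw [integral_const_mul]
      refine h1.trans (le_of_eq ?_)
      rw [hα, div_eq_mul_inv, ← inv_pow, ← hx]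
  calc _ ≤ ∑ i, ∑ k, ‖u i * expansionError μ σ τ W z v i k‖ :=
        (norm_sum_le _ _).trans (Finset.sum_le_sum fun i _ => norm_sum_le _ _)
    _ ≤ ∑ i, ∑ k, ∫ ω, ‖u i‖ * (α * (‖y ω i‖ + ‖y ω k‖)
          + if i = k then β * ‖y ω i‖ else 0) ∂μ :=
        Finset.sum_le_sum fun i _ => Finset.sum_le_sum fun k _ => hterm i k
    _ = ∫ ω, ∑ i, ∑ k, ‖u i‖ * (α * (‖y ω i‖ + ‖y ω k‖)
          + if i = k then β * ‖y ω i‖ else 0) ∂μ := by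
        rw [integral_finsetSum _ fun i _ => integrable_finsetSum _ fun k _ => iH i k]
        refine Finset.sum_congr rfl fun i _ => ?_
        rw [integral_finsetSum _ fun k _ => iH i k]
    _ ≤ ∫ _ω, (2 * α * N * x + β * x) ∂μ := by
        refine integral_mono (integrable_finsetSum _ fun i _ => integrable_finsetSum _ fun k _ =>
          iH i k) (integrable_const _) fun ω => ?_
        refine sum_sum_norm_le hx0.le hu ?_ α β hα0 hβ0
        have := sum_norm_sq_resolventMatrix_mulVec_le (hH ω) hz hv
        rwa [one_div, ← inv_pow] at this
    _ = c * t * (2 * x ^ 3 * (N * t ^ 2) + t * x ^ 2) := by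
        rw [integral_const, probReal_univ, one_smul, hα, hβ]; ring
    _ ≤ _ := by
        rw [hNt]
        have : t * x ^ 2 ≤ 1 * x ^ 2 := by gcongr
        refine mul_le_mul_of_nonneg_left ?_ (by positivity)
        linarith

/-- The covariance is at most the mean of the variances. -/
theorem norm_integral_mul_sub_le {f g : Ω → ℂ} (hf : MemLp f 2 μ) (hg : MemLp g 2 μ) {V : ℝ}
    (hfV : complexVariance μ f ≤ V) (hgV : complexVariance μ g ≤ V) :
    ‖∫ ω, f ω * g ω ∂μ - (∫ ω, f ω ∂μ) * ∫ ω, g ω ∂μ‖ ≤ V := by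
  set a := ∫ ω, f ω ∂μ with ha
  set b := ∫ ω, g ω ∂μ with hb
  have hfi : Integrable f μ := hf.integrable (by norm_num)
  have hgi : Integrable g μ := hg.integrable (by norm_num)
  have hfg : Integrable (fun ω => f ω * g ω) μ := hf.integrable_mul hg
  have h1 : ∫ ω, f ω * g ω ∂μ - a * b = ∫ ω, (f ω - a) * (g ω - b) ∂μ := by
    have hpt : ∀ ω, (f ω - a) * (g ω - b) = f ω * g ω - (a * g ω + f ω * b - a * b) := by
      intro ω; ring
    have i1 : Integrable (fun ω => a * g ω + f ω * b) μ := (hgi.const_mul a).add (hfi.mul_const b)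
    have i2 : Integrable (fun ω => a * g ω + f ω * b - a * b) μ := i1.sub (integrable_const _)
    simp_rw [hpt]
    rw [integral_sub hfg i2, integral_sub i1 (integrable_const _),
      integral_add (hgi.const_mul a) (hfi.mul_const b), integral_const_mul, integral_mul_const,
      ← ha, ← hb]
    simp
  have hf2 : Integrable (fun ω => ‖f ω - a‖ ^ 2) μ :=
    (hf.sub (memLp_const a)).integrable_norm_pow (by norm_num)
  have hg2 : Integrable (fun ω => ‖g ω - b‖ ^ 2) μ :=
    (hg.sub (memLp_const b)).integrable_norm_pow (by norm_num)
  have h2 : ‖∫ ω, (f ω - a) * (g ω - b) ∂μ‖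
      ≤ ∫ ω, (1 / 2) * (‖f ω - a‖ ^ 2 + ‖g ω - b‖ ^ 2) ∂μ := by
    refine norm_integral_le_of_norm_le ((hf2.add hg2).const_mul _)
      (Filter.Eventually.of_forall fun ω => ?_)
    rw [norm_mul]
    nlinarith [sq_nonneg (‖f ω - a‖ - ‖g ω - b‖)]
  rw [integral_const_mul, integral_add hf2 hg2] at h2
  unfold complexVariance at hfV hgV
  rw [h1]
  linarith

/-- The expectation of the normalized trace of the resolvent. -/
noncomputable def meanTrace (μ : Measure Ω) (W : Ω → Matrix (Fin N) (Fin N) ℂ) (z : ℂ) : ℂ :=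
  scale N ^ 2 * ∑ k, ∫ ω, resolventMatrix (W ω) z k k ∂μ

theorem form_single (W : Matrix (Fin N) (Fin N) ℂ) (z : ℂ) (k : Fin N) :
    (Pi.single k 1 : Fin N → ℂ) ⬝ᵥ (resolventMatrix W z *ᵥ Pi.single k 1)
      = resolventMatrix W z k k := by
  simp

theorem norm_scale_sq_mul_sum_le [NeZero N] {f : Fin N → ℂ} {V : ℝ} (h : ∀ k, ‖f k‖ ≤ V) :
    ‖(scale N : ℂ) ^ 2 * ∑ k, f k‖ ≤ V := by
  have h1 : ‖∑ k, f k‖ ≤ N * V := by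
    refine (norm_sum_le _ _).trans ((Finset.sum_le_sum fun k _ => h k).trans (le_of_eq ?_))
    simp
  rw [norm_mul, norm_pow, Complex.norm_real, Real.norm_of_nonneg (scale_nonneg N)]
  calc _ ≤ scale N ^ 2 * (N * V) := mul_le_mul_of_nonneg_left h1 (sq_nonneg _)
    _ = (N * scale N ^ 2) * V := by ring
    _ = V := by rw [natCast_mul_scale_sq, one_mul]

/-- The constant in the error term of the self-consistent equation. -/
noncomputable def errorConst (σ L : ℝ) : ℝ :=
  2 * (2 * (L * (36 * σ ^ 2 + 12)) + σ ^ 2) + 20000 * σ ^ 2 * L ^ 3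

/-- The approximate self-consistent equation for the expected resolvent forms. -/
theorem IsWignerModel.norm_selfConsistent_le [NeZero N] (hW : IsWignerModel μ σ τ L W)
    (hz : z.im ≠ 0) (hu : ∑ i, ‖u i‖ ^ 2 ≤ 1) (hv : ∑ i, ‖v i‖ ^ 2 ≤ 1)
    (hε : scale N * (2 * L) / |z.im| ≤ 1) :
    ‖(z - σ ^ 2 * meanTrace μ W z) * ∫ ω, u ⬝ᵥ (resolventMatrix (W ω) z *ᵥ v) ∂μ - u ⬝ᵥ v‖
      ≤ errorConst σ L * scale N * ((|z.im|⁻¹) ^ 2 + (|z.im|⁻¹) ^ 5) := by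
  have hη := abs_pos.2 hz
  have ht := scale_pos (N := N)
  have ht1 := scale_le_one (N := N)
  have hL := hW.one_le
  have hm := hW.measurable_entry
  have hH := hW.isHermitian
  have hx0 : 0 < |z.im|⁻¹ := inv_pos.2 hη
  have hexp := hW.integral_form_eq hz u hv
  have herr := hW.norm_sum_expansionError_le hz hu hv hε
  have hFV := hW.variance_form_le hz hu hv
  have hkV := fun k : Fin N => hW.variance_form_le hz (sum_norm_sq_single k).le
    (sum_norm_sq_single k).le
  have hkM := fun k : Fin N => hW.memLp_form hz (sum_norm_sq_single k).le
    (sum_norm_sq_single k).le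
  simp_rw [form_single] at hkV hkM
  set x := |z.im|⁻¹ with hx
  set t := scale N with ht'
  set V := 10000 * L ^ 3 * t ^ 2 * (x ^ 4 + x ^ 6) with hV
  set c := L * (36 * σ ^ 2 + 12) with hc
  have hc0 : 0 ≤ c := by positivity
  set F : Ω → ℂ := fun ω => u ⬝ᵥ (resolventMatrix (W ω) z *ᵥ v) with hF
  have hcov : ‖(t : ℂ) ^ 2 * ∑ k, (∫ ω, resolventMatrix (W ω) z k k * F ω ∂μ
      - (∫ ω, resolventMatrix (W ω) z k k ∂μ) * ∫ ω, F ω ∂μ)‖ ≤ V :=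
    norm_scale_sq_mul_sum_le fun k =>
      norm_integral_mul_sub_le (hkM k) (hW.memLp_form hz hu hv) (hkV k) hFV
  have hτ : ‖∫ ω, (resolventMatrix (W ω) z *ᵥ v) ⬝ᵥ (resolventMatrix (W ω) z *ᵥ u) ∂μ‖
      ≤ x * x := by
    have h1 : ∀ ω, ‖(resolventMatrix (W ω) z *ᵥ v) ⬝ᵥ (resolventMatrix (W ω) z *ᵥ u)‖ ≤ x * x := by
      intro ω
      have h2 := sum_norm_sq_resolventMatrix_mulVec_le (hH ω) hz hv
      have h3 := sum_norm_sq_resolventMatrix_mulVec_le (hH ω) hz hu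
      rw [one_div, ← inv_pow] at h2 h3
      refine le_trans (norm_sum_le _ _) (le_trans (le_of_eq ?_)
        (norm_dotProduct_le hx0.le hx0.le h2 h3))
      simp_rw [norm_mul]
    have := norm_integral_le_of_norm_le_const (μ := μ) (Filter.Eventually.of_forall h1)
    simpa using this
  -- An exact identity: the defect is the `τ` term, the expansion errors and `σ²` times the averaged
  -- covariance of `R_kk` with `F`.
  have hdec : (z - σ ^ 2 * meanTrace μ W z) * ∫ ω, F ω ∂μ - u ⬝ᵥ v
      = τ * t ^ 2 * ∫ ω, (resolventMatrix (W ω) z *ᵥ v) ⬝ᵥ (resolventMatrix (W ω) z *ᵥ u) ∂μ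
        + ∑ i, ∑ k, u i * expansionError μ σ τ W z v i k
        + σ ^ 2 * ((t : ℂ) ^ 2 * ∑ k, (∫ ω, resolventMatrix (W ω) z k k * F ω ∂μ
          - (∫ ω, resolventMatrix (W ω) z k k ∂μ) * ∫ ω, F ω ∂μ)) := by
    rw [← hexp, Finset.sum_sub_distrib, ← Finset.sum_mul, meanTrace]
    ring
  rw [hdec]
  have hnt : ‖(t : ℂ)‖ = t := by rw [Complex.norm_real, Real.norm_of_nonneg ht.le]
  have hnτ : ‖(τ : ℂ)‖ ≤ σ ^ 2 := by rw [Complex.norm_real]; exact hW.abs_le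
  have hnσ : ‖(σ : ℂ) ^ 2‖ = σ ^ 2 := by
    rw [norm_pow, Complex.norm_real, Real.norm_eq_abs, sq_abs]
  have b1 : ‖(τ : ℂ) * t ^ 2 *
      ∫ ω, (resolventMatrix (W ω) z *ᵥ v) ⬝ᵥ (resolventMatrix (W ω) z *ᵥ u) ∂μ‖
      ≤ σ ^ 2 * t ^ 2 * (x * x) := by
    rw [norm_mul, norm_mul, norm_pow, hnt]
    gcongr
  have b2 : ‖(σ : ℂ) ^ 2 * ((t : ℂ) ^ 2 * ∑ k, (∫ ω, resolventMatrix (W ω) z k k * F ω ∂μ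
          - (∫ ω, resolventMatrix (W ω) z k k ∂μ) * ∫ ω, F ω ∂μ))‖ ≤ σ ^ 2 * V := by
    rw [norm_mul, hnσ]
    gcongr
  refine (norm_add_le _ _).trans ((add_le_add ((norm_add_le _ _).trans (add_le_add b1 herr))
    b2).trans ?_)
  -- From here one factor `t x` can be dropped from every `t²` term. In particular the `t² x⁶` of
  -- the covariance becomes `t x⁵`, the highest power in the final error.
  have htx : t * x ≤ 1 := by
    have : t * (2 * L) / |z.im| = 2 * L * (t * x) := by rw [hx, div_eq_mul_inv]; ring
    rw [this] at hε
    have : 0 < t * x := mul_pos ht hx0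
    nlinarith
  have c1 : t ^ 2 * (x * x) ≤ t * x ^ 2 := by nlinarith [mul_pos ht (pow_pos hx0 2)]
  have c2 : t ^ 2 * x ^ 4 ≤ t * x ^ 3 := by
    have := mul_le_mul_of_nonneg_right htx (show 0 ≤ t * x ^ 3 by positivity)
    linarith
  have c3 : t ^ 2 * x ^ 6 ≤ t * x ^ 5 := by
    have := mul_le_mul_of_nonneg_right htx (show 0 ≤ t * x ^ 5 by positivity)
    linarith
  have c4 : x ^ 3 ≤ x ^ 2 + x ^ 5 := by
    rcases le_total x 1 with h | h
    · have := pow_le_pow_of_le_one hx0.le h (show 2 ≤ 3 by norm_num)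
      have := pow_pos hx0 5
      linarith
    · have := pow_le_pow_right₀ h (show 3 ≤ 5 by norm_num)
      have := pow_pos hx0 2
      linarith
  have c5 := mul_le_mul_of_nonneg_left c4 ht.le
  have d1 := mul_le_mul_of_nonneg_left c1 (sq_nonneg σ)
  have d2 := mul_le_mul_of_nonneg_left (add_le_add c2 c3)
    (show 0 ≤ 10000 * σ ^ 2 * L ^ 3 by positivity)
  have d3 := mul_le_mul_of_nonneg_left c5 (show 0 ≤ 2 * c by positivity)
  have d4 := mul_le_mul_of_nonneg_left c5 (show 0 ≤ 10000 * σ ^ 2 * L ^ 3 by positivity)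
  have p1 : 0 ≤ c * (t * x ^ 2) := by positivity
  have p2 : 0 ≤ c * (t * x ^ 5) := by positivity
  have p3 : 0 ≤ σ ^ 2 * (t * x ^ 2) := by positivity
  have p4 : 0 ≤ σ ^ 2 * (t * x ^ 5) := by positivity
  have p5 : 0 ≤ σ ^ 2 * L ^ 3 * (t * x ^ 2) := by positivity
  have p6 : 0 ≤ σ ^ 2 * L ^ 3 * (t * x ^ 5) := by positivity
  unfold errorConst
  rw [← hc, hV]
  linarith

/-- Average `norm_selfConsistent_le` over `u = v = e_k`: the mean trace then solves its own
approximate quadratic equation. -/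
theorem IsWignerModel.norm_meanTrace_eq_le [NeZero N] (hW : IsWignerModel μ σ τ L W)
    (hz : z.im ≠ 0) (hε : scale N * (2 * L) / |z.im| ≤ 1) :
    ‖(z - σ ^ 2 * meanTrace μ W z) * meanTrace μ W z - 1‖
      ≤ errorConst σ L * scale N * ((|z.im|⁻¹) ^ 2 + (|z.im|⁻¹) ^ 5) := by
  have h := fun k : Fin N => hW.norm_selfConsistent_le hz (sum_norm_sq_single k).le
    (sum_norm_sq_single k).le hε
  simp_rw [form_single] at h
  refine le_trans (le_of_eq ?_) (norm_scale_sq_mul_sum_le h)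
  congr 1
  have hN : (scale N : ℂ) ^ 2 * N = 1 := by
    have := natCast_mul_scale_sq (N := N)
    rw [mul_comm]
    exact_mod_cast this
  simp only [Finset.sum_sub_distrib, ← Finset.mul_sum, single_one_dotProduct, Pi.single_eq_same,
    Finset.sum_const, Finset.card_univ, Fintype.card_fin, nsmul_eq_mul, mul_one]
  rw [mul_sub, hN]
  simp only [meanTrace]
  ring

theorem IsWignerModel.im_mul_im_meanTrace_nonpos (hW : IsWignerModel μ σ τ L W)
    (hz : z.im ≠ 0) : z.im * (meanTrace μ W z).im ≤ 0 := by
  have hH := hW.isHermitian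
  have hi : ∀ k, Integrable (fun ω => resolventMatrix (W ω) z k k) μ := fun k =>
    integrable_of_bound (measurable_resolventMatrix hW.measurable_entry z k k) fun ω =>
      norm_resolventMatrix_apply_le (hH ω) hz k k
  have h1 : ∀ k, z.im * (∫ ω, resolventMatrix (W ω) z k k ∂μ).im ≤ 0 := by
    intro k
    have h2 : (∫ ω, resolventMatrix (W ω) z k k ∂μ).im
        = ∫ ω, (resolventMatrix (W ω) z k k).im ∂μ := by
      have := integral_im (𝕜 := ℂ) (hi k)
      simp only [RCLike.im_eq_complex_im] at this
      exact this.symm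
    rw [h2, ← integral_const_mul]
    exact integral_nonpos fun ω => im_mul_im_resolventMatrix_nonpos (hH ω) hz k
  unfold meanTrace
  rw [← Complex.ofReal_pow, Complex.im_ofReal_mul, Complex.im_sum, mul_left_comm, Finset.mul_sum]
  exact mul_nonpos_of_nonneg_of_nonpos (sq_nonneg _) (Finset.sum_nonpos fun k _ => h1 k)

end SelfConsistent

/-! ### Stability of the semicircle equation -/

section Stability

/-- When the imaginary parts have opposite signs they add up in `z - w`. This is the only source of
lower bounds in the stability argument. -/
theorem abs_im_le_norm_sub {z w : ℂ} (h : z.im * w.im ≤ 0) : |z.im| ≤ ‖z - w‖ := by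
  refine le_trans ?_ (Complex.abs_im_le_norm _)
  rw [Complex.sub_im, ← sq_le_sq]
  nlinarith [sq_nonneg w.im]

/-- Stability of the self-consistent equation of the semicircle law. -/
theorem norm_sub_mul_le_of_selfConsistent {σ E : ℝ} (hσ : 0 < σ) {z g h f p : ℂ} (hz : z.im ≠ 0)
    (hg : g * (z - σ ^ 2 * g) = 1) (hgσ : ‖g‖ ≤ 1 / σ) (hgi : z.im * g.im ≤ 0)
    (hhi : z.im * h.im ≤ 0) (hh : ‖(z - σ ^ 2 * h) * h - 1‖ ≤ E)
    (hf : ‖(z - σ ^ 2 * h) * f - p‖ ≤ E) (hp : ‖p‖ ≤ 1) :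
    ‖f - g * p‖ ≤ E * (|z.im|⁻¹ + σ * (|z.im|⁻¹) ^ 2) := by
  have hη := abs_pos.2 hz
  have him : ∀ w : ℂ, ((σ : ℂ) ^ 2 * w).im = σ ^ 2 * w.im := by
    intro w; rw [← Complex.ofReal_pow, Complex.im_ofReal_mul]
  have k1 : |z.im| ≤ ‖z - σ ^ 2 * h‖ := abs_im_le_norm_sub (by
    rw [him]; nlinarith [sq_nonneg σ])
  have k2 : |z.im| ≤ ‖z - σ ^ 2 * (h + g)‖ := abs_im_le_norm_sub (by
    rw [him, Complex.add_im]; nlinarith [sq_nonneg σ])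
  -- The difference of the two quadratic equations factors through `h - g`, and `k2` bounds the
  -- cofactor below, so neither a choice of branch nor a restriction on `z` is needed.
  have h1 : (z - σ ^ 2 * (h + g)) * (h - g) = (z - σ ^ 2 * h) * h - 1 := by
    linear_combination -hg
  have h2 : ‖h - g‖ ≤ E * |z.im|⁻¹ := by
    rw [← div_eq_mul_inv, le_div_iff₀ hη, mul_comm]
    calc _ ≤ ‖z - σ ^ 2 * (h + g)‖ * ‖h - g‖ := by gcongr
      _ ≤ E := by rw [← norm_mul, h1]; exact hh
  -- The equation of `g` is used to compare `g p` with the solution of the linear equation of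
  -- coefficient `z - σ²h`; the price is the error `h - g`, multiplied by `σ² g` of modulus at most
  -- `σ`.
  have h3 : (z - σ ^ 2 * h) * (f - g * p)
      = ((z - σ ^ 2 * h) * f - p) + p * (σ ^ 2 * (h - g) * g) := by
    linear_combination p * (1 : ℂ) * (-hg)
  have hE : 0 ≤ E := (norm_nonneg _).trans hh
  have h4 : ‖p * (σ ^ 2 * (h - g) * g)‖ ≤ 1 * (σ ^ 2 * (E * |z.im|⁻¹) * (1 / σ)) := by
    rw [norm_mul, norm_mul, norm_mul, norm_pow, Complex.norm_real, Real.norm_of_nonneg hσ.le]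
    gcongr
  have h5 : ‖f - g * p‖ ≤ (E + σ * (E * |z.im|⁻¹)) * |z.im|⁻¹ := by
    rw [← div_eq_mul_inv _ |z.im|, le_div_iff₀ hη, mul_comm]
    calc _ ≤ ‖z - σ ^ 2 * h‖ * ‖f - g * p‖ := by gcongr
      _ ≤ E + 1 * (σ ^ 2 * (E * |z.im|⁻¹) * (1 / σ)) := by
          rw [← norm_mul, h3]
          exact (norm_add_le _ _).trans (add_le_add hf h4)
      _ = _ := by field_simp
  refine h5.trans (le_of_eq ?_)
  ring

end Stability

/-! ### The mean of the resolvent forms -/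

section Mean

variable {Ω : Type*} [MeasurableSpace Ω] {μ : Measure Ω} [IsProbabilityMeasure μ] {N : ℕ}
  {σ τ L : ℝ} {W : Ω → Matrix (Fin N) (Fin N) ℂ} {z : ℂ} {u v : Fin N → ℂ}

/-- The expectation of a resolvent form of a Wigner matrix. -/
theorem IsWignerModel.norm_integral_form_sub_le [NeZero N] (hW : IsWignerModel μ σ τ L W)
    (hσ : 0 < σ) (hz : z.im ≠ 0) (hu : ∑ i, ‖u i‖ ^ 2 ≤ 1) (hv : ∑ i, ‖v i‖ ^ 2 ≤ 1) :
    ‖∫ ω, u ⬝ᵥ (resolventMatrix (W ω) z *ᵥ v) ∂μ - semicircleStieltjes σ z * (u ⬝ᵥ v)‖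
      ≤ (errorConst σ L * (2 + 2 * σ) + 8 * L ^ 2) * scale N
        * ((|z.im|⁻¹) ^ 3 + (|z.im|⁻¹) ^ 7) := by
  have hη := abs_pos.2 hz
  have ht := scale_pos (N := N)
  have ht1 := scale_le_one (N := N)
  have hL := hW.one_le
  have hH := hW.isHermitian
  have hx0 : 0 < |z.im|⁻¹ := inv_pos.2 hη
  have hK : 0 ≤ errorConst σ L := by unfold errorConst; positivity
  obtain ⟨hg, hgσ, hgi⟩ := semicircleStieltjes_spec hσ hz
  set g := semicircleStieltjes σ z
  have hp : ‖u ⬝ᵥ v‖ ≤ 1 := by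
    have h := norm_dotProduct_le (p := u) (q := v) zero_le_one zero_le_one (by simpa using hu)
      (by simpa using hv)
    refine (norm_sum_le _ _).trans (le_trans (le_of_eq ?_) (h.trans (by norm_num)))
    simp_rw [norm_mul]
  rcases le_or_gt (scale N * (2 * L) / |z.im|) 1 with hε | hε
  · have h := norm_sub_mul_le_of_selfConsistent hσ hz hg hgσ hgi (hW.im_mul_im_meanTrace_nonpos hz)
      (hW.norm_meanTrace_eq_le hz hε) (hW.norm_selfConsistent_le hz hu hv hε) hp
    refine h.trans ?_
    set x := |z.im|⁻¹
    set t := scale N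
    have hpow : ∀ k, 3 ≤ k → k ≤ 7 → x ^ k ≤ x ^ 3 + x ^ 7 := by
      intro k h3 h7
      rcases le_total x 1 with h | h
      · have := pow_le_pow_of_le_one hx0.le h h3
        have := pow_pos hx0 7
        linarith
      · have := pow_le_pow_right₀ h h7
        have := pow_pos hx0 3
        linarith
    have h4 := mul_le_mul_of_nonneg_left (hpow 4 (by norm_num) (by norm_num)) hσ.le
    have h6 := hpow 6 (by norm_num) (by norm_num)
    have h3 := pow_pos hx0 3
    have h7 := pow_pos hx0 7
    have hsum : (x ^ 2 + x ^ 5) * (x + σ * x ^ 2) ≤ (2 + 2 * σ) * (x ^ 3 + x ^ 7) := by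
      have e : (x ^ 2 + x ^ 5) * (x + σ * x ^ 2) = x ^ 3 + σ * x ^ 4 + x ^ 6 + σ * x ^ 7 := by ring
      rw [e]
      nlinarith [mul_pos hσ h3, mul_pos hσ h7]
    calc errorConst σ L * t * (x ^ 2 + x ^ 5) * (x + σ * x ^ 2)
        = errorConst σ L * t * ((x ^ 2 + x ^ 5) * (x + σ * x ^ 2)) := by ring
      _ ≤ errorConst σ L * t * ((2 + 2 * σ) * (x ^ 3 + x ^ 7)) := by gcongr
      _ = errorConst σ L * (2 + 2 * σ) * t * (x ^ 3 + x ^ 7) := by ring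
      _ ≤ _ := by
        gcongr
        have : 0 ≤ 8 * L ^ 2 := by positivity
        linarith
  · have hF : ‖∫ ω, u ⬝ᵥ (resolventMatrix (W ω) z *ᵥ v) ∂μ‖ ≤ |z.im|⁻¹ := by
      have := norm_integral_le_of_norm_le_const (μ := μ) (C := 1 / |z.im|)
        (Filter.Eventually.of_forall fun ω => norm_form_le (hH ω) hz hu hv)
      simpa using this
    have hgx : ‖g‖ ≤ |z.im|⁻¹ := by
      have k1 : |z.im| ≤ ‖z - σ ^ 2 * g‖ := abs_im_le_norm_sub (by
        rw [← Complex.ofReal_pow, Complex.im_ofReal_mul]; nlinarith [sq_nonneg σ])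
      have k2 : ‖g‖ * ‖z - σ ^ 2 * g‖ = 1 := by rw [← norm_mul, hg, norm_one]
      rw [← one_div, le_div_iff₀ hη, ← k2]
      gcongr
    have htot : ‖∫ ω, u ⬝ᵥ (resolventMatrix (W ω) z *ᵥ v) ∂μ - g * (u ⬝ᵥ v)‖
        ≤ |z.im|⁻¹ + |z.im|⁻¹ * 1 := by
      refine (norm_sub_le _ _).trans (add_le_add hF ?_)
      rw [norm_mul]
      gcongr
    refine htot.trans ?_
    rw [div_eq_mul_inv] at hε
    set x := |z.im|⁻¹
    set t := scale N
    have h1 : 1 ≤ 2 * L * t * x := by linarith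
    have h2 : 1 ≤ 2 * L * x := by
      refine h1.trans ?_
      have : t * (2 * L * x) ≤ 1 * (2 * L * x) := by gcongr
      linarith
    -- Multiplying the trivial bound `2x` by these factors gives `8L² t x³`. The first supplies the
    -- factor `t`; the second raises the power of `x` to three, so that `x³ + x⁷` dominates it.
    have h3 : 1 * 1 ≤ (2 * L * t * x) * (2 * L * x) := mul_le_mul h1 h2 zero_le_one (by positivity)
    have h4 := mul_le_mul_of_nonneg_left h3 (show 0 ≤ 2 * x by positivity)
    have h5 : 2 * x * ((2 * L * t * x) * (2 * L * x)) = 8 * L ^ 2 * t * x ^ 3 := by ring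
    calc x + x * 1 ≤ 8 * L ^ 2 * t * x ^ 3 := by linarith
      _ ≤ (errorConst σ L * (2 + 2 * σ) + 8 * L ^ 2) * t * (x ^ 3 + x ^ 7) := by
        gcongr
        · have : 0 ≤ errorConst σ L * (2 + 2 * σ) := by positivity
          linarith
        · have := pow_pos hx0 7
          linarith

end Mean

/-! ### Translation to unit vectors and the final bounds -/

/-- The preceding estimates concern the bilinear pairing `⬝ᵥ`; the conjugation of the inner product
is absorbed into `u`, which does not change its norm. -/
theorem resolventForm_eq {N : ℕ} (W : Matrix (Fin N) (Fin N) ℂ) (u v : EuclideanSpace ℂ (Fin N))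
    (z : ℂ) :
    resolventForm W u v z = star (WithLp.ofLp u) ⬝ᵥ (resolventMatrix W z *ᵥ WithLp.ofLp v) := by
  unfold resolventForm
  rw [EuclideanSpace.inner_eq_star_dotProduct, dotProduct_comm]
  rfl

theorem inner_eq_dotProduct {N : ℕ} (u v : EuclideanSpace ℂ (Fin N)) :
    inner ℂ u v = star (WithLp.ofLp u) ⬝ᵥ WithLp.ofLp v := by
  rw [EuclideanSpace.inner_eq_star_dotProduct, dotProduct_comm]

theorem sum_norm_sq_le_one {N : ℕ} {v : EuclideanSpace ℂ (Fin N)} (hv : ‖v‖ = 1) :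
    ∑ i, ‖WithLp.ofLp v i‖ ^ 2 ≤ 1 := by
  rw [← EuclideanSpace.norm_sq_eq, hv, one_pow]

theorem neZero_of_norm_eq_one {N : ℕ} {v : EuclideanSpace ℂ (Fin N)} (hv : ‖v‖ = 1) :
    NeZero N := by
  refine ⟨?_⟩
  rintro rfl
  rw [Subsingleton.elim v 0, norm_zero] at hv
  exact zero_ne_one hv

open Polynomial in
/-- The polynomial `1 + X + ⋯ + X ^ n`. -/
noncomputable def geomPolynomial (n : ℕ) : Polynomial ℝ := ∑ k ∈ Finset.range (n + 1), X ^ k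

theorem coeff_geomPolynomial (n k : ℕ) :
    (geomPolynomial n).coeff k = if k ≤ n then 1 else 0 := by
  simp [geomPolynomial, Polynomial.coeff_X_pow]

theorem isPositivePolynomial_geomPolynomial (n : ℕ) :
    IsPositivePolynomial n (geomPolynomial n) := by
  refine ⟨Polynomial.natDegree_eq_of_le_of_coeff_ne_zero ?_ ?_, fun k hk => ?_⟩
  · rw [Polynomial.natDegree_le_iff_coeff_eq_zero]
    intro k hk
    rw [coeff_geomPolynomial, if_neg (by omega)]
  · rw [coeff_geomPolynomial, if_pos le_rfl]
    exact one_ne_zero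
  · rw [coeff_geomPolynomial, if_pos hk]
    exact one_pos

theorem pow_add_pow_le_eval_geomPolynomial {n a b : ℕ} {x : ℝ} (hx : 0 ≤ x) (hab : a ≠ b)
    (ha : a ≤ n) (hb : b ≤ n) : x ^ a + x ^ b ≤ (geomPolynomial n).eval x := by
  rw [geomPolynomial, Polynomial.eval_finsetSum]
  simp only [Polynomial.eval_pow, Polynomial.eval_X]
  rw [← Finset.sum_pair (f := fun k => x ^ k) hab]
  refine Finset.sum_le_sum_of_subset_of_nonneg ?_ fun k _ _ => pow_nonneg hx k
  intro k hk
  simp only [Finset.mem_insert, Finset.mem_singleton] at hk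
  rw [Finset.mem_range]
  omega

/-- Both moment bounds for the resolvent forms, in terms of unit vectors of `EuclideanSpace`. -/
theorem IsWigner.resolventForm_bounds {Ω : Type u} [MeasurableSpace Ω] {μ : Measure Ω}
    [IsProbabilityMeasure μ] {N : ℕ} {σ m₅ c₃ : ℝ} (hσ : 0 < σ)
    {W : Ω → Matrix (Fin N) (Fin N) ℂ} (hW : IsWigner μ σ m₅ c₃ W)
    {u v : EuclideanSpace ℂ (Fin N)} (hu : ‖u‖ = 1) (hv : ‖v‖ = 1) {z : ℂ} (hz : z.im ≠ 0)
    {L : ℝ} (hL : L = 1 + |m₅| + |c₃|) :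
    MemLp (fun ω => resolventForm (W ω) u v z) 2 μ ∧
    ‖(∫ ω, resolventForm (W ω) u v z ∂μ) - semicircleStieltjes σ z * inner ℂ u v‖
      ≤ (errorConst σ L * (2 + 2 * σ) + 8 * L ^ 2) * scale N
        * ((|z.im|⁻¹) ^ 3 + (|z.im|⁻¹) ^ 7) ∧
    complexVariance μ (fun ω => resolventForm (W ω) u v z)
      ≤ 10000 * L ^ 3 * scale N ^ 2 * ((|z.im|⁻¹) ^ 4 + (|z.im|⁻¹) ^ 6) := by
  have := neZero_of_norm_eq_one hv
  obtain ⟨τ, hM⟩ := hW.exists_isWignerModel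
  rw [← hL] at hM
  have hu' : ∑ i, ‖star (WithLp.ofLp u) i‖ ^ 2 ≤ 1 := by
    simpa using sum_norm_sq_le_one hu
  simp_rw [resolventForm_eq, inner_eq_dotProduct]
  exact ⟨hM.memLp_form hz hu' (sum_norm_sq_le_one hv),
    hM.norm_integral_form_sub_le hσ hz hu' (sum_norm_sq_le_one hv),
    hM.variance_form_le hz hu' (sum_norm_sq_le_one hv)⟩

end WignerResolvent

theorem proposition2p1 (σ m₅ c₃ : ℝ) (hσ : 0 < σ) :
    (∀ B : Set ℂ, Bornology.IsBounded B → (∀ z ∈ B, z.im ≠ 0) →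
      ∃ C : ℝ, ∀ (N : ℕ) (Ω : Type u) [MeasurableSpace Ω] (μ : Measure Ω)
        [IsProbabilityMeasure μ] (W : Ω → Matrix (Fin N) (Fin N) ℂ),
        WignerResolvent.IsWigner μ σ m₅ c₃ W →
        ∀ u v : EuclideanSpace ℂ (Fin N), ‖u‖ = 1 → ‖v‖ = 1 → ∀ z ∈ B,
          Integrable (fun ω => WignerResolvent.resolventForm (W ω) u v z) μ ∧
          ‖(∫ ω, WignerResolvent.resolventForm (W ω) u v z ∂μ)
              - WignerResolvent.semicircleStieltjes σ z * inner ℂ u v‖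
            ≤ C * (1 / (|z.im| ^ 7 * Real.sqrt N))) ∧
    (∃ (C M : ℝ) (P₈ : Polynomial ℝ), WignerResolvent.IsPositivePolynomial 8 P₈ ∧
      ∀ (N : ℕ) (Ω : Type u) [MeasurableSpace Ω] (μ : Measure Ω)
        [IsProbabilityMeasure μ] (W : Ω → Matrix (Fin N) (Fin N) ℂ),
        WignerResolvent.IsWigner μ σ m₅ c₃ W →
        ∀ u v : EuclideanSpace ℂ (Fin N), ‖u‖ = 1 → ‖v‖ = 1 → ∀ z : ℂ, z.im ≠ 0 →
          Integrable (fun ω => WignerResolvent.resolventForm (W ω) u v z) μ ∧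
          ‖(∫ ω, WignerResolvent.resolventForm (W ω) u v z ∂μ)
              - WignerResolvent.semicircleStieltjes σ z * inner ℂ u v‖
            ≤ C * ((‖z‖ + M) * (P₈.eval (|z.im|⁻¹) / Real.sqrt N))) ∧
    (∃ (C : ℝ) (P₈ : Polynomial ℝ), WignerResolvent.IsPositivePolynomial 8 P₈ ∧
      ∀ (N : ℕ) (Ω : Type u) [MeasurableSpace Ω] (μ : Measure Ω)
        [IsProbabilityMeasure μ] (W : Ω → Matrix (Fin N) (Fin N) ℂ),
        WignerResolvent.IsWigner μ σ m₅ c₃ W →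
        ∀ u v : EuclideanSpace ℂ (Fin N), ‖u‖ = 1 → ‖v‖ = 1 → ∀ z : ℂ, z.im ≠ 0 →
          MemLp (fun ω => WignerResolvent.resolventForm (W ω) u v z) 2 μ ∧
          WignerResolvent.complexVariance μ
              (fun ω => WignerResolvent.resolventForm (W ω) u v z)
            ≤ C * (P₈.eval (|z.im|⁻¹) / N)) := by
  open WignerResolvent in
  set L : ℝ := 1 + |m₅| + |c₃| with hL
  have hL0 : 0 ≤ L := by positivity
  set K : ℝ := errorConst σ L * (2 + 2 * σ) + 8 * L ^ 2 with hKdef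
  have hK : 0 ≤ K := by
    have : 0 ≤ errorConst σ L := by unfold errorConst; positivity
    positivity
  refine ⟨?_, ?_, ?_⟩
  · intro B hB hBim
    obtain ⟨r, hr⟩ := isBounded_iff_forall_norm_le.1 hB
    -- On a set of radius `r` one has `x³ = η⁴ x⁷ ≤ r⁴ x⁷`, so `x³ + x⁷ ≤ (r⁴ + 1) x⁷`.
    refine ⟨K * (r ^ 4 + 1), fun N Ω _ μ _ W hW u v hu hv z hzB => ?_⟩
    have hz := hBim z hzB
    have hη := abs_pos.2 hz
    obtain ⟨hmem, hmean, -⟩ := hW.resolventForm_bounds hσ hu hv hz hL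
    refine ⟨hmem.integrable (by norm_num), hmean.trans ?_⟩
    have hle : |z.im| ≤ r := (Complex.abs_im_le_norm z).trans (hr z hzB)
    have hx7 : (|z.im|⁻¹) ^ 3 ≤ r ^ 4 * (|z.im|⁻¹) ^ 7 := by
      have h1 : |z.im| ^ 4 * (|z.im|⁻¹) ^ 7 = (|z.im|⁻¹) ^ 3 := by field_simp
      rw [← h1]
      gcongr
    have ht := scale_nonneg N
    calc K * scale N * ((|z.im|⁻¹) ^ 3 + (|z.im|⁻¹) ^ 7)
        ≤ K * scale N * (r ^ 4 * (|z.im|⁻¹) ^ 7 + (|z.im|⁻¹) ^ 7) := by gcongr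
      _ = K * (r ^ 4 + 1) * ((|z.im|⁻¹) ^ 7 * scale N) := by ring
      _ = _ := by
        congr 1
        rw [scale, inv_pow, one_div, one_div, mul_inv]
  -- The bound holds without growth in `|z|`, so `M = 1` only serves to make `|z| + M ≥ 1`. The
  -- polynomial with all coefficients one dominates `x³ + x⁷`.
  · refine ⟨K, 1, geomPolynomial 8, isPositivePolynomial_geomPolynomial 8,
      fun N Ω _ μ _ W hW u v hu hv z hz => ?_⟩
    obtain ⟨hmem, hmean, -⟩ := hW.resolventForm_bounds hσ hu hv hz hL
    refine ⟨hmem.integrable (by norm_num), hmean.trans ?_⟩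
    have hx0 : 0 ≤ |z.im|⁻¹ := by positivity
    have hP := pow_add_pow_le_eval_geomPolynomial (n := 8) (a := 3) (b := 7) hx0 (by norm_num)
      (by norm_num) (by norm_num)
    have ht := scale_nonneg N
    have hP0 : 0 ≤ (geomPolynomial 8).eval (|z.im|⁻¹) := le_trans (by positivity) hP
    calc K * scale N * ((|z.im|⁻¹) ^ 3 + (|z.im|⁻¹) ^ 7)
        ≤ K * scale N * (geomPolynomial 8).eval (|z.im|⁻¹) := by gcongr
      _ = K * (1 * ((geomPolynomial 8).eval (|z.im|⁻¹) / Real.sqrt N)) := by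
          rw [scale]; ring
      _ ≤ _ := by
          gcongr
          linarith [norm_nonneg z]
  · refine ⟨10000 * L ^ 3, geomPolynomial 8, isPositivePolynomial_geomPolynomial 8,
      fun N Ω _ μ _ W hW u v hu hv z hz => ?_⟩
    obtain ⟨hmem, -, hvar⟩ := hW.resolventForm_bounds hσ hu hv hz hL
    refine ⟨hmem, hvar.trans ?_⟩
    have hx0 : 0 ≤ |z.im|⁻¹ := by positivity
    have hP := pow_add_pow_le_eval_geomPolynomial (n := 8) (a := 4) (b := 6) hx0 (by norm_num)
      (by norm_num) (by norm_num)
    calc 10000 * L ^ 3 * scale N ^ 2 * ((|z.im|⁻¹) ^ 4 + (|z.im|⁻¹) ^ 6)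
        ≤ 10000 * L ^ 3 * scale N ^ 2 * (geomPolynomial 8).eval (|z.im|⁻¹) := by gcongr
      _ = _ := by rw [scale_sq]; ring
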